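/- Let $(W,S)$ be a Coxeter system of type $A_2$ (so $W\cong S_3$), with identity $e$ and set of reflections $T$ ($|T|=3$). Let $V$ be a reflection faithful real representation of $W$, i.e. a finite-dimensional faithful representation such that, for $w\in W$, the fixed space $V^w$ has codimension $1$ if and only if $w\in T$. Let $R$ be the $\mathbb R$-algebra of polynomial functions on $V$, graded so that $V^*$ is in degree $2$, with its induced $W$-action. We consider $\mathbb Z$-graded $(R,R)$-bimodules on which the two actions of $\mathbb R$ agree, with degree-$0$ bimodule homomorphisms as morphisms, and write $M(n)_i=M_{n+i}$ for the grading shift. For $t\in T$ let $R^t$ be the subalgebra of $t$-invariants and $B_t=R\otimes_{R^t}R(1)$. Let $\mathcal C$ be the full subcategory whose objects are the direct summands of finite direct sums of shifts $(B_{t_1}\otimes_R\cdots\otimes_R B_{t_k})(n)$, with $k\ge 0$, $t_1,\dots,t_k\in T$, $n\in\mathbb Z$ (for $k=0$ the tensor product is $R$). For $x\in W$ let $\mathrm{Gr}(x)=\{(xv,v)\mid v\in V\}\subseteq V\times V$. For $A\subseteq W$ let $R(A)$ be the graded $\mathbb R$-algebra of regular functions (restrictions of polynomial functions) on $\bigcup_{x\in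 A}\mathrm{Gr}(x)$, with linear forms in degree $2$, regarded as a graded $R$-bimodule by $(a\cdot f\cdot b)(u,v)=a(u)f(u,v)b(v)$. Let $\mathcal X$ be the set of nonempty subsets $A\subseteq W$ such that $tA=A$ for some $t\in T$. Then: 1. A bimodule $X\in\mathcal C$ is indecomposable if and only if it is isomorphic to $R(n)$ or to $R(A)(n)$ for some $n\in\mathbb Z$ and some $A\in\mathcal X$. All the bimodules $R(n)$ and $R(A)(n)$, with $n\in\mathbb Z$ and $A\in\mathcal X$, lie in $\mathcal C$, and they are pairwise non-isomorphic. 2. $|\mathcal X|=19$. 3. Let $\mathcal A(W)=\langle\mathcal C\rangle$ be the split Grothendieck ring of $\mathcal C$: the abelian group generated by the isomorphism classes $[X]$ of objects $X$ of $\mathcal C$, with relations $[X\oplus Y]=[X]+[Y]$ and product $[X][Y]=[X\otimes_R Y]$. It is a $\mathbb Z[v^{\pm1}]$-algebra, with $v\,[X]=[X(1)]$. As a $\mathbb Z[v^{\pm1}]$-module, $\mathcal A(W)$ is free of rank $20$. -/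

import Mathlib

open CategoryTheory Limits MonoidalCategory TensorProduct

universe u

/-! ### Graded vector spaces -/

section Gradings

variable {M : Type*} [AddCommGroup M] [Module ℝ M]

theorem isInternal_of_components (G : ℤ → Submodule ℝ M) (htop : ⨆ k, G k = ⊤)
    (δ : M →ₗ[ℝ] (ℤ →₀ M)) (hδ : ∀ k, ∀ m ∈ G k, δ m = Finsupp.single k m) :
    DirectSum.IsInternal G := by
  classical
  rw [DirectSum.isInternal_submodule_iff_iSupIndep_and_iSup_eq_top]
  refine ⟨?_, htop⟩
  rw [iSupIndep_def]
  intro k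
  rw [Submodule.disjoint_def]
  intro m hm hm'
  have h1 := hδ k m hm
  have key : ∀ x ∈ ⨆ j, ⨆ (_ : j ≠ k), G j, δ x k = 0 := by
    intro x hx
    have : (⨆ j, ⨆ (_ : j ≠ k), G j) ≤ LinearMap.ker ((Finsupp.lapply k) ∘ₗ δ) := by
      refine iSup₂_le fun j hj y hy => ?_
      simp [hδ j y hy, hj]
    exact this hx
  have := key m hm'
  rw [h1] at this
  simpa using this

theorem exists_components (G : ℤ → Submodule ℝ M) (h : DirectSum.IsInternal G) :
    ∃ δ : M →ₗ[ℝ] (ℤ →₀ M), ∀ k, ∀ m ∈ G k, δ m = Finsupp.single k m := by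
  classical
  let e := LinearEquiv.ofBijective (DirectSum.coeLinearMap G) h
  refine ⟨(DirectSum.toModule ℝ ℤ (ℤ →₀ M)
    (fun k => (Finsupp.lsingle k) ∘ₗ (G k).subtype)) ∘ₗ e.symm.toLinearMap, fun k m hm => ?_⟩
  have : e.symm m = DirectSum.lof ℝ ℤ (fun k => G k) k ⟨m, hm⟩ := by
    rw [LinearEquiv.symm_apply_eq]
    exact (DirectSum.coeLinearMap_lof G k ⟨m, hm⟩).symm
  simp [this]

theorem mem_iSup_inf_eqLocus {M : Type*} [AddCommGroup M] [Module ℝ M] (G : ℤ → Submodule ℝ M)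
    (h : DirectSum.IsInternal G)
    (τ : M →ₗ[ℝ] M) (hτ : ∀ k, ∀ m ∈ G k, τ m ∈ G k) (m : M) (hm : τ m = m) :
    m ∈ ⨆ k, G k ⊓ LinearMap.eqLocus τ LinearMap.id := by
  obtain ⟨δ, hδ⟩ := exists_components G h
  have htop := h.submodule_iSup_eq_top
  have key : ∀ x : M, (δ x).sum (fun _ y => y) = x ∧ (∀ k, δ x k ∈ G k) ∧
      ∀ k, δ (τ x) k = τ (δ x k) := by
    intro x
    have hx : x ∈ ⨆ k, G k := by rw [htop]; trivial
    induction hx using Submodule.iSup_induction' with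
    | mem i x hx =>
      refine ⟨by rw [hδ i x hx, Finsupp.sum_single_index rfl], fun k => ?_, fun k => ?_⟩
      · rw [hδ i x hx, Finsupp.single_apply]
        split_ifs with h
        · exact h ▸ hx
        · exact zero_mem _
      · rw [hδ i x hx, hδ i _ (hτ i x hx), Finsupp.single_apply, Finsupp.single_apply]
        split_ifs
        · rfl
        · rw [map_zero]
    | zero => simp
    | add x y _ _ hx hy =>
      refine ⟨?_, fun k => ?_, fun k => ?_⟩
      · rw [map_add, Finsupp.sum_add_index' (fun _ => rfl) (fun _ _ _ => rfl), hx.1, hy.1]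
      · rw [map_add]
        exact add_mem (hx.2.1 k) (hy.2.1 k)
      · rw [map_add, map_add, map_add, Finsupp.add_apply, Finsupp.add_apply, map_add, hx.2.2,
          hy.2.2]
  obtain ⟨h1, h2, h3⟩ := key m
  rw [← h1]
  refine Submodule.sum_mem _ fun k _ => Submodule.mem_iSup_of_mem k ⟨h2 k, ?_⟩
  change τ (δ m k) = δ m k
  rw [← h3, hm]

end Gradings

/-! ### Graded bimodules -/

section Bimodules

variable {R : Type u} [CommRing R] [Algebra ℝ R]

/-- A `ℤ`-graded bimodule over the commutative graded `ℝ`-algebra `R = ⨁ 𝒜 i`, on which `ℝ` acts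
in the same way from both sides. As `R` is commutative, a right action of `R` is the same as an
algebra homomorphism from `R` to the endomorphisms: `lact a m = a m` and `ract b m = m b`. -/
structure GrBimod (𝒜 : ℤ → Submodule ℝ R) : Type (u + 1) where
  carrier : Type u
  [addCommGroup : AddCommGroup carrier]
  [module : Module ℝ carrier]
  lact : R →ₐ[ℝ] Module.End ℝ carrier
  ract : R →ₐ[ℝ] Module.End ℝ carrier
  lact_ract : ∀ a b m, lact a (ract b m) = ract b (lact a m)
  deg : ℤ → Submodule ℝ carrier
  isInternal : DirectSum.IsInternal deg
  lact_mem : ∀ {i j a m}, a ∈ 𝒜 i → m ∈ deg j → lact a m ∈ deg (i + j)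
  ract_mem : ∀ {i j b m}, m ∈ deg i → b ∈ 𝒜 j → ract b m ∈ deg (i + j)

namespace GrBimod

variable {𝒜 : ℤ → Submodule ℝ R}

attribute [instance] addCommGroup module

/-- Morphisms of graded bimodules: bimodule homomorphisms which preserve degrees. -/
@[ext]
structure Hom (M N : GrBimod 𝒜) : Type u where
  toLin : M.carrier →ₗ[ℝ] N.carrier
  map_lact : ∀ a m, toLin (M.lact a m) = N.lact a (toLin m)
  map_ract : ∀ b m, toLin (M.ract b m) = N.ract b (toLin m)
  map_deg : ∀ i, ∀ m ∈ M.deg i, toLin m ∈ N.deg i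

instance : Category (GrBimod 𝒜) where
  Hom := Hom
  id M := ⟨LinearMap.id, by simp, by simp, by simp⟩
  comp f g := ⟨g.toLin ∘ₗ f.toLin, by simp [f.map_lact, g.map_lact],
    by simp [f.map_ract, g.map_ract], fun i m hm => g.map_deg i _ (f.map_deg i m hm)⟩

section HomLemmas

variable {M N P : GrBimod 𝒜}

theorem hom_ext {f g : M ⟶ N} (h : ∀ m, f.toLin m = g.toLin m) : f = g :=
  Hom.ext (LinearMap.ext h)

@[simp] theorem id_toLin (m : M.carrier) : Hom.toLin (𝟙 M) m = m := rfl

@[simp] theorem comp_toLin (f : M ⟶ N) (g : N ⟶ P) (m : M.carrier) :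
    Hom.toLin (f ≫ g) m = g.toLin (f.toLin m) := rfl

/-- The homomorphism given by a linear map with the required properties. -/
def ofLin (f : M.carrier →ₗ[ℝ] N.carrier) (h₁ : ∀ a m, f (M.lact a m) = N.lact a (f m))
    (h₂ : ∀ b m, f (M.ract b m) = N.ract b (f m)) (h₃ : ∀ i, ∀ m ∈ M.deg i, f m ∈ N.deg i) :
    M ⟶ N :=
  Hom.mk f h₁ h₂ h₃

@[simp] theorem ofLin_toLin (f : M.carrier →ₗ[ℝ] N.carrier) (h₁ h₂ h₃) (m : M.carrier) :
    Hom.toLin (ofLin (M := M) (N := N) f h₁ h₂ h₃) m = f m := rfl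

instance : Zero (M ⟶ N) := ⟨ofLin 0 (by simp) (by simp) (by simp)⟩

instance : Add (M ⟶ N) := ⟨fun f g => ofLin (f.toLin + g.toLin)
  (by simp [f.map_lact, g.map_lact]) (by simp [f.map_ract, g.map_ract])
  (fun i m hm => add_mem (f.map_deg i m hm) (g.map_deg i m hm))⟩

instance : Neg (M ⟶ N) := ⟨fun f => ofLin (-f.toLin)
  (by simp [f.map_lact]) (by simp [f.map_ract])
  (fun i m hm => neg_mem (f.map_deg i m hm))⟩

@[simp] theorem zero_toLin (m : M.carrier) : Hom.toLin (0 : M ⟶ N) m = 0 := rfl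

@[simp] theorem add_toLin (f g : M ⟶ N) (m : M.carrier) :
    Hom.toLin (f + g) m = f.toLin m + g.toLin m := rfl

@[simp] theorem neg_toLin (f : M ⟶ N) (m : M.carrier) : Hom.toLin (-f) m = -f.toLin m := rfl

instance : AddCommGroup (M ⟶ N) where
  add_assoc f g h := hom_ext fun m => by simp [add_assoc]
  zero_add f := hom_ext fun m => by simp
  add_zero f := hom_ext fun m => by simp
  nsmul := nsmulRec
  zsmul := zsmulRec
  neg_add_cancel f := hom_ext fun m => by simp
  add_comm f g := hom_ext fun m => by simp [add_comm]

end HomLemmas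

instance : Preadditive (GrBimod 𝒜) where
  add_comp _ _ _ f f' g := hom_ext fun m => by simp
  comp_add _ _ _ f g g' := hom_ext fun m => by simp

/-- The direct sum of two graded bimodules. -/
def dirSum (M N : GrBimod 𝒜) : GrBimod 𝒜 where
  carrier := M.carrier × N.carrier
  lact := AlgHom.ofLinearMap
    { toFun := fun a => (M.lact a).prodMap (N.lact a)
      map_add' := fun a b => by ext <;> simp
      map_smul' := fun a b => by ext <;> simp } (by ext <;> simp) (fun a b => by ext <;> simp)
  ract := AlgHom.ofLinearMap
    { toFun := fun a => (M.ract a).prodMap (N.ract a)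
      map_add' := fun a b => by ext <;> simp
      map_smul' := fun a b => by ext <;> simp } (by ext <;> simp) (fun a b => by ext <;> simp)
  lact_ract a b m := by simp [M.lact_ract, N.lact_ract]
  deg i := (M.deg i).prod (N.deg i)
  isInternal := by
    obtain ⟨δ, hδ⟩ := exists_components _ M.isInternal
    obtain ⟨ε, hε⟩ := exists_components _ N.isInternal
    refine isInternal_of_components _ ?_
      (Finsupp.mapRange.linearMap (LinearMap.inl ℝ _ _) ∘ₗ δ ∘ₗ LinearMap.fst ℝ _ _ +
        Finsupp.mapRange.linearMap (LinearMap.inr ℝ _ _) ∘ₗ ε ∘ₗ LinearMap.snd ℝ _ _) ?_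
    · rw [eq_top_iff]
      rintro ⟨x, y⟩ -
      have hx : x ∈ ⨆ k, M.deg k := by rw [M.isInternal.submodule_iSup_eq_top]; trivial
      have hy : y ∈ ⨆ k, N.deg k := by rw [N.isInternal.submodule_iSup_eq_top]; trivial
      have h1 : (⨆ k, M.deg k) ≤ (⨆ k, (M.deg k).prod (N.deg k)).comap (LinearMap.inl ℝ _ _) :=
        iSup_le fun k z hz => Submodule.mem_iSup_of_mem k (by simpa using hz)
      have h2 : (⨆ k, N.deg k) ≤ (⨆ k, (M.deg k).prod (N.deg k)).comap (LinearMap.inr ℝ _ _) :=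
        iSup_le fun k z hz => Submodule.mem_iSup_of_mem k (by simpa using hz)
      have h := add_mem (Submodule.mem_comap.1 (h1 hx)) (Submodule.mem_comap.1 (h2 hy))
      rw [LinearMap.inl_apply, LinearMap.inr_apply, Prod.mk_add_mk, add_zero, zero_add] at h
      exact h
    · rintro k ⟨x, y⟩ ⟨hx, hy⟩
      simp only [LinearMap.add_apply, LinearMap.comp_apply, LinearMap.fst_apply,
        LinearMap.snd_apply, hδ k x hx, hε k y hy, Finsupp.mapRange.linearMap_apply,
        Finsupp.mapRange_single, ← Finsupp.single_add]
      simp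
  lact_mem ha hm := ⟨M.lact_mem ha hm.1, N.lact_mem ha hm.2⟩
  ract_mem hm hb := ⟨M.ract_mem hm.1 hb, N.ract_mem hm.2 hb⟩

/-- The direct sum, with its projections and inclusions. -/
def dirSumBicone (M N : GrBimod 𝒜) : BinaryBicone M N where
  pt := dirSum M N
  fst := Hom.mk (LinearMap.fst ℝ _ _) (fun _ _ => rfl) (fun _ _ => rfl) (fun _ _ hm => hm.1)
  snd := Hom.mk (LinearMap.snd ℝ _ _) (fun _ _ => rfl) (fun _ _ => rfl) (fun _ _ hm => hm.2)
  inl := Hom.mk (LinearMap.inl ℝ _ _) (fun a _ => Prod.ext rfl (map_zero (N.lact a)).symm)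
    (fun a _ => Prod.ext rfl (map_zero (N.ract a)).symm) (fun _ _ hm => ⟨hm, zero_mem _⟩)
  inr := Hom.mk (LinearMap.inr ℝ _ _) (fun a _ => Prod.ext (map_zero (M.lact a)).symm rfl)
    (fun a _ => Prod.ext (map_zero (M.ract a)).symm rfl) (fun _ _ hm => ⟨zero_mem _, hm⟩)
  inl_fst := rfl
  inl_snd := rfl
  inr_fst := rfl
  inr_snd := rfl

instance : HasBinaryBiproducts (GrBimod 𝒜) where
  has_binary_biproduct M N := HasBinaryBiproduct.mk
    { bicone := dirSumBicone M N
      isBilimit := isBinaryBilimitOfTotal _ (hom_ext fun m =>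
        Prod.ext (add_zero m.1) (zero_add m.2)) }

/-- The grading shift `M(n)`, with `M(n)_i = M_{i+n}`. -/
def shift (n : ℤ) (M : GrBimod 𝒜) : GrBimod 𝒜 where
  carrier := M.carrier
  lact := M.lact
  ract := M.ract
  lact_ract := M.lact_ract
  deg i := M.deg (i + n)
  isInternal := by
    classical
    have h := M.isInternal
    rw [DirectSum.isInternal_submodule_iff_iSupIndep_and_iSup_eq_top] at h ⊢
    exact ⟨h.1.comp (add_left_injective n),
      by rw [← h.2]; exact (Equiv.addRight n).iSup_comp (g := M.deg)⟩
  lact_mem ha hm := by simpa [add_assoc] using M.lact_mem ha hm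
  ract_mem {i j b m} hm hb := by simpa [add_right_comm] using M.ract_mem hm hb

/-! ### Tensor products -/

section Balanced

variable (S : Subalgebra ℝ R) (M N : GrBimod 𝒜)

/-- The relations `m s ⊗ n = m ⊗ s n`, for `s ∈ S`. -/
def balRel : Submodule ℝ (M.carrier ⊗[ℝ] N.carrier) :=
  Submodule.span ℝ {z | ∃ s ∈ S, ∃ m n, z = M.ract s m ⊗ₜ[ℝ] n - m ⊗ₜ[ℝ] N.lact s n}

/-- The image of `m ⊗ n` in `M ⊗_S N`. -/
def balMk : M.carrier →ₗ[ℝ] N.carrier →ₗ[ℝ] (M.carrier ⊗[ℝ] N.carrier) ⧸ balRel S M N :=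
  (TensorProduct.mk ℝ M.carrier N.carrier).compr₂ (balRel S M N).mkQ

variable {S M N}

theorem balMk_ract {s : R} (hs : s ∈ S) (m : M.carrier) (n : N.carrier) :
    balMk S M N (M.ract s m) n = balMk S M N m (N.lact s n) := by
  simp only [balMk, LinearMap.compr₂_apply, TensorProduct.mk_apply, Submodule.mkQ_apply]
  rw [Submodule.Quotient.eq]
  exact Submodule.subset_span ⟨s, hs, m, n, rfl⟩

/-- The linear map out of `M ⊗_S N` given by an `S`-balanced bilinear map. -/
def balLift {P : Type*} [AddCommGroup P] [Module ℝ P] (f : M.carrier →ₗ[ℝ] N.carrier →ₗ[ℝ] P)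
    (hf : ∀ s ∈ S, ∀ m n, f (M.ract s m) n = f m (N.lact s n)) :
    ((M.carrier ⊗[ℝ] N.carrier) ⧸ balRel S M N) →ₗ[ℝ] P :=
  (balRel S M N).liftQ (TensorProduct.lift f) (by
    rw [balRel, Submodule.span_le]
    rintro _ ⟨s, hs, m, n, rfl⟩
    simp [hf s hs m n])

@[simp] theorem balLift_balMk {P : Type*} [AddCommGroup P] [Module ℝ P]
    (f : M.carrier →ₗ[ℝ] N.carrier →ₗ[ℝ] P)
    (hf : ∀ s ∈ S, ∀ m n, f (M.ract s m) n = f m (N.lact s n)) (m : M.carrier) (n : N.carrier) :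
    balLift f hf (balMk S M N m n) = f m n := by
  simp [balLift, balMk]

theorem bal_ext {P : Type*} [AddCommGroup P] [Module ℝ P]
    {f g : ((M.carrier ⊗[ℝ] N.carrier) ⧸ balRel S M N) →ₗ[ℝ] P}
    (h : ∀ m n, f (balMk S M N m n) = g (balMk S M N m n)) : f = g := by
  apply Submodule.linearMap_qext
  apply TensorProduct.ext'
  exact h

variable (S M N)

/-- `(M ⊗_S N)_k` is spanned by the `m ⊗ n` with `m ∈ M_i`, `n ∈ N_j` and `i + j = k`. -/
def balDeg (k : ℤ) : Submodule ℝ ((M.carrier ⊗[ℝ] N.carrier) ⧸ balRel S M N) :=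
  Submodule.span ℝ {z | ∃ i j, i + j = k ∧ ∃ m ∈ M.deg i, ∃ n ∈ N.deg j, z = balMk S M N m n}

variable {S M N}

theorem balMk_mem {i j : ℤ} {m : M.carrier} {n : N.carrier} (hm : m ∈ M.deg i)
    (hn : n ∈ N.deg j) : balMk S M N m n ∈ balDeg S M N (i + j) :=
  Submodule.subset_span ⟨i, j, rfl, m, hm, n, hn, rfl⟩

theorem bal_induction (f : M.carrier → Prop) (h : ∀ i, ∀ m ∈ M.deg i, f m)
    (h0 : f 0) (hadd : ∀ x y, f x → f y → f (x + y)) (m : M.carrier) : f m := by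
  have hm : m ∈ ⨆ k, M.deg k := by rw [M.isInternal.submodule_iSup_eq_top]; trivial
  induction hm using Submodule.iSup_induction' with
  | mem i x hx => exact h i x hx
  | zero => exact h0
  | add x y _ _ hx hy => exact hadd x y hx hy

/-- `S` is a graded subalgebra: it contains the homogeneous components of its elements. -/
def IsGradedSubalgebra (𝒜 : ℤ → Submodule ℝ R) (S : Subalgebra ℝ R) : Prop :=
  ∀ s ∈ S, s ∈ ⨆ i, 𝒜 i ⊓ Subalgebra.toSubmodule S

theorem balDeg_isInternal (hS : IsGradedSubalgebra 𝒜 S) :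
    DirectSum.IsInternal (balDeg S M N) := by
  obtain ⟨δ, hδ⟩ := exists_components _ M.isInternal
  obtain ⟨ε, hε⟩ := exists_components _ N.isInternal
  let β : (ℤ →₀ M.carrier) →ₗ[ℝ] (ℤ →₀ N.carrier) →ₗ[ℝ]
      (ℤ →₀ (M.carrier ⊗[ℝ] N.carrier) ⧸ balRel S M N) :=
    Finsupp.lsum ℝ (fun i => LinearMap.flip (Finsupp.lsum ℝ (fun j =>
      ((balMk S M N).compr₂ (Finsupp.lsingle (i + j))).flip)))
  let B := β.compl₁₂ δ ε
  have hB : ∀ i j, ∀ m ∈ M.deg i, ∀ n ∈ N.deg j,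
      B m n = Finsupp.single (i + j) (balMk S M N m n) := by
    intro i j m hm n hn
    simp [B, β, hδ i m hm, hε j n hn]
  have hbal' : ∀ s ∈ ⨆ i, 𝒜 i ⊓ Subalgebra.toSubmodule S, ∀ m n,
      B (M.ract s m) n = B m (N.lact s n) := by
    intro s hs m n
    induction hs using Submodule.iSup_induction' with
    | zero => simp
    | add x y _ _ hx hy => simp only [map_add, LinearMap.add_apply, hx, hy]
    | mem a x hx =>
      refine bal_induction (fun m => B (M.ract x m) n = B m (N.lact x n)) ?_ (by simp)
        (fun m m' h h' => by simp only [map_add, LinearMap.add_apply, h, h']) m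
      intro i m hm
      refine bal_induction (fun n => B (M.ract x m) n = B m (N.lact x n)) ?_ (by simp)
        (fun n n' h h' => by simp only [map_add, h, h']) n
      intro j n hn
      rw [hB _ _ _ (M.ract_mem hm hx.1) n hn, hB _ _ m hm _ (N.lact_mem hx.1 hn), add_assoc,
        balMk_ract hx.2]
  have hbal : ∀ s ∈ S, ∀ m n, B (M.ract s m) n = B m (N.lact s n) :=
    fun s hs => hbal' s (hS s hs)
  refine isInternal_of_components _ ?_ (balLift B hbal) ?_
  · rw [eq_top_iff]
    rintro z -
    obtain ⟨z, rfl⟩ := Submodule.mkQ_surjective _ z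
    induction z using TensorProduct.induction_on with
    | zero => simp
    | add x y hx hy => rw [map_add]; exact add_mem hx hy
    | tmul m n =>
      change balMk S M N m n ∈ _
      refine bal_induction (fun m => balMk S M N m n ∈ ⨆ k, balDeg S M N k) ?_ (by simp)
        (fun m m' h h' => by rw [map_add]; exact add_mem h h') m
      intro i m hm
      refine bal_induction (fun n => balMk S M N m n ∈ ⨆ k, balDeg S M N k) ?_ (by simp)
        (fun n n' h h' => by rw [map_add]; exact add_mem h h') n
      intro j n hn
      exact Submodule.mem_iSup_of_mem _ (balMk_mem hm hn)
  · intro k z hz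
    have : balDeg S M N k ≤ LinearMap.eqLocus (balLift B hbal) (Finsupp.lsingle k) := by
      rw [balDeg, Submodule.span_le]
      rintro _ ⟨i, j, rfl, m, hm, n, hn, rfl⟩
      simp [hB i j m hm n hn]
    exact this hz

variable (S M N)

/-- The left action `a (m ⊗ n) = a m ⊗ n`. -/
def balLact : R →ₐ[ℝ] Module.End ℝ ((M.carrier ⊗[ℝ] N.carrier) ⧸ balRel S M N) :=
  AlgHom.ofLinearMap
    { toFun := fun a => balLift ((balMk S M N) ∘ₗ M.lact a) (fun s hs m n => by
        simp [M.lact_ract, balMk_ract hs])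
      map_add' := fun a b => bal_ext fun m n => by simp
      map_smul' := fun a b => bal_ext fun m n => by simp }
    (bal_ext fun m n => by simp) (fun a b => bal_ext fun m n => by simp)

/-- The right action `(m ⊗ n) b = m ⊗ n b`. -/
def balRact : R →ₐ[ℝ] Module.End ℝ ((M.carrier ⊗[ℝ] N.carrier) ⧸ balRel S M N) :=
  AlgHom.ofLinearMap
    { toFun := fun b => balLift ((balMk S M N).compl₂ (N.ract b)) (fun s hs m n => by
        simp [← N.lact_ract, balMk_ract hs])
      map_add' := fun a b => bal_ext fun m n => by simp
      map_smul' := fun a b => bal_ext fun m n => by simp }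
    (bal_ext fun m n => by simp) (fun a b => bal_ext fun m n => by simp)

variable {S M N}

@[simp] theorem balLact_balMk (a : R) (m : M.carrier) (n : N.carrier) :
    balLact S M N a (balMk S M N m n) = balMk S M N (M.lact a m) n := by
  simp [balLact]

@[simp] theorem balRact_balMk (b : R) (m : M.carrier) (n : N.carrier) :
    balRact S M N b (balMk S M N m n) = balMk S M N m (N.ract b n) := by
  simp [balRact]

variable (S M N) in
/-- The graded bimodule `M ⊗_S N`, for a graded subalgebra `S` of `R`: the quotient of `M ⊗_ℝ N` by
the relations `m s ⊗ n = m ⊗ s n`, with `R` acting from the left on `M` and from the right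
on `N`. -/
def balTensor (hS : IsGradedSubalgebra 𝒜 S) : GrBimod 𝒜 where
  carrier := (M.carrier ⊗[ℝ] N.carrier) ⧸ balRel S M N
  lact := balLact S M N
  ract := balRact S M N
  lact_ract a b z := by
    have h : balLact S M N a ∘ₗ balRact S M N b = balRact S M N b ∘ₗ balLact S M N a :=
      bal_ext fun m n => by simp
    exact LinearMap.congr_fun h z
  deg := balDeg S M N
  isInternal := balDeg_isInternal hS
  lact_mem {i k a z} ha hz := by
    suffices h : balDeg S M N k ≤ (balDeg S M N (i + k)).comap (balLact S M N a) from h hz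
    rw [balDeg, Submodule.span_le]
    rintro _ ⟨p, q, rfl, m, hm, n, hn, rfl⟩
    simpa [add_assoc] using balMk_mem (M.lact_mem ha hm) hn
  ract_mem {k j b z} hz hb := by
    suffices h : balDeg S M N k ≤ (balDeg S M N (k + j)).comap (balRact S M N b) from h hz
    rw [balDeg, Submodule.span_le]
    rintro _ ⟨p, q, rfl, m, hm, n, hn, rfl⟩
    simpa [add_assoc] using balMk_mem hm (N.ract_mem hn hb)

end Balanced

section Monoidal

variable [GradedAlgebra 𝒜]

theorem isGradedSubalgebra_top : IsGradedSubalgebra 𝒜 (⊤ : Subalgebra ℝ R) := by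
  intro s _
  simp [(DirectSum.Decomposition.isInternal 𝒜).submodule_iSup_eq_top]

variable (𝒜) in
/-- `R` as a graded bimodule over itself. -/
def regular : GrBimod 𝒜 where
  carrier := R
  lact := Algebra.lmul ℝ R
  ract := Algebra.lmul ℝ R
  lact_ract a b m := by simp [mul_left_comm]
  deg := 𝒜
  isInternal := DirectSum.Decomposition.isInternal 𝒜
  lact_mem ha hm := SetLike.mul_mem_graded ha hm
  ract_mem {i j b m} hm hb := by
    simpa [mul_comm] using SetLike.mul_mem_graded hm hb

variable (𝒜) in
/-- An element of `R` as an element of the bimodule `R`. -/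
def toRegular : R ≃ₗ[ℝ] (regular 𝒜).carrier := LinearEquiv.refl ℝ R

@[simp] theorem regular_lact (a : R) (x : (regular 𝒜).carrier) :
    (regular 𝒜).lact a x = toRegular 𝒜 (a * (toRegular 𝒜).symm x) := rfl

@[simp] theorem regular_ract (a : R) (x : (regular 𝒜).carrier) :
    (regular 𝒜).ract a x = toRegular 𝒜 (a * (toRegular 𝒜).symm x) := rfl

theorem mem_regular_deg {i : ℤ} {x : (regular 𝒜).carrier} :
    x ∈ (regular 𝒜).deg i ↔ (toRegular 𝒜).symm x ∈ 𝒜 i := Iff.rfl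

/-- The tensor product `M ⊗_R N`. -/
def tensor (M N : GrBimod 𝒜) : GrBimod 𝒜 := balTensor ⊤ M N isGradedSubalgebra_top

/-- The element `m ⊗ n` of `M ⊗_R N`. -/
def tmk (M N : GrBimod 𝒜) : M.carrier →ₗ[ℝ] N.carrier →ₗ[ℝ] (tensor M N).carrier := balMk ⊤ M N

variable {M N P Q : GrBimod 𝒜}

theorem tmk_ract (r : R) (m : M.carrier) (n : N.carrier) :
    tmk M N (M.ract r m) n = tmk M N m (N.lact r n) :=
  balMk_ract (S := ⊤) trivial m n

@[simp] theorem tensor_lact (a : R) (m : M.carrier) (n : N.carrier) :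
    (tensor M N).lact a (tmk M N m n) = tmk M N (M.lact a m) n :=
  balLact_balMk a m n

@[simp] theorem tensor_ract (b : R) (m : M.carrier) (n : N.carrier) :
    (tensor M N).ract b (tmk M N m n) = tmk M N m (N.ract b n) :=
  balRact_balMk b m n

theorem tmk_mem {i j : ℤ} {m : M.carrier} {n : N.carrier} (hm : m ∈ M.deg i)
    (hn : n ∈ N.deg j) : tmk M N m n ∈ (tensor M N).deg (i + j) :=
  balMk_mem hm hn

/-- The linear map out of `M ⊗_R N` given by an `R`-balanced bilinear map. -/
def tlift {X : Type*} [AddCommGroup X] [Module ℝ X] (f : M.carrier →ₗ[ℝ] N.carrier →ₗ[ℝ] X)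
    (hf : ∀ r m n, f (M.ract r m) n = f m (N.lact r n)) : (tensor M N).carrier →ₗ[ℝ] X :=
  balLift (S := ⊤) f (fun s _ => hf s)

@[simp] theorem tlift_tmk {X : Type*} [AddCommGroup X] [Module ℝ X]
    (f : M.carrier →ₗ[ℝ] N.carrier →ₗ[ℝ] X)
    (hf : ∀ r m n, f (M.ract r m) n = f m (N.lact r n)) (m : M.carrier) (n : N.carrier) :
    tlift f hf (tmk M N m n) = f m n :=
  balLift_balMk f _ m n

theorem tensor_ext {X : Type*} [AddCommGroup X] [Module ℝ X]
    {f g : (tensor M N).carrier →ₗ[ℝ] X} (h : ∀ m n, f (tmk M N m n) = g (tmk M N m n)) : f = g :=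
  bal_ext h

@[elab_as_elim]
theorem tensor_induction {p : (tensor M N).carrier → Prop} (h : ∀ m n, p (tmk M N m n))
    (hadd : ∀ x y, p x → p y → p (x + y)) (z : (tensor M N).carrier) : p z := by
  obtain ⟨z, rfl⟩ := Submodule.mkQ_surjective (balRel ⊤ M N) z
  induction z using TensorProduct.induction_on with
  | zero =>
    have h0 := h 0 0
    rw [map_zero] at h0
    rw [map_zero]
    exact h0
  | add x y hx hy => rw [map_add]; exact hadd _ _ hx hy
  | tmul m n => exact h m n

theorem tensor_deg_le {k : ℤ} {G : Submodule ℝ (tensor M N).carrier}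
    (h : ∀ i j, i + j = k → ∀ m ∈ M.deg i, ∀ n ∈ N.deg j, tmk M N m n ∈ G) :
    (tensor M N).deg k ≤ G :=
  Submodule.span_le.2 (by rintro _ ⟨i, j, hij, m, hm, n, hn, rfl⟩; exact h i j hij m hm n hn)

theorem tensor_hom_ext {f g : tensor M N ⟶ P}
    (h : ∀ m n, f.toLin (tmk M N m n) = g.toLin (tmk M N m n)) : f = g :=
  Hom.ext (tensor_ext h)

/-- The homomorphism out of `M ⊗_R N` given by a bilinear map with the required properties. -/
def tensorDesc (f : M.carrier →ₗ[ℝ] N.carrier →ₗ[ℝ] P.carrier)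
    (hf : ∀ r m n, f (M.ract r m) n = f m (N.lact r n))
    (hl : ∀ a m n, f (M.lact a m) n = P.lact a (f m n))
    (hr : ∀ b m n, f m (N.ract b n) = P.ract b (f m n))
    (hd : ∀ i j, ∀ m ∈ M.deg i, ∀ n ∈ N.deg j, f m n ∈ P.deg (i + j)) : tensor M N ⟶ P :=
  ofLin (tlift f hf)
    (fun a => tensor_induction (fun m n => by simp [hl]) (fun x y hx hy => by simp [hx, hy]))
    (fun b => tensor_induction (fun m n => by simp [hr]) (fun x y hx hy => by simp [hx, hy]))
    (fun k z hz => (tensor_deg_le (G := (P.deg k).comap (tlift f hf))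
      (by rintro i j rfl m hm n hn; simpa using hd i j m hm n hn)) hz)

@[simp] theorem tensorDesc_tmk (f : M.carrier →ₗ[ℝ] N.carrier →ₗ[ℝ] P.carrier) (hf hl hr hd)
    (m : M.carrier) (n : N.carrier) :
    Hom.toLin (tensorDesc (P := P) f hf hl hr hd) (tmk M N m n) = f m n :=
  tlift_tmk f hf m n

/-- `f ⊗ g`, for homomorphisms `f` and `g`. -/
def tensorMap {M' N' : GrBimod 𝒜} (f : M ⟶ M') (g : N ⟶ N') : tensor M N ⟶ tensor M' N' :=
  tensorDesc ((tmk M' N').compl₁₂ f.toLin g.toLin)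
    (fun r m n => by simp [f.map_ract, g.map_lact, tmk_ract])
    (fun a m n => by simp [f.map_lact]) (fun b m n => by simp [g.map_ract])
    (fun i j m hm n hn => by
      rw [LinearMap.compl₁₂_apply]
      exact tmk_mem (f.map_deg i m hm) (g.map_deg j n hn))

@[simp] theorem tensorMap_tmk {M' N' : GrBimod 𝒜} (f : M ⟶ M') (g : N ⟶ N') (m : M.carrier)
    (n : N.carrier) :
    Hom.toLin (tensorMap f g) (tmk M N m n) = tmk M' N' (f.toLin m) (g.toLin n) := by
  rw [tensorMap, tensorDesc_tmk]; rfl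

variable (M N P)

/-- The trilinear map `(m ⊗ n, p) ↦ m ⊗ (n ⊗ p)`. -/
def assocLin : (tensor M N).carrier →ₗ[ℝ] P.carrier →ₗ[ℝ] (tensor M (tensor N P)).carrier :=
  tlift (LinearMap.mk₂ ℝ (fun m n => tmk M (tensor N P) m ∘ₗ tmk N P n)
    (fun _ _ _ => by ext; simp) (fun _ _ _ => by ext; simp) (fun _ _ _ => by ext; simp)
    (fun _ _ _ => by ext; simp))
    (fun r m n => LinearMap.ext fun p => by simp [tmk_ract])

@[simp] theorem assocLin_tmk (m : M.carrier) (n : N.carrier) (p : P.carrier) :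
    assocLin M N P (tmk M N m n) p = tmk M _ m (tmk N P n p) := by
  simp [assocLin]

/-- The trilinear map `(m, n ⊗ p) ↦ (m ⊗ n) ⊗ p`. -/
def assocInvLin : M.carrier →ₗ[ℝ] (tensor N P).carrier →ₗ[ℝ] (tensor (tensor M N) P).carrier :=
  (tlift (LinearMap.mk₂ ℝ (fun n p => (tmk (tensor M N) P).flip p ∘ₗ (tmk M N).flip n)
    (fun _ _ _ => by ext; simp) (fun _ _ _ => by ext; simp) (fun _ _ _ => by ext; simp)
    (fun _ _ _ => by ext; simp))
    (fun r n p => LinearMap.ext fun m => by simp [← tmk_ract])).flip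

@[simp] theorem assocInvLin_tmk (m : M.carrier) (n : N.carrier) (p : P.carrier) :
    assocInvLin M N P m (tmk N P n p) = tmk _ P (tmk M N m n) p := by
  simp [assocInvLin]

/-- The map `(m ⊗ n) ⊗ p ↦ m ⊗ (n ⊗ p)`. -/
def assocHom : tensor (tensor M N) P ⟶ tensor M (tensor N P) :=
  tensorDesc (assocLin M N P)
    (fun r z p => by
      induction z using tensor_induction with
      | h m n => simp [tmk_ract]
      | hadd x y hx hy => simp only [map_add, LinearMap.add_apply, hx, hy])
    (fun r z p => by
      induction z using tensor_induction with
      | h m n => simp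
      | hadd x y hx hy => simp only [map_add, LinearMap.add_apply, hx, hy])
    (fun r z p => by
      induction z using tensor_induction with
      | h m n => simp
      | hadd x y hx hy => simp only [map_add, LinearMap.add_apply, hx, hy])
    (fun i j z hz p hp => by
      refine tensor_deg_le (G := ((tensor M (tensor N P)).deg (i + j)).comap
        ((assocLin M N P).flip p)) ?_ hz
      rintro k l rfl m hm n hn
      simpa [add_assoc] using tmk_mem hm (tmk_mem hn hp))

/-- The map `m ⊗ (n ⊗ p) ↦ (m ⊗ n) ⊗ p`. -/
def assocInv : tensor M (tensor N P) ⟶ tensor (tensor M N) P :=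
  tensorDesc (assocInvLin M N P)
    (fun r m z => by
      induction z using tensor_induction with
      | h n p => simp [tmk_ract]
      | hadd x y hx hy => simp only [map_add, hx, hy])
    (fun r m z => by
      induction z using tensor_induction with
      | h n p => simp
      | hadd x y hx hy => simp only [map_add, hx, hy])
    (fun r m z => by
      induction z using tensor_induction with
      | h n p => simp
      | hadd x y hx hy => simp only [map_add, hx, hy])
    (fun i j m hm z hz => by
      refine tensor_deg_le (G := ((tensor (tensor M N) P).deg (i + j)).comap
        (assocInvLin M N P m)) ?_ hz
      rintro k l rfl n hn p hp
      simpa [add_assoc] using tmk_mem (tmk_mem hm hn) hp)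

variable {M N P}

@[simp] theorem assocHom_tmk (m : M.carrier) (n : N.carrier) (p : P.carrier) :
    (assocHom M N P).toLin (tmk _ P (tmk M N m n) p) = tmk M _ m (tmk N P n p) := by
  unfold assocHom
  exact (tensorDesc_tmk _ _ _ _ _ _ _).trans (assocLin_tmk M N P m n p)

@[simp] theorem assocInv_tmk (m : M.carrier) (n : N.carrier) (p : P.carrier) :
    (assocInv M N P).toLin (tmk M _ m (tmk N P n p)) = tmk _ P (tmk M N m n) p := by
  unfold assocInv
  exact (tensorDesc_tmk _ _ _ _ _ _ _).trans (assocInvLin_tmk M N P m n p)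

theorem tensor_hom_ext_left {f g : tensor (tensor M N) P ⟶ Q}
    (h : ∀ m n p, f.toLin (tmk _ P (tmk M N m n) p) = g.toLin (tmk _ P (tmk M N m n) p)) :
    f = g := by
  refine tensor_hom_ext fun z p => ?_
  induction z using tensor_induction with
  | h m n => exact h m n p
  | hadd x y hx hy => simp only [map_add, LinearMap.add_apply, hx, hy]

theorem tensor_hom_ext_right {f g : tensor M (tensor N P) ⟶ Q}
    (h : ∀ m n p, f.toLin (tmk M _ m (tmk N P n p)) = g.toLin (tmk M _ m (tmk N P n p))) :
    f = g := by
  refine tensor_hom_ext fun m z => ?_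
  induction z using tensor_induction with
  | h n p => exact h m n p
  | hadd x y hx hy => simp only [map_add, hx, hy]

/-- The associativity isomorphism. -/
def assocIso (M N P : GrBimod 𝒜) : tensor (tensor M N) P ≅ tensor M (tensor N P) where
  hom := assocHom M N P
  inv := assocInv M N P
  hom_inv_id := tensor_hom_ext_left fun m n p => by simp
  inv_hom_id := tensor_hom_ext_right fun m n p => by simp

theorem tmk_regular_left (a : (regular 𝒜).carrier) (m : M.carrier) :
    tmk (regular 𝒜) M (toRegular 𝒜 1) (M.lact ((toRegular 𝒜).symm a) m) =
      tmk (regular 𝒜) M a m := by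
  rw [← tmk_ract]
  simp

theorem tmk_regular_right (m : M.carrier) (a : (regular 𝒜).carrier) :
    tmk M (regular 𝒜) (M.ract ((toRegular 𝒜).symm a) m) (toRegular 𝒜 1) =
      tmk M (regular 𝒜) m a := by
  rw [tmk_ract]
  simp

/-- The map `a ⊗ m ↦ a m`. -/
def leftUnitHom (M : GrBimod 𝒜) : tensor (regular 𝒜) M ⟶ M :=
  tensorDesc (M.lact.toLinearMap ∘ₗ (toRegular 𝒜).symm.toLinearMap)
    (fun r a m => by simp [mul_comm r]) (fun r a m => by simp) (fun r a m => by simp [M.lact_ract])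
    (fun i j a ha m hm => by simpa using M.lact_mem (mem_regular_deg.1 ha) hm)

/-- The map `m ⊗ a ↦ m a`. -/
def rightUnitHom (M : GrBimod 𝒜) : tensor M (regular 𝒜) ⟶ M :=
  tensorDesc (M.ract.toLinearMap ∘ₗ (toRegular 𝒜).symm.toLinearMap).flip
    (fun r m a => by simp [mul_comm r]) (fun r m a => by simp [M.lact_ract]) (fun r m a => by simp)
    (fun i j m hm a ha => by simpa using M.ract_mem hm (mem_regular_deg.1 ha))

@[simp] theorem leftUnitHom_tmk (M : GrBimod 𝒜) (a : (regular 𝒜).carrier) (m : M.carrier) :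
    (leftUnitHom M).toLin (tmk (regular 𝒜) M a m) = M.lact ((toRegular 𝒜).symm a) m := by
  unfold leftUnitHom
  exact tensorDesc_tmk _ _ _ _ _ a m

@[simp] theorem rightUnitHom_tmk (M : GrBimod 𝒜) (m : M.carrier) (a : (regular 𝒜).carrier) :
    (rightUnitHom M).toLin (tmk M (regular 𝒜) m a) = M.ract ((toRegular 𝒜).symm a) m := by
  unfold rightUnitHom
  exact tensorDesc_tmk _ _ _ _ _ m a

/-- The isomorphism `R ⊗_R M ≅ M`. -/
def leftUnitIso (M : GrBimod 𝒜) : tensor (regular 𝒜) M ≅ M where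
  hom := leftUnitHom M
  inv := ofLin (tmk (regular 𝒜) M (toRegular 𝒜 1))
    (fun a m => by rw [← tmk_ract]; simp)
    (fun a m => by simp)
    (fun i m hm => by
      have h := tmk_mem (M := regular 𝒜) (m := toRegular 𝒜 1) (SetLike.one_mem_graded 𝒜) hm
      rwa [zero_add] at h)
  hom_inv_id := tensor_hom_ext fun a m => by simp [tmk_regular_left]
  inv_hom_id := hom_ext fun m => by simp

/-- The map `m ↦ m ⊗ 1`. -/
def rightUnitInv (M : GrBimod 𝒜) : M ⟶ tensor M (regular 𝒜) :=
  ofLin ((tmk M (regular 𝒜)).flip (toRegular 𝒜 1))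
    (fun a m => by simp)
    (fun a m => by simp [tmk_ract])
    (fun i m hm => by
      have h := tmk_mem (N := regular 𝒜) (n := toRegular 𝒜 1) hm (SetLike.one_mem_graded 𝒜)
      rwa [add_zero] at h)

@[simp] theorem rightUnitInv_apply (M : GrBimod 𝒜) (m : M.carrier) :
    (rightUnitInv M).toLin m = tmk M (regular 𝒜) m (toRegular 𝒜 1) := rfl

/-- The isomorphism `M ⊗_R R ≅ M`. -/
def rightUnitIso (M : GrBimod 𝒜) : tensor M (regular 𝒜) ≅ M where
  hom := rightUnitHom M
  inv := rightUnitInv M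
  hom_inv_id := tensor_hom_ext fun m a => by simp [tmk_regular_right]
  inv_hom_id := hom_ext fun m => by simp

instance : MonoidalCategoryStruct (GrBimod 𝒜) where
  tensorObj := tensor
  whiskerLeft M _ _ f := tensorMap (𝟙 M) f
  whiskerRight f N := tensorMap f (𝟙 N)
  tensorHom := tensorMap
  tensorUnit := regular 𝒜
  associator := assocIso
  leftUnitor := leftUnitIso
  rightUnitor := rightUnitIso

theorem tensorMap_id (M N : GrBimod 𝒜) : tensorMap (𝟙 M) (𝟙 N) = 𝟙 (tensor M N) :=
  tensor_hom_ext fun m n => by simp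

theorem tensorMap_comp {M M' M'' N N' N'' : GrBimod 𝒜} (f : M ⟶ M') (f' : M' ⟶ M'')
    (g : N ⟶ N') (g' : N' ⟶ N'') :
    tensorMap f g ≫ tensorMap f' g' = tensorMap (f ≫ f') (g ≫ g') :=
  tensor_hom_ext fun m n => by simp

instance : MonoidalCategory (GrBimod 𝒜) :=
  MonoidalCategory.ofTensorHom
    (id_tensorHom_id := tensorMap_id)
    (id_tensorHom := fun _ _ _ _ => rfl)
    (tensorHom_id := fun _ _ => rfl)
    (tensorHom_comp_tensorHom := fun f g f' g' => tensorMap_comp f f' g g')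
    (associator_naturality := fun f g h => by
      change tensorMap (tensorMap f g) h ≫ assocHom _ _ _ =
        assocHom _ _ _ ≫ tensorMap f (tensorMap g h)
      exact tensor_hom_ext_left fun m n p => by simp)
    (leftUnitor_naturality := fun {M N} f => by
      change tensorMap (𝟙 (regular 𝒜)) f ≫ leftUnitHom N = leftUnitHom M ≫ f
      exact tensor_hom_ext fun a m => by simp [f.map_lact])
    (rightUnitor_naturality := fun {M N} f => by
      change tensorMap f (𝟙 (regular 𝒜)) ≫ rightUnitHom N = rightUnitHom M ≫ f
      exact tensor_hom_ext fun a m => by simp [f.map_ract])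
    (pentagon := fun M N P Q => by
      change tensorMap (assocHom M N P) (𝟙 Q) ≫ assocHom M (tensor N P) Q ≫
        tensorMap (𝟙 M) (assocHom N P Q) = assocHom (tensor M N) P Q ≫ assocHom M N (tensor P Q)
      refine tensor_hom_ext fun z q => ?_
      induction z using tensor_induction with
      | hadd x y hx hy => simp only [map_add, LinearMap.add_apply, hx, hy]
      | h z p =>
        induction z using tensor_induction with
        | hadd x y hx hy => simp only [map_add, LinearMap.add_apply, hx, hy]
        | h m n => simp)
    (triangle := fun M N => by
      change assocHom M (regular 𝒜) N ≫ tensorMap (𝟙 M) (leftUnitHom N) =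
        tensorMap (rightUnitHom M) (𝟙 N)
      exact tensor_hom_ext_left fun m a n => by simp [tmk_ract])

instance : MonoidalPreadditive (GrBimod 𝒜) where
  whiskerLeft_zero {M N P} := by
    change tensorMap (𝟙 M) (0 : N ⟶ P) = 0
    exact tensor_hom_ext fun m n => by simp
  zero_whiskerRight {M N P} := by
    change tensorMap (0 : N ⟶ P) (𝟙 M) = 0
    exact tensor_hom_ext fun m n => by simp
  whiskerLeft_add {M N P} f g := by
    change tensorMap (𝟙 M) (f + g) = tensorMap (𝟙 M) f + tensorMap (𝟙 M) g
    exact tensor_hom_ext fun m n => by simp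
  add_whiskerRight {M N P} f g := by
    change tensorMap (f + g) (𝟙 M) = tensorMap f (𝟙 M) + tensorMap g (𝟙 M)
    exact tensor_hom_ext fun m n => by simp

end Monoidal

/-! ### Shifts -/

section Shift

variable {M N : GrBimod 𝒜}

/-- An element of `M` as an element of `M(n)`. -/
def toShift (n : ℤ) (M : GrBimod 𝒜) : M.carrier ≃ₗ[ℝ] (shift n M).carrier :=
  LinearEquiv.refl ℝ M.carrier

@[simp] theorem shift_lact (n : ℤ) (a : R) (m : (shift n M).carrier) :
    (shift n M).lact a m = toShift n M (M.lact a ((toShift n M).symm m)) := rfl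

@[simp] theorem shift_ract (n : ℤ) (a : R) (m : (shift n M).carrier) :
    (shift n M).ract a m = toShift n M (M.ract a ((toShift n M).symm m)) := rfl

theorem mem_shift_deg {n i : ℤ} {m : (shift n M).carrier} :
    m ∈ (shift n M).deg i ↔ (toShift n M).symm m ∈ M.deg (i + n) := Iff.rfl

/-- A homomorphism `M ⟶ N` is also a homomorphism `M(n) ⟶ N(n)`. -/
def shiftMap (n : ℤ) (f : M ⟶ N) : shift n M ⟶ shift n N :=
  ofLin (toShift n N ∘ₗ f.toLin ∘ₗ (toShift n M).symm.toLinearMap)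
    (fun a m => by simp [f.map_lact]) (fun a m => by simp [f.map_ract])
    (fun i m hm => by simpa [mem_shift_deg] using f.map_deg _ _ (mem_shift_deg.1 hm))

@[simp] theorem shiftMap_apply (n : ℤ) (f : M ⟶ N) (m : (shift n M).carrier) :
    (shiftMap n f).toLin m = toShift n N (f.toLin ((toShift n M).symm m)) := rfl

/-- The grading shift, as a functor. -/
def shiftFunctor (n : ℤ) : GrBimod 𝒜 ⥤ GrBimod 𝒜 where
  obj := shift n
  map := shiftMap n
  map_id M := hom_ext fun m => by simp
  map_comp f g := hom_ext fun m => by simp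

/-- `M ≅ N` implies `M(n) ≅ N(n)`. -/
def shiftIso (n : ℤ) (e : M ≅ N) : shift n M ≅ shift n N := (shiftFunctor n).mapIso e

instance (n : ℤ) : (shiftFunctor n : GrBimod 𝒜 ⥤ GrBimod 𝒜).Additive where
  map_add {M N f g} := by
    change shiftMap n (f + g) = shiftMap n f + shiftMap n g
    exact hom_ext fun m => by simp

/-- `M(n)(k) ≅ M(n + k)`. -/
def shiftShift (n k : ℤ) (M : GrBimod 𝒜) : shift k (shift n M) ≅ shift (n + k) M where
  hom := ofLin (toShift (n + k) M ∘ₗ (toShift n M).symm.toLinearMap ∘ₗ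
      (toShift k (shift n M)).symm.toLinearMap)
    (fun a m => by simp) (fun a m => by simp)
    (fun i m hm => by
      have h := mem_shift_deg.1 (mem_shift_deg.1 hm)
      rw [add_assoc, add_comm k n] at h
      exact h)
  inv := ofLin (toShift k (shift n M) ∘ₗ (toShift n M).toLinearMap ∘ₗ
      (toShift (n + k) M).symm.toLinearMap)
    (fun a m => by simp) (fun a m => by simp)
    (fun i m hm => by
      have h := mem_shift_deg.1 hm
      rw [add_comm n k, ← add_assoc] at h
      exact h)
  hom_inv_id := hom_ext fun m => by simp
  inv_hom_id := hom_ext fun m => by simp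

/-- `M(0) ≅ M`. -/
def shiftZero (M : GrBimod 𝒜) : shift 0 M ≅ M where
  hom := ofLin (toShift 0 M).symm.toLinearMap (fun a m => by simp) (fun a m => by simp)
    (fun i m hm => by simpa [mem_shift_deg] using hm)
  inv := ofLin (toShift 0 M).toLinearMap (fun a m => by simp) (fun a m => by simp)
    (fun i m hm => by simpa [mem_shift_deg] using hm)
  hom_inv_id := hom_ext fun m => by simp
  inv_hom_id := hom_ext fun m => by simp

variable [GradedAlgebra 𝒜]

/-- The bilinear map `(m, n) ↦ m ⊗ n` from `M × N` to `M(k) ⊗ N`. -/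
def shiftTmk (k : ℤ) (M N : GrBimod 𝒜) :
    M.carrier →ₗ[ℝ] N.carrier →ₗ[ℝ] (tensor (shift k M) N).carrier :=
  tmk (shift k M) N ∘ₗ (toShift k M).toLinearMap

/-- The bilinear map `(m, n) ↦ m ⊗ n` from `M × N` to `M ⊗ N(k)`. -/
def tmkShift (k : ℤ) (M N : GrBimod 𝒜) :
    M.carrier →ₗ[ℝ] N.carrier →ₗ[ℝ] (tensor M (shift k N)).carrier :=
  (tmk M (shift k N)).compl₂ (toShift k N).toLinearMap

/-- The linear map `M ⊗ N → M(k) ⊗ N`, `m ⊗ n ↦ m ⊗ n`. -/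
def shiftTensorLin (k : ℤ) (M N : GrBimod 𝒜) :
    (tensor M N).carrier →ₗ[ℝ] (tensor (shift k M) N).carrier :=
  tlift (shiftTmk k M N) (fun r m n => by simp [shiftTmk, ← tmk_ract])

/-- The linear map `M ⊗ N → M ⊗ N(k)`, `m ⊗ n ↦ m ⊗ n`. -/
def tensorShiftLin (k : ℤ) (M N : GrBimod 𝒜) :
    (tensor M N).carrier →ₗ[ℝ] (tensor M (shift k N)).carrier :=
  tlift (tmkShift k M N) (fun r m n => by simp [tmkShift, tmk_ract])

@[simp] theorem shiftTensorLin_tmk (k : ℤ) (m : M.carrier) (n : N.carrier) :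
    shiftTensorLin k M N (tmk M N m n) = tmk (shift k M) N (toShift k M m) n := by
  unfold shiftTensorLin
  exact tlift_tmk _ _ m n

@[simp] theorem tensorShiftLin_tmk (k : ℤ) (m : M.carrier) (n : N.carrier) :
    tensorShiftLin k M N (tmk M N m n) = tmk M (shift k N) m (toShift k N n) := by
  unfold tensorShiftLin
  exact tlift_tmk _ _ m n

/-- The map `M(k) ⊗ N → (M ⊗ N)(k)`, `m ⊗ n ↦ m ⊗ n`. -/
def shiftTensorHom (k : ℤ) (M N : GrBimod 𝒜) : tensor (shift k M) N ⟶ shift k (tensor M N) :=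
  tensorDesc (((tmk M N).compr₂ (toShift k (tensor M N)).toLinearMap) ∘ₗ
      (toShift k M).symm.toLinearMap)
    (fun r m n => by simp [tmk_ract]) (fun a m n => by simp) (fun b m n => by simp)
    (fun i j m hm n hn => by
      have h := tmk_mem (mem_shift_deg.1 hm) hn
      rw [add_right_comm] at h
      simpa [mem_shift_deg] using h)

/-- The map `M ⊗ N(k) → (M ⊗ N)(k)`, `m ⊗ n ↦ m ⊗ n`. -/
def tensorShiftHom (k : ℤ) (M N : GrBimod 𝒜) : tensor M (shift k N) ⟶ shift k (tensor M N) :=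
  tensorDesc (((tmk M N).compr₂ (toShift k (tensor M N)).toLinearMap).compl₂
      (toShift k N).symm.toLinearMap)
    (fun r m n => by simp [tmk_ract]) (fun a m n => by simp) (fun b m n => by simp)
    (fun i j m hm n hn => by
      have h := tmk_mem hm (mem_shift_deg.1 hn)
      rw [← add_assoc] at h
      simpa [mem_shift_deg] using h)

@[simp] theorem shiftTensorHom_tmk (k : ℤ) (m : (shift k M).carrier) (n : N.carrier) :
    (shiftTensorHom k M N).toLin (tmk (shift k M) N m n) =
      toShift k (tensor M N) (tmk M N ((toShift k M).symm m) n) := by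
  unfold shiftTensorHom
  exact tensorDesc_tmk _ _ _ _ _ m n

@[simp] theorem tensorShiftHom_tmk (k : ℤ) (m : M.carrier) (n : (shift k N).carrier) :
    (tensorShiftHom k M N).toLin (tmk M (shift k N) m n) =
      toShift k (tensor M N) (tmk M N m ((toShift k N).symm n)) := by
  unfold tensorShiftHom
  exact tensorDesc_tmk _ _ _ _ _ m n

/-- The inverse of `shiftTensorHom`. -/
def shiftTensorInv (k : ℤ) (M N : GrBimod 𝒜) : shift k (tensor M N) ⟶ tensor (shift k M) N :=
  ofLin (shiftTensorLin k M N ∘ₗ (toShift k (tensor M N)).symm.toLinearMap)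
    (fun a z => by
      obtain ⟨z, rfl⟩ := (toShift k (tensor M N)).surjective z
      induction z using tensor_induction with
      | h m n => simp
      | hadd x y hx hy => simp only [map_add, hx, hy])
    (fun a z => by
      obtain ⟨z, rfl⟩ := (toShift k (tensor M N)).surjective z
      induction z using tensor_induction with
      | h m n => simp
      | hadd x y hx hy => simp only [map_add, hx, hy])
    (fun l z hz => by
      have h : (tensor M N).deg (l + k) ≤
          ((tensor (shift k M) N).deg l).comap (shiftTensorLin k M N) := by
        refine tensor_deg_le fun i j hij m hm n hn => ?_
        have hm' : toShift k M m ∈ (shift k M).deg (i - k) := by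
          rw [mem_shift_deg, LinearEquiv.symm_apply_apply, sub_add_cancel]
          exact hm
        have h := tmk_mem hm' hn
        rw [show i - k + j = l by omega] at h
        rw [Submodule.mem_comap, shiftTensorLin_tmk]
        exact h
      exact h (mem_shift_deg.1 hz))

@[simp] theorem shiftTensorInv_apply (k : ℤ) (z : (shift k (tensor M N)).carrier) :
    (shiftTensorInv k M N).toLin z = shiftTensorLin k M N ((toShift k (tensor M N)).symm z) := rfl

/-- `M(k) ⊗ N ≅ (M ⊗ N)(k)`. -/
def shiftTensor (k : ℤ) (M N : GrBimod 𝒜) : tensor (shift k M) N ≅ shift k (tensor M N) where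
  hom := shiftTensorHom k M N
  inv := shiftTensorInv k M N
  hom_inv_id := tensor_hom_ext fun m n => by simp
  inv_hom_id := hom_ext fun z => by
    obtain ⟨z, rfl⟩ := (toShift k (tensor M N)).surjective z
    induction z using tensor_induction with
    | h m n => simp
    | hadd x y hx hy => simp only [map_add, hx, hy]

/-- The inverse of `tensorShiftHom`. -/
def tensorShiftInv (k : ℤ) (M N : GrBimod 𝒜) : shift k (tensor M N) ⟶ tensor M (shift k N) :=
  ofLin (tensorShiftLin k M N ∘ₗ (toShift k (tensor M N)).symm.toLinearMap)
    (fun a z => by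
      obtain ⟨z, rfl⟩ := (toShift k (tensor M N)).surjective z
      induction z using tensor_induction with
      | h m n => simp
      | hadd x y hx hy => simp only [map_add, hx, hy])
    (fun a z => by
      obtain ⟨z, rfl⟩ := (toShift k (tensor M N)).surjective z
      induction z using tensor_induction with
      | h m n => simp
      | hadd x y hx hy => simp only [map_add, hx, hy])
    (fun l z hz => by
      have h : (tensor M N).deg (l + k) ≤
          ((tensor M (shift k N)).deg l).comap (tensorShiftLin k M N) := by
        refine tensor_deg_le fun i j hij m hm n hn => ?_
        have hn' : toShift k N n ∈ (shift k N).deg (j - k) := by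
          rw [mem_shift_deg, LinearEquiv.symm_apply_apply, sub_add_cancel]
          exact hn
        have h := tmk_mem hm hn'
        rw [show i + (j - k) = l by omega] at h
        rw [Submodule.mem_comap, tensorShiftLin_tmk]
        exact h
      exact h (mem_shift_deg.1 hz))

@[simp] theorem tensorShiftInv_apply (k : ℤ) (z : (shift k (tensor M N)).carrier) :
    (tensorShiftInv k M N).toLin z = tensorShiftLin k M N ((toShift k (tensor M N)).symm z) := rfl

/-- `M ⊗ N(k) ≅ (M ⊗ N)(k)`. -/
def tensorShift (k : ℤ) (M N : GrBimod 𝒜) : tensor M (shift k N) ≅ shift k (tensor M N) where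
  hom := tensorShiftHom k M N
  inv := tensorShiftInv k M N
  hom_inv_id := tensor_hom_ext fun m n => by simp
  inv_hom_id := hom_ext fun z => by
    obtain ⟨z, rfl⟩ := (toShift k (tensor M N)).surjective z
    induction z using tensor_induction with
    | h m n => simp
    | hadd x y hx hy => simp only [map_add, hx, hy]

end Shift

end GrBimod

end Bimodules

/-! ### Split Grothendieck rings -/

section SplitGrothendieck

theorem preservesBinaryBiproduct_of_additive {𝒞 𝒟 : Type*} [Category 𝒞] [Category 𝒟]
    [Preadditive 𝒞] [Preadditive 𝒟] (F : 𝒞 ⥤ 𝒟) [F.Additive] (X Y : 𝒞) :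
    PreservesBinaryBiproduct X Y F :=
  preservesBinaryBiproduct_of_preservesBiproduct F X Y

/-- An additive functor commutes with direct sums. -/
noncomputable def mapBiprodIso {𝒞 𝒟 : Type*} [Category 𝒞] [Category 𝒟]
    [Preadditive 𝒞] [Preadditive 𝒟] [HasBinaryBiproducts 𝒞] [HasBinaryBiproducts 𝒟]
    (F : 𝒞 ⥤ 𝒟) [F.Additive] (X Y : 𝒞) : F.obj (X ⊞ Y) ≅ F.obj X ⊞ F.obj Y :=
  have := preservesBinaryBiproduct_of_additive F X Y
  F.mapBiprod X Y

variable (𝒞 : Type*) [Category 𝒞]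

/-- The isomorphism classes of objects. -/
def IsoClass : Type _ := Quotient (isIsomorphicSetoid 𝒞)

variable {𝒞} in
/-- The isomorphism class of an object. -/
def isoClass (X : 𝒞) : IsoClass 𝒞 := Quotient.mk (isIsomorphicSetoid 𝒞) X

variable {𝒞} in
theorem isoClass_eq {X Y : 𝒞} (e : X ≅ Y) : isoClass X = isoClass Y := Quotient.sound ⟨e⟩

variable [MonoidalCategory 𝒞]

/-- The multiplication of isomorphism classes given by the tensor product. -/
instance : Monoid (IsoClass 𝒞) where
  mul := Quotient.map₂ (fun X Y => X ⊗ Y) (by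
    rintro X X' ⟨e⟩ Y Y' ⟨f⟩
    exact ⟨e ⊗ᵢ f⟩)
  one := isoClass (𝟙_ 𝒞)
  mul_assoc := by
    rintro ⟨X⟩ ⟨Y⟩ ⟨Z⟩
    exact isoClass_eq (α_ X Y Z)
  one_mul := by
    rintro ⟨X⟩
    exact isoClass_eq (λ_ X)
  mul_one := by
    rintro ⟨X⟩
    exact isoClass_eq (ρ_ X)

variable {𝒞} in
theorem isoClass_mul (X Y : 𝒞) : isoClass X * isoClass Y = isoClass (X ⊗ Y) := rfl

variable [Preadditive 𝒞] [HasBinaryBiproducts 𝒞]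

/-- The subgroup of the free abelian group on the isomorphism classes which is generated by the
elements `[X ⊞ Y] - [X] - [Y]`. -/
def splitRelations : AddSubgroup (FreeAbelianGroup (IsoClass 𝒞)) :=
  AddSubgroup.closure {z | ∃ X Y : 𝒞, z = FreeAbelianGroup.of (isoClass (X ⊞ Y)) -
    FreeAbelianGroup.of (isoClass X) - FreeAbelianGroup.of (isoClass Y)}

variable [MonoidalPreadditive 𝒞]

variable {𝒞} in
theorem mul_mem_splitRelations (x : FreeAbelianGroup (IsoClass 𝒞))
    {y : FreeAbelianGroup (IsoClass 𝒞)} (hy : y ∈ splitRelations 𝒞) :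
    x * y ∈ splitRelations 𝒞 := by
  induction x using FreeAbelianGroup.induction_on with
  | zero => rw [zero_mul]; exact zero_mem _
  | neg x hx => rw [neg_mul]; exact neg_mem hx
  | add x x' hx hx' => rw [add_mul]; exact add_mem hx hx'
  | of Z =>
    induction hy using AddSubgroup.closure_induction with
    | zero => rw [mul_zero]; exact zero_mem _
    | add y y' _ _ hy hy' => rw [mul_add]; exact add_mem hy hy'
    | neg y _ hy => rw [mul_neg]; exact neg_mem hy
    | mem y hy =>
      obtain ⟨X, Y, rfl⟩ := hy
      obtain ⟨Z, rfl⟩ := Quotient.exists_rep Z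
      change FreeAbelianGroup.of (isoClass Z) * _ ∈ _
      rw [mul_sub, mul_sub, FreeAbelianGroup.of_mul_of, FreeAbelianGroup.of_mul_of,
        FreeAbelianGroup.of_mul_of, isoClass_mul, isoClass_mul, isoClass_mul,
        isoClass_eq (show Z ⊗ (X ⊞ Y) ≅ Z ⊗ X ⊞ Z ⊗ Y from mapBiprodIso (tensorLeft Z) X Y)]
      exact AddSubgroup.subset_closure ⟨_, _, rfl⟩

variable {𝒞} in
theorem mem_splitRelations_mul {x : FreeAbelianGroup (IsoClass 𝒞)} (hx : x ∈ splitRelations 𝒞)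
    (y : FreeAbelianGroup (IsoClass 𝒞)) : x * y ∈ splitRelations 𝒞 := by
  induction y using FreeAbelianGroup.induction_on with
  | zero => rw [mul_zero]; exact zero_mem _
  | neg y hy => rw [mul_neg]; exact neg_mem hy
  | add y y' hy hy' => rw [mul_add]; exact add_mem hy hy'
  | of Z =>
    induction hx using AddSubgroup.closure_induction with
    | zero => rw [zero_mul]; exact zero_mem _
    | add y y' _ _ hy hy' => rw [add_mul]; exact add_mem hy hy'
    | neg y _ hy => rw [neg_mul]; exact neg_mem hy
    | mem y hy =>
      obtain ⟨X, Y, rfl⟩ := hy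
      obtain ⟨Z, rfl⟩ := Quotient.exists_rep Z
      change _ * FreeAbelianGroup.of (isoClass Z) ∈ _
      rw [sub_mul, sub_mul, FreeAbelianGroup.of_mul_of, FreeAbelianGroup.of_mul_of,
        FreeAbelianGroup.of_mul_of, isoClass_mul, isoClass_mul, isoClass_mul,
        isoClass_eq (show (X ⊞ Y) ⊗ Z ≅ X ⊗ Z ⊞ Y ⊗ Z from mapBiprodIso (tensorRight Z) X Y)]
      exact AddSubgroup.subset_closure ⟨_, _, rfl⟩

/-- The subgroup `splitRelations`, as a two-sided ideal. -/
def splitIdeal : TwoSidedIdeal (FreeAbelianGroup (IsoClass 𝒞)) :=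
  TwoSidedIdeal.mk' (splitRelations 𝒞) (zero_mem _) add_mem neg_mem
    (fun hy => mul_mem_splitRelations _ hy) (fun hx => mem_splitRelations_mul hx _)

/-- The split Grothendieck ring of a preadditive monoidal category with biproducts: the abelian
group generated by the isomorphism classes of objects with the relations `[X ⊞ Y] = [X] + [Y]`,
with the multiplication `[X] [Y] = [X ⊗ Y]`. -/
def SplitK0 : Type _ := (splitIdeal 𝒞).ringCon.Quotient

instance : Ring (SplitK0 𝒞) := inferInstanceAs (Ring (splitIdeal 𝒞).ringCon.Quotient)

/-- The quotient map onto the split Grothendieck ring. -/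
def splitMk : FreeAbelianGroup (IsoClass 𝒞) →+* SplitK0 𝒞 := (splitIdeal 𝒞).ringCon.mk'

variable {𝒞} in
/-- The class `[X]` of an object. -/
def splitClass (X : 𝒞) : SplitK0 𝒞 := splitMk 𝒞 (FreeAbelianGroup.of (isoClass X))

variable {𝒞} in
theorem splitClass_mul (X Y : 𝒞) : splitClass X * splitClass Y = splitClass (X ⊗ Y) := by
  rw [splitClass, splitClass, ← map_mul, FreeAbelianGroup.of_mul_of, isoClass_mul]
  rfl

variable {𝒞} in
theorem splitClass_eq {X Y : 𝒞} (e : X ≅ Y) : splitClass X = splitClass Y := by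
  rw [splitClass, isoClass_eq e, splitClass]

theorem splitClass_induction {p : SplitK0 𝒞 → Prop} (h : ∀ X, p (splitClass X)) (h0 : p 0)
    (hneg : ∀ x, p x → p (-x)) (hadd : ∀ x y, p x → p y → p (x + y)) (x : SplitK0 𝒞) : p x := by
  obtain ⟨x, rfl⟩ := (splitIdeal 𝒞).ringCon.mk'_surjective x
  change p (splitMk 𝒞 x)
  induction x using FreeAbelianGroup.induction_on with
  | zero => rw [map_zero]; exact h0
  | neg x hx => rw [map_neg]; exact hneg _ hx
  | add x y hx hy => rw [map_add]; exact hadd _ _ hx hy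
  | of X =>
    obtain ⟨X, rfl⟩ := Quotient.exists_rep X
    exact h X

end SplitGrothendieck

/-! ### Categories generated by graded bimodules -/

section Generated

variable {R : Type u} [CommRing R] [Algebra ℝ R] {𝒜 : ℤ → Submodule ℝ R} [GradedAlgebra 𝒜]
variable {ι : Type*} (B : ι → GrBimod 𝒜)

namespace GrBimod

/-- The tensor product `B_{i₁} ⊗_R ⋯ ⊗_R B_{iₖ}`, which is `R` for `k = 0`. -/
def tensorWord : List ι → GrBimod 𝒜
  | [] => regular 𝒜
  | i :: l => tensor (B i) (tensorWord l)

/-- The objects of the Karoubian category generated by the graded bimodules `B i`, a full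
subcategory of the category of graded bimodules: the direct summands of the finite direct sums of
shifted tensor products of bimodules `B i`. -/
inductive karoubiGenerated : ObjectProperty (GrBimod 𝒜)
  | word (l : List ι) (n : ℤ) : karoubiGenerated (shift n (tensorWord B l))
  | biprod {M N : GrBimod 𝒜} :
      karoubiGenerated M → karoubiGenerated N → karoubiGenerated (M ⊞ N)
  | retract {M N : GrBimod 𝒜} : Retract M N → karoubiGenerated N → karoubiGenerated M

variable {B}

theorem karoubiGenerated.of_iso {M N : GrBimod 𝒜} (e : M ≅ N) (h : karoubiGenerated B N) :
    karoubiGenerated B M :=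
  .retract (Retract.ofIso e) h

theorem karoubiGenerated.shift {M : GrBimod 𝒜} (n : ℤ) (h : karoubiGenerated B M) :
    karoubiGenerated B (shift n M) := by
  induction h with
  | word l k => exact .of_iso (shiftShift k n _) (.word l (k + n))
  | biprod _ _ hM hN => exact .of_iso (mapBiprodIso (shiftFunctor n) _ _) (.biprod hM hN)
  | retract r _ hN => exact .retract (r.map (shiftFunctor n)) hN

/-- The tensor product of two words is the concatenated word. -/
def tensorWordAppend (B : ι → GrBimod 𝒜) : ∀ l l' : List ι,
    tensor (tensorWord B l) (tensorWord B l') ≅ tensorWord B (l ++ l')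
  | [], l' => leftUnitIso (tensorWord B l')
  | i :: l, l' => assocIso (B i) (tensorWord B l) (tensorWord B l') ≪≫
      (tensorLeft (B i)).mapIso (tensorWordAppend B l l')

theorem karoubiGenerated.tensor {M N : GrBimod 𝒜} (hM : karoubiGenerated B M)
    (hN : karoubiGenerated B N) : karoubiGenerated B (M ⊗ N) := by
  induction hM with
  | word l n =>
    refine .of_iso (shiftTensor n (tensorWord B l) N) (.shift n ?_)
    change karoubiGenerated B (tensorWord B l ⊗ N)
    induction hN with
    | word l' k =>
      exact .of_iso (tensorShift k (tensorWord B l) (tensorWord B l'))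
        (.shift k (.of_iso (tensorWordAppend B l l') (.of_iso (shiftZero _).symm (.word _ 0))))
    | biprod _ _ hN hN' => exact .of_iso (mapBiprodIso (tensorLeft _) _ _) (.biprod hN hN')
    | retract r _ hN => exact .retract (r.map (tensorLeft _)) hN
  | biprod _ _ hM hM' => exact .of_iso (mapBiprodIso (tensorRight N) _ _) (.biprod hM hM')
  | retract r _ hM => exact .retract (r.map (tensorRight N)) hM

variable (B)

theorem karoubiGenerated_regular : karoubiGenerated B (regular 𝒜) :=
  .of_iso (shiftZero _).symm (.word [] 0)

instance : (karoubiGenerated B).IsMonoidal where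
  prop_unit := karoubiGenerated_regular B
  prop_tensor _ _ hM hN := hM.tensor hN

instance : HasBinaryBiproducts (karoubiGenerated B).FullSubcategory where
  has_binary_biproduct M N := HasBinaryBiproduct.mk
    { bicone :=
        { pt := ⟨M.obj ⊞ N.obj, .biprod M.property N.property⟩
          fst := ObjectProperty.homMk biprod.fst
          snd := ObjectProperty.homMk biprod.snd
          inl := ObjectProperty.homMk biprod.inl
          inr := ObjectProperty.homMk biprod.inr
          inl_fst := ObjectProperty.hom_ext _ biprod.inl_fst
          inl_snd := ObjectProperty.hom_ext _ biprod.inl_snd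
          inr_fst := ObjectProperty.hom_ext _ biprod.inr_fst
          inr_snd := ObjectProperty.hom_ext _ biprod.inr_snd }
      isBilimit := isBinaryBilimitOfTotal _ (ObjectProperty.hom_ext _ biprod.total) }

/-- The shifted bimodule `R(n)`, as an object of the generated category. -/
def regularShift (n : ℤ) : (karoubiGenerated B).FullSubcategory :=
  ⟨shift n (regular 𝒜), (karoubiGenerated_regular B).shift n⟩

/-- The homomorphism which sends `v ^ n` to the class of `R(n)`. -/
noncomputable def shiftHom :
    LaurentPolynomial ℤ →+* SplitK0 (karoubiGenerated B).FullSubcategory :=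
  (AddMonoidAlgebra.lift ℤ (SplitK0 (karoubiGenerated B).FullSubcategory) ℤ
    { toFun := fun n => splitClass (regularShift B n.toAdd)
      map_one' := splitClass_eq (ObjectProperty.isoMk _ (shiftZero _))
      map_mul' := fun n k => by
        rw [splitClass_mul]
        exact splitClass_eq (ObjectProperty.isoMk _
          ((shiftShift _ _ _).symm ≪≫ shiftIso _ (rightUnitIso _).symm ≪≫
            (tensorShift _ _ _).symm)) }).toRingHom

theorem shiftHom_T (n : ℤ) :
    shiftHom B (LaurentPolynomial.T n) = splitClass (regularShift B n) := by
  change AddMonoidAlgebra.lift ℤ _ ℤ _ (AddMonoidAlgebra.single n 1) = _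
  rw [AddMonoidAlgebra.lift_single, one_smul]
  rfl

theorem regularShift_mul (n : ℤ) (M : (karoubiGenerated B).FullSubcategory) :
    splitClass (regularShift B n) * splitClass M =
      splitClass (𝒞 := (karoubiGenerated B).FullSubcategory)
        ⟨shift n M.obj, M.property.shift n⟩ := by
  rw [splitClass_mul]
  exact splitClass_eq (ObjectProperty.isoMk _
    (shiftTensor n (regular 𝒜) M.obj ≪≫ shiftIso n (leftUnitIso M.obj)))

theorem mul_regularShift (n : ℤ) (M : (karoubiGenerated B).FullSubcategory) :
    splitClass M * splitClass (regularShift B n) =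
      splitClass (𝒞 := (karoubiGenerated B).FullSubcategory)
        ⟨shift n M.obj, M.property.shift n⟩ := by
  rw [splitClass_mul]
  exact splitClass_eq (ObjectProperty.isoMk _
    (tensorShift n M.obj (regular 𝒜) ≪≫ shiftIso n (rightUnitIso M.obj)))

theorem shiftHom_comm (c : LaurentPolynomial ℤ)
    (x : SplitK0 (karoubiGenerated B).FullSubcategory) :
    shiftHom B c * x = x * shiftHom B c := by
  induction c using LaurentPolynomial.induction_on' with
  | add p q hp hq => rw [map_add, add_mul, mul_add, hp, hq]
  | C_mul_T n a =>
    have ha : shiftHom B (LaurentPolynomial.C a) = (a : SplitK0 _) := by simp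
    have hc : splitClass (regularShift B n) * x = x * splitClass (regularShift B n) := by
      induction x using splitClass_induction with
      | h X => rw [regularShift_mul, mul_regularShift]
      | h0 => rw [zero_mul, mul_zero]
      | hneg x hx => rw [mul_neg, neg_mul, hx]
      | hadd x y hx hy => rw [mul_add, add_mul, hx, hy]
    rw [map_mul, ha, shiftHom_T, mul_assoc, hc, ← mul_assoc, ← mul_assoc, Int.cast_comm]

/-- The split Grothendieck ring is a `ℤ[v, v⁻¹]`-algebra, where `v` acts by the grading shift
`(1)`. -/
noncomputable instance :
    Algebra (LaurentPolynomial ℤ) (SplitK0 (karoubiGenerated B).FullSubcategory) :=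
  (shiftHom B).toAlgebra' (shiftHom_comm B)

theorem T_smul_splitClass (n : ℤ) (M : (karoubiGenerated B).FullSubcategory) :
    (LaurentPolynomial.T n : LaurentPolynomial ℤ) • splitClass M =
      splitClass (𝒞 := (karoubiGenerated B).FullSubcategory)
        ⟨shift n M.obj, M.property.shift n⟩ := by
  rw [Algebra.smul_def, ← regularShift_mul, ← shiftHom_T]
  rfl

end GrBimod

end Generated

/-! ### Polynomial functions and regular functions -/

section PolynomialFunctions

/-- Composition with `g`, as a homomorphism of algebras of functions. -/
def precomp {ι κ : Type*} (g : κ → ι) : (ι → ℝ) →ₐ[ℝ] (κ → ℝ) :=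
  AlgHom.ofLinearMap (LinearMap.funLeft ℝ ℝ g) rfl (fun _ _ => rfl)

/-- The algebra `𝒪(E) = S(E*)` of polynomial functions on a real vector space `E`: the algebra of
functions generated by the linear forms. -/
def polyFun (E : Type u) [AddCommGroup E] [Module ℝ E] : Subalgebra ℝ (E → ℝ) :=
  Algebra.adjoin ℝ (Set.range fun (φ : Module.Dual ℝ E) (x : E) => φ x)

variable {E E' : Type u} [AddCommGroup E] [Module ℝ E] [AddCommGroup E'] [Module ℝ E']

/-- The algebra `𝒪(X)` of regular functions on `X ⊆ E`: the restrictions to `X` of polynomial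
functions. -/
def regFun (X : Set E) : Subalgebra ℝ (X → ℝ) :=
  (polyFun E).map (precomp (Subtype.val : X → E))

/-- Restriction of polynomial functions to `X`. -/
def restrictTo (X : Set E) : polyFun E →ₐ[ℝ] regFun X :=
  AlgHom.codRestrict ((precomp (Subtype.val : X → E)).comp (polyFun E).val) _
    (fun f => ⟨f, f.2, rfl⟩)

theorem polyFun_comp (L : E' →ₗ[ℝ] E) {f : E → ℝ} (hf : f ∈ polyFun E) :
    precomp L f ∈ polyFun E' := by
  have h : polyFun E ≤ (polyFun E').comap (precomp L) := by
    refine Algebra.adjoin_le ?_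
    rintro _ ⟨φ, rfl⟩
    exact Algebra.subset_adjoin ⟨φ ∘ₗ L, rfl⟩
  exact h hf

/-- The pullback `f ↦ f ∘ L` of polynomial functions along a linear map. -/
def polyPullback (L : E' →ₗ[ℝ] E) : polyFun E →ₐ[ℝ] polyFun E' :=
  AlgHom.codRestrict ((precomp L).comp (polyFun E).val) _ (fun f => polyFun_comp L f.2)

/-- The functions in `F` which are homogeneous of degree `n`, for an algebra `F` of functions
on `ι` and a map `p` from `ι` to a vector space: `f (c x) = c ^ n f x` for all scalars `c` and all
points `x` and `c x` of `ι`. -/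
def homogeneousPart {ι : Type*} (p : ι → E) (F : Subalgebra ℝ (ι → ℝ)) (n : ℕ) :
    Submodule ℝ F where
  carrier := {f | ∀ (c : ℝ) (i j : ι), p j = c • p i → f.1 j = c ^ n * f.1 i}
  zero_mem' := fun c i j _ => by simp
  add_mem' := fun {f g} hf hg c i j h => by
    change f.1 j + g.1 j = c ^ n * (f.1 i + g.1 i)
    rw [hf c i j h, hg c i j h, mul_add]
  smul_mem' := fun a f hf c i j h => by
    change a * f.1 j = c ^ n * (a * f.1 i)
    rw [hf c i j h, mul_left_comm]

/-- The grading of an algebra of functions in which linear forms have degree `2`: the part of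
degree `2 n` consists of the functions which are homogeneous of degree `n`; the parts of odd or
negative degree are zero. -/
def evenGrading {ι : Type*} (p : ι → E) (F : Subalgebra ℝ (ι → ℝ)) (k : ℤ) : Submodule ℝ F :=
  ⨆ n : ℕ, ⨆ _ : 2 * (n : ℤ) = k, homogeneousPart p F n

section Grading

variable {ι : Type*} {p : ι → E} {F : Subalgebra ℝ (ι → ℝ)}

theorem homogeneousPart_le (n : ℕ) : homogeneousPart p F n ≤ evenGrading p F (2 * n) :=
  le_iSup₂_of_le n rfl le_rfl

theorem evenGrading_le {k : ℤ} {G : Submodule ℝ F}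
    (h : ∀ n : ℕ, 2 * (n : ℤ) = k → homogeneousPart p F n ≤ G) : evenGrading p F k ≤ G :=
  iSup₂_le h

theorem one_mem_evenGrading : (1 : F) ∈ evenGrading p F 0 :=
  homogeneousPart_le 0 (fun c i j _ => by simp)

theorem mul_mem_evenGrading {k l : ℤ} {f g : F} (hf : f ∈ evenGrading p F k)
    (hg : g ∈ evenGrading p F l) : f * g ∈ evenGrading p F (k + l) := by
  suffices h : evenGrading p F k * evenGrading p F l ≤ evenGrading p F (k + l) from
    h (Submodule.mul_mem_mul hf hg)
  unfold evenGrading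
  simp only [Submodule.iSup_mul, Submodule.mul_iSup]
  refine iSup₂_le fun n hn => iSup₂_le fun m hm => ?_
  refine le_iSup₂_of_le (n + m) (by push_cast; omega) (Submodule.mul_le.2 ?_)
  intro f hf g hg c i j h
  change f.1 j * g.1 j = c ^ (n + m) * (f.1 i * g.1 i)
  rw [hf c i j h, hg c i j h, pow_add]
  ring

theorem evenGrading_isInternal (hp : ∀ (c : ℝ) (i : ι), ∃ j, p j = c • p i)
    (hF : F = Algebra.adjoin ℝ (Set.range fun (φ : Module.Dual ℝ E) (i : ι) => φ (p i))) :
    DirectSum.IsInternal (evenGrading p F) := by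
  classical
  rw [DirectSum.isInternal_submodule_iff_iSupIndep_and_iSup_eq_top]
  constructor
  · choose s hs using hp 4
    have hσ : ∀ f ∈ F, precomp s f ∈ F := by
      have h : F ≤ F.comap (precomp s) := by
        conv_lhs => rw [hF]
        refine Algebra.adjoin_le ?_
        rintro _ ⟨φ, rfl⟩
        have h1 : (fun i => φ (p i)) ∈ F := by
          rw [hF]
          exact Algebra.subset_adjoin ⟨φ, rfl⟩
        have h2 : precomp s (fun i => φ (p i)) = (4 : ℝ) • fun i => φ (p i) := by
          funext i
          change φ (p (s i)) = 4 * φ (p i)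
          rw [hs i, map_smul, smul_eq_mul]
        change precomp s (fun i => φ (p i)) ∈ F
        rw [h2]
        exact F.smul_mem h1 4
      exact fun f hf => h hf
    let σ : Module.End ℝ F := LinearMap.restrict (precomp s).toLinearMap
      (p := Subalgebra.toSubmodule F) (q := Subalgebra.toSubmodule F) hσ
    refine ((Module.End.eigenspaces_iSupIndep σ).comp
      (f := fun k : ℤ => (2 : ℝ) ^ k) (zpow_right_injective₀ (by norm_num) (by norm_num))).mono ?_
    intro k
    refine evenGrading_le ?_
    rintro n rfl f hf
    rw [Function.comp_apply, Module.End.mem_eigenspace_iff]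
    apply Subtype.ext
    funext i
    change f.1 (s i) = (2 : ℝ) ^ (2 * (n : ℤ)) * f.1 i
    rw [hf 4 i (s i) (hs i), zpow_mul]
    norm_num
  · have hmul : ∀ f ∈ ⨆ k, evenGrading p F k, ∀ g ∈ ⨆ k, evenGrading p F k,
        f * g ∈ ⨆ k, evenGrading p F k := by
      intro f hf g hg
      suffices h : (⨆ k, evenGrading p F k) * (⨆ k, evenGrading p F k) ≤
        ⨆ k, evenGrading p F k from h (Submodule.mul_mem_mul hf hg)
      simp only [Submodule.iSup_mul, Submodule.mul_iSup]
      refine iSup_le fun k => iSup_le fun l => Submodule.mul_le.2 fun f hf g hg => ?_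
      exact Submodule.mem_iSup_of_mem _ (mul_mem_evenGrading hf hg)
    have hone : (1 : F) ∈ ⨆ k, evenGrading p F k :=
      Submodule.mem_iSup_of_mem 0 one_mem_evenGrading
    rw [eq_top_iff]
    rintro ⟨f, hf⟩ -
    have hf' := hf
    rw [hF] at hf'
    induction hf' using Algebra.adjoin_induction with
    | mem f h =>
      obtain ⟨φ, rfl⟩ := h
      refine Submodule.mem_iSup_of_mem _ (homogeneousPart_le 1 ?_)
      intro c i j h
      change φ (p j) = c ^ 1 * φ (p i)
      rw [h, map_smul, smul_eq_mul, pow_one]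
    | algebraMap r =>
      have h := Submodule.smul_mem _ r hone
      rw [← Algebra.algebraMap_eq_smul_one] at h
      exact h
    | add x y hx hy h1 h2 =>
      rw [← hF] at hx hy
      exact add_mem (h1 hx) (h2 hy)
    | mul x y hx hy h1 h2 =>
      rw [← hF] at hx hy
      exact hmul _ (h1 hx) _ (h2 hy)

end Grading

/-- The grading of `𝒪(E)` with linear forms in degree `2`. -/
def polyGrading (E : Type u) [AddCommGroup E] [Module ℝ E] : ℤ → Submodule ℝ (polyFun E) :=
  evenGrading id (polyFun E)

theorem polyGrading_isInternal : DirectSum.IsInternal (polyGrading E) :=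
  evenGrading_isInternal (fun c i => ⟨c • i, rfl⟩) rfl

noncomputable instance : GradedAlgebra (polyGrading E) where
  one_mem := one_mem_evenGrading
  mul_mem _ _ _ _ hf hg := mul_mem_evenGrading hf hg
  toDecomposition := polyGrading_isInternal.chooseDecomposition

/-- The grading of `𝒪(X)` with linear forms in degree `2`. -/
def regGrading (X : Set E) : ℤ → Submodule ℝ (regFun X) :=
  evenGrading Subtype.val (regFun X)

theorem regGrading_isInternal {X : Set E} (hX : ∀ (c : ℝ), ∀ x ∈ X, c • x ∈ X) :
    DirectSum.IsInternal (regGrading X) := by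
  refine evenGrading_isInternal (fun c i => ⟨⟨c • i.1, hX c _ i.2⟩, rfl⟩) ?_
  rw [regFun, polyFun, AlgHom.map_adjoin, ← Set.range_comp]
  rfl

theorem pullback_mem_regGrading (L : E' →ₗ[ℝ] E) (X : Set E') {k : ℤ} {f : polyFun E}
    (hf : f ∈ polyGrading E k) : restrictTo X (polyPullback L f) ∈ regGrading X k := by
  have h : polyGrading E k ≤ (regGrading X k).comap
      ((restrictTo X).comp (polyPullback L)).toLinearMap := by
    refine evenGrading_le ?_
    rintro n rfl f hf
    refine homogeneousPart_le n ?_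
    intro c i j h
    refine hf c (L i.1) (L j.1) ?_
    rw [id, id, h, map_smul]
  exact h hf

theorem pullback_mem_polyGrading (L : E' →ₗ[ℝ] E) {k : ℤ} {f : polyFun E}
    (hf : f ∈ polyGrading E k) : polyPullback L f ∈ polyGrading E' k := by
  have h : polyGrading E k ≤ (polyGrading E' k).comap (polyPullback L).toLinearMap := by
    refine evenGrading_le ?_
    rintro n rfl f hf
    refine homogeneousPart_le n ?_
    intro c i j h
    refine hf c (L i) (L j) ?_
    rw [id, id, ← map_smul]
    exact congrArg L h
  exact h hf

end PolynomialFunctions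

/-! ### Bimodules attached to a representation -/

section Representation

variable {W : Type*} [Group W] {V : Type u} [AddCommGroup V] [Module ℝ V]

/-- A reflection faithful representation of a Coxeter system: a finite-dimensional faithful
representation in which the elements of `W` whose fixed space has codimension `1` are precisely the
reflections. -/
structure IsReflectionFaithful {ι : Type*} {M : CoxeterMatrix ι} (cs : CoxeterSystem M W)
    (ρ : Representation ℝ W V) : Prop where
  finiteDimensional : FiniteDimensional ℝ V
  injective : Function.Injective ρ
  codim_fixed : ∀ w, Module.finrank ℝ (V ⧸ LinearMap.eqLocus (ρ w) LinearMap.id) = 1 ↔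
    cs.IsReflection w

variable (ρ : Representation ℝ W V)

/-- The graph `Gr(w) = {(w v, v) | v ∈ V}`. -/
def graph (w : W) : Set (V × V) := Set.range fun v => (ρ w v, v)

/-- The union of the graphs `Gr(w)`, for `w ∈ A`. -/
def graphUnion (A : Set W) : Set (V × V) := ⋃ w ∈ A, graph ρ w

theorem smul_mem_graphUnion (A : Set W) (c : ℝ) :
    ∀ x ∈ graphUnion ρ A, c • x ∈ graphUnion ρ A := by
  intro x hx
  simp only [graphUnion, graph, Set.mem_iUnion, Set.mem_range] at hx ⊢
  obtain ⟨w, hw, v, rfl⟩ := hx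
  exact ⟨w, hw, c • v, by rw [map_smul]; rfl⟩

/-- The graded bimodule `R(A) = 𝒪(⋃_{w ∈ A} Gr(w))`, with the action
`(a f b)(u, v) = a(u) f(u, v) b(v)`. -/
def graphBimod (A : Set W) : GrBimod (polyGrading V) where
  carrier := regFun (graphUnion ρ A)
  lact := (Algebra.lmul ℝ (regFun (graphUnion ρ A))).comp
    ((restrictTo (graphUnion ρ A)).comp (polyPullback (LinearMap.fst ℝ V V)))
  ract := (Algebra.lmul ℝ (regFun (graphUnion ρ A))).comp
    ((restrictTo (graphUnion ρ A)).comp (polyPullback (LinearMap.snd ℝ V V)))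
  lact_ract a b f := mul_left_comm _ _ f
  deg := regGrading (graphUnion ρ A)
  isInternal := regGrading_isInternal (smul_mem_graphUnion ρ A)
  lact_mem ha hf := mul_mem_evenGrading (pullback_mem_regGrading _ _ ha) hf
  ract_mem {i j b f} hf hb := by
    rw [add_comm]
    exact mul_mem_evenGrading (pullback_mem_regGrading _ _ hb) hf

/-- The subalgebra `R^t` of polynomial functions invariant under `t`. -/
def invariants (t : W) : Subalgebra ℝ (polyFun V) :=
  AlgHom.equalizer (polyPullback (ρ t)) (AlgHom.id ℝ (polyFun V))

theorem mem_invariants {t : W} {f : polyFun V} :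
    f ∈ invariants ρ t ↔ ∀ v, f.1 (ρ t v) = f.1 v :=
  Subtype.ext_iff.trans funext_iff

theorem invariants_isGraded (t : W) :
    GrBimod.IsGradedSubalgebra (polyGrading V) (invariants ρ t) := fun f hf =>
  mem_iSup_inf_eqLocus _ polyGrading_isInternal (polyPullback (ρ t)).toLinearMap
    (fun _ _ h => pullback_mem_polyGrading _ h) f hf

/-- The graded bimodule `B_t = R ⊗_{R^t} R(1)`. -/
noncomputable def reflBimod (t : W) : GrBimod (polyGrading V) :=
  GrBimod.shift 1 (GrBimod.balTensor (invariants ρ t) (GrBimod.regular (polyGrading V))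
    (GrBimod.regular (polyGrading V)) (invariants_isGraded ρ t))

variable {ι : Type*} {M : CoxeterMatrix ι} (cs : CoxeterSystem M W)

/-- The Karoubian category generated by the graded bimodules `B_t`, for all reflections `t`. -/
abbrev ReflCat : Type (u + 1) :=
  (GrBimod.karoubiGenerated
    (fun t : {t : W // cs.IsReflection t} => reflBimod ρ t.1)).FullSubcategory

end Representation

/-- The set of all nonempty subsets of `W` which are stable under left multiplication by some
reflection. -/
def stableSets {W : Type*} [Group W] {ι : Type*} {M : CoxeterMatrix ι}
    (cs : CoxeterSystem M W) : Set (Set W) :=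
  {A | A.Nonempty ∧ ∃ t, cs.IsReflection t ∧ (fun x => t * x) '' A = A}

/-! ### The Coxeter group of type `A₂` -/

section TypeATwo

open Equiv

/-! Write 𝒳 for `stableSets cs`. Everything rests on one splitting,
`IsReflectionFaithful.nonempty_tensor_iso`: B_t ⊗ R(A) ≅ R(A ∪ tA)(1) ⊕ R(A ∩ tA)(-1) whenever A =
{1} or A ∈ 𝒳. Since R = R^t + αR^t for a root α of t and R(A) is generated by 1, the bimodule B_t ⊗
R(A) is generated by 1⊗1 and 1⊗λ with λ(u,v) = p(u) - q(v), as soon as p is not t-invariant. Its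
elements are detected by the two evaluations (a⊗b)⊗f ↦ abf and (a⊗b)⊗f ↦ t(a)bf
(`exists_twistEval`), so relations between the generators become equations between polynomial
functions on the graphs of x and tx for x ∈ A. If λ vanishes on Gr(x) for all x ∈ A \ tA, these
equations decouple: 1⊗1 generates a copy of R(A ∪ tA), 1⊗λ a copy of R(A ∩ tA), and the sum is
direct (`nonempty_reflTensor_iso`). Type A₂ enters through the existence of λ: A \ tA lies in a pair
{a, b} for which r = ab⁻¹ is a reflection other than t (`exists_sdiff_image_subset_pair`), and any p
that is r-invariant but not t-invariant, with q = p∘a, will do.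

As R ≅ R({1}), and as A ∪ tA and A ∩ tA are in 𝒳 or empty, the finite sums of shifts of R and of the
R(A) are stable under B_t ⊗ -. They are also stable under direct summands: a homomorphism out of
R(A)(n) is determined by the image of 1, so its endomorphisms are real scalars
(`graphShift_exists_eq_smul`), and the exchange argument `FinSum.of_retract` applies. Hence every
object of the category is such a sum. Conversely, every A ∈ 𝒳 is reached from {1} by the operations
A ∪ tA and A ∩ tA, so every R(A) is in the category (`karoubiGenerated_graphBimod`).

A nonzero map R(A)(n) → R(B)(n) forces B ⊆ A, because functions vanishing on the graphs of A then
vanish on those of B; and there is no nonzero map R(A)(n) → R(B)(m) for m < n. So every composite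
R(A)(n) → R(B)(m) → R(A)(n) is zero unless A = B and n = m (`graphShift_comp_eq_zero`). This
separates isomorphism classes. It also shows that the multiplicity of R(A)(n) in N, the dimension of
Hom(R(A)(n), N) modulo the maps killed by all compositions back to R(A)(n), is an additive function
which is a Kronecker delta on the indecomposables. These functions make the classes [R(A)] linearly
independent over ℤ[v, v⁻¹]; the rank is 19 = |𝒳| plus one for R itself. -/

/-- The pair of transpositions `(0 1)`, `(1 2)` generating the symmetric group on three letters. -/
def adjacentSwap (i : Fin 2) : Perm (Fin 3) := swap i.castSucc i.succ

theorem isLiftable_adjacentSwap : (CoxeterMatrix.A 2).IsLiftable adjacentSwap := by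
  unfold CoxeterMatrix.IsLiftable
  decide

variable {W : Type*} [Group W] (cs : CoxeterSystem (CoxeterMatrix.A 2) W)

/-- The homomorphism from the Coxeter group of type `A₂` to the symmetric group. -/
def toPermThree : W →* Perm (Fin 3) := cs.lift ⟨adjacentSwap, isLiftable_adjacentSwap⟩

theorem toPermThree_simple (i : Fin 2) : toPermThree cs (cs.simple i) = adjacentSwap i :=
  cs.lift_apply_simple isLiftable_adjacentSwap i

/-- In `(s₀ s₁)³ = 1` the first three letters and the last three form mutually inverse words, and
reversing a palindrome changes nothing. -/
theorem braid_typeATwo : cs.simple 1 * cs.simple 0 * cs.simple 1 =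
    cs.simple 0 * cs.simple 1 * cs.simple 0 := by
  have h := cs.simple_mul_simple_pow 0 1
  rw [show (CoxeterMatrix.A 2) 0 1 = 3 by decide] at h
  have h2 : cs.simple 0 * cs.simple 1 * cs.simple 0 *
      (cs.simple 1 * cs.simple 0 * cs.simple 1) = 1 := by
    rw [← h]; simp only [pow_succ, pow_zero, one_mul, mul_assoc]
  rw [eq_comm, eq_inv_of_mul_eq_one_left h2]
  simp only [mul_inv_rev, cs.inv_simple, mul_assoc]

/-- The six words include the identity and are stable under left multiplication by either generator,
the braid relation returning the longer products to the list. This bounds the order of the group and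
reduces later claims to six cases. -/
theorem normalForms_typeATwo (w : W) :
    w = 1 ∨ w = cs.simple 0 ∨ w = cs.simple 1 ∨ w = cs.simple 0 * cs.simple 1 ∨
      w = cs.simple 1 * cs.simple 0 ∨ w = cs.simple 0 * cs.simple 1 * cs.simple 0 := by
  have h0 := cs.simple_mul_simple_self 0
  have h1 := cs.simple_mul_simple_self 1
  have h0' := fun x => cs.simple_mul_simple_cancel_left (w := x) 0
  have h1' := fun x => cs.simple_mul_simple_cancel_left (w := x) 1
  have hb := braid_typeATwo cs
  induction w using cs.simple_induction_left with
  | one => exact Or.inl rfl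
  | mul_simple_left w i ih =>
    fin_cases i
    · rcases ih with rfl | rfl | rfl | rfl | rfl | rfl <;>
        simp [mul_assoc, h0, h0']
    · have h3 : cs.simple 1 * (cs.simple 0 * (cs.simple 1 * cs.simple 0)) =
          cs.simple 0 * cs.simple 1 := by
        rw [← mul_assoc, ← mul_assoc, hb, mul_assoc, h0, mul_one]
      rw [mul_assoc, mul_assoc] at hb
      rcases ih with rfl | rfl | rfl | rfl | rfl | rfl <;>
        simp [mul_assoc, h1, h1', hb, h3]

/-- Conjugates of the generators are odd because the sign is conjugation invariant; among the six
normal forms only three are odd, and each of these is a conjugate of a generator. This makes being a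
reflection decidable on permutations. -/
theorem isReflection_iff_sign (w : W) :
    cs.IsReflection w ↔ Perm.sign (toPermThree cs w) = -1 := by
  constructor
  · rintro ⟨x, i, rfl⟩
    rw [map_mul, map_mul, map_mul, map_mul, map_inv, map_inv, mul_inv_cancel_comm,
      toPermThree_simple]
    revert i
    decide
  · intro h
    rcases normalForms_typeATwo cs w with rfl | rfl | rfl | rfl | rfl | rfl
    · simp at h
    · exact cs.isReflection_simple 0
    · exact cs.isReflection_simple 1
    · simp only [map_mul, toPermThree_simple] at h
      exact absurd h (by decide)
    · simp only [map_mul, toPermThree_simple] at h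
      exact absurd h (by decide)
    · exact ⟨cs.simple 0, 1, by rw [cs.inv_simple]⟩

/-- Inspection of normal forms: the five nontrivial words have nontrivial images, and with the
identity these images exhaust the permutations. -/
theorem toPermThree_bijective : Function.Bijective (toPermThree cs) := by
  constructor
  · rw [injective_iff_map_eq_one]
    intro w hw
    rcases normalForms_typeATwo cs w with rfl | rfl | rfl | rfl | rfl | rfl
    · rfl
    all_goals
      simp only [map_mul, toPermThree_simple] at hw
      exact absurd hw (by decide)
  · intro g
    have h : ∀ g : Perm (Fin 3), g = 1 ∨ g = adjacentSwap 0 ∨ g = adjacentSwap 1 ∨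
        g = adjacentSwap 0 * adjacentSwap 1 ∨ g = adjacentSwap 1 * adjacentSwap 0 ∨
        g = adjacentSwap 0 * adjacentSwap 1 * adjacentSwap 0 := by decide
    simp only [← toPermThree_simple cs, ← map_mul] at h
    rcases h g with rfl | h | h | h | h | h
    · exact ⟨1, map_one _⟩
    all_goals exact ⟨_, h.symm⟩

/-- The Coxeter group of type `A₂` is the symmetric group on three letters. -/
noncomputable def equivPermThree : W ≃* Perm (Fin 3) :=
  MulEquiv.ofBijective (toPermThree cs) (toPermThree_bijective cs)

theorem isReflection_iff (w : W) :
    cs.IsReflection w ↔ Perm.sign (equivPermThree cs w) = -1 :=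
  isReflection_iff_sign cs w

theorem isReflection_symm_iff (g : Perm (Fin 3)) :
    cs.IsReflection ((equivPermThree cs).symm g) ↔ Perm.sign g = -1 := by
  rw [isReflection_iff, MulEquiv.apply_symm_apply]

theorem finite_typeATwo {W : Type*} [Group W] (cs : CoxeterSystem (CoxeterMatrix.A 2) W) :
    Finite W :=
  Finite.of_equiv _ (equivPermThree cs).toEquiv.symm

-- A product of two reflections is an even permutation of three letters, so its order divides 3.
set_option maxRecDepth 10000 in
theorem IsReflection.mul_pow_three {r t : W} (hr : cs.IsReflection r) (ht : cs.IsReflection t) :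
    (r * t) ^ 3 = 1 := by
  rw [isReflection_iff] at hr ht
  apply (equivPermThree cs).injective
  rw [map_pow, map_mul, map_one]
  revert hr ht
  generalize equivPermThree cs r = a
  generalize equivPermThree cs t = b
  revert a b
  decide

/-! ### Subsets of the group as finite sets of permutations -/

/-- The subset of the Coxeter group corresponding to a set of permutations. -/
def setOfPerms (A : Finset (Perm (Fin 3))) : Set W := equivPermThree cs ⁻¹' A

theorem mem_setOfPerms {A : Finset (Perm (Fin 3))} {w : W} :
    w ∈ setOfPerms cs A ↔ equivPermThree cs w ∈ A := Iff.rfl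

theorem setOfPerms_injective : Function.Injective (setOfPerms cs) := fun _ _ h =>
  Finset.coe_injective ((equivPermThree cs).surjective.preimage_injective h)

theorem setOfPerms_surjective : Function.Surjective (setOfPerms cs) := by
  intro A
  classical
  have := finite_typeATwo cs
  refine ⟨(Set.toFinite (equivPermThree cs '' A)).toFinset, ?_⟩
  ext w
  rw [mem_setOfPerms, Set.Finite.mem_toFinset]
  exact (equivPermThree cs).injective.mem_set_image

theorem setOfPerms_singleton_one : setOfPerms cs {1} = {1} := by
  ext w
  simp [mem_setOfPerms]

theorem setOfPerms_union (A B : Finset (Perm (Fin 3))) :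
    setOfPerms cs (A ∪ B) = setOfPerms cs A ∪ setOfPerms cs B := by
  ext w
  simp [mem_setOfPerms]

theorem setOfPerms_inter (A B : Finset (Perm (Fin 3))) :
    setOfPerms cs (A ∩ B) = setOfPerms cs A ∩ setOfPerms cs B := by
  ext w
  simp [mem_setOfPerms]

theorem setOfPerms_image (A : Finset (Perm (Fin 3))) (t : W) :
    setOfPerms cs (A.image (equivPermThree cs t * ·)) = (fun x => t * x) '' setOfPerms cs A := by
  ext w
  simp only [mem_setOfPerms, Finset.mem_image, Set.mem_image]
  constructor
  · rintro ⟨g, hg, h⟩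
    refine ⟨(equivPermThree cs).symm g, by simpa using hg, (equivPermThree cs).injective ?_⟩
    rw [map_mul, MulEquiv.apply_symm_apply, h]
  · rintro ⟨x, hx, rfl⟩
    exact ⟨_, hx, (map_mul _ _ _).symm⟩

theorem setOfPerms_image_symm (A : Finset (Perm (Fin 3))) (g : Perm (Fin 3)) :
    setOfPerms cs (A.image (g * ·)) =
      (fun x => (equivPermThree cs).symm g * x) '' setOfPerms cs A := by
  rw [← setOfPerms_image, MulEquiv.apply_symm_apply]

/-- The nonempty sets of permutations which are stable under left multiplication by some
transposition. -/
def stablePerms : Finset (Finset (Perm (Fin 3))) :=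
  Finset.univ.filter fun A => A.Nonempty ∧ ∃ t, Perm.sign t = -1 ∧ A.image (t * ·) = A

theorem mem_stablePerms {A : Finset (Perm (Fin 3))} :
    A ∈ stablePerms ↔ A.Nonempty ∧ ∃ t, Perm.sign t = -1 ∧ A.image (t * ·) = A := by
  simp [stablePerms]

-- For each of the three transpositions, left multiplication has three orbits, hence 7 nonempty
-- stable sets. Two distinct transpositions generate the group, so only the full set is counted more
-- than once: 3 · 7 - 2 = 19.
set_option maxRecDepth 100000 in
theorem card_stablePerms : stablePerms.card = 19 := by decide

theorem setOfPerms_mem_stableSets {A : Finset (Perm (Fin 3))} :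
    setOfPerms cs A ∈ stableSets cs ↔ A ∈ stablePerms := by
  rw [mem_stablePerms]
  refine and_congr ?_ ?_
  · constructor
    · rintro ⟨x, hx⟩
      exact ⟨_, hx⟩
    · rintro ⟨g, hg⟩
      exact ⟨(equivPermThree cs).symm g, by simpa [mem_setOfPerms] using hg⟩
  · constructor
    · rintro ⟨t, ht, h⟩
      rw [← setOfPerms_image] at h
      exact ⟨_, (isReflection_iff cs t).1 ht, setOfPerms_injective cs h⟩
    · rintro ⟨g, hg, h⟩
      refine ⟨_, (isReflection_symm_iff cs g).2 hg, ?_⟩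
      rw [← setOfPerms_image_symm, h]

theorem ncard_stableSets : (stableSets cs).ncard = 19 := by
  have h : stableSets cs = setOfPerms cs '' stablePerms := by
    ext A
    obtain ⟨A, rfl⟩ := setOfPerms_surjective cs A
    rw [setOfPerms_mem_stableSets, (setOfPerms_injective cs).mem_set_image, Finset.mem_coe]
  rw [h, Set.ncard_image_of_injective _ (setOfPerms_injective cs), Set.ncard_coe_finset,
    card_stablePerms]

/-- Stability of `{1}` under `t` would give `t = 1`, which is even. Thus `R ≅ R({1})` is not among
the 19 other bimodules. -/
theorem singleton_one_notMem_stableSets : ({1} : Set W) ∉ stableSets cs := by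
  rintro ⟨-, t, ht, h⟩
  rw [Set.image_singleton, mul_one, Set.singleton_eq_singleton_iff] at h
  rw [isReflection_iff, h] at ht
  simp at ht

-- The difference is empty if `A` is stable under `t` or is everything, and it is `{1}` if `A =
-- {1}`. Suppose `A` is stable under a transposition `s ≠ t`. If `|A| = 2`, then `A` is disjoint
-- from `tA`, and the difference is `A = {a, sa}`. If `A` is the complement of `{x, sx}`, the
-- difference is `{tx, tsx}`, belonging to the reflection `tst ≠ t`.
set_option maxRecDepth 100000 in
theorem exists_sdiff_image_subset_pair_perm : ∀ A : Finset (Perm (Fin 3)),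
    A = {1} ∨ (∃ t, Perm.sign t = -1 ∧ A.image (t * ·) = A) →
      ∀ t, Perm.sign t = -1 → ∃ a b, A \ A.image (t * ·) ⊆ {a, b} ∧ Perm.sign (a * b⁻¹) = -1 ∧ a * b⁻¹ ≠ t := by
  decide

/-- If `A` is `{1}` or stable under some reflection, and `t` is a reflection, then `A \ t A`
is contained in a coset of the group generated by a reflection other than `t`. -/
theorem exists_sdiff_image_subset_pair {A : Set W} (hA : A = {1} ∨ A ∈ stableSets cs) {t : W}
    (ht : cs.IsReflection t) :
    ∃ a b, A \ (fun x => t * x) '' A ⊆ {a, b} ∧ cs.IsReflection (a * b⁻¹) ∧ a * b⁻¹ ≠ t := by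
  obtain ⟨A, rfl⟩ := setOfPerms_surjective cs A
  rw [← setOfPerms_singleton_one cs, (setOfPerms_injective cs).eq_iff,
    setOfPerms_mem_stableSets, mem_stablePerms] at hA
  obtain ⟨a, b, h1, h2, h3⟩ :=
    exists_sdiff_image_subset_pair_perm A (hA.imp_right And.right) _
      ((isReflection_iff cs t).1 ht)
  refine ⟨(equivPermThree cs).symm a, (equivPermThree cs).symm b, ?_, ?_, ?_⟩
  · rintro x ⟨hx, hx'⟩
    rw [← setOfPerms_image] at hx'
    have := h1 (Finset.mem_sdiff.2 ⟨hx, hx'⟩)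
    simpa [MulEquiv.eq_symm_apply] using this
  · rw [← map_inv, ← map_mul, isReflection_symm_iff]
    exact h2
  · rw [← map_inv, ← map_mul, Ne, MulEquiv.symm_apply_eq]
    exact h3

/-- The sets of permutations in `K`, and the sets `A ∪ t A` and `A ∩ t A` for `A` in `K` and
transpositions `t`. -/
def stepPerms (K : Finset (Finset (Perm (Fin 3)))) : Finset (Finset (Perm (Fin 3))) :=
  K ∪ K.biUnion fun A => (Finset.univ.filter fun t : Perm (Fin 3) => Perm.sign t = -1).biUnion
    fun t => {A ∪ A.image (t * ·), A ∩ A.image (t * ·)}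

-- Unions lead from `{1}` to sets with two, four and six elements. If a four-element set is stable
-- under `s` and `t ≠ s`, intersecting it with its translate by `t` leaves a two-element set stable
-- under `t`, which also gives pairs not containing `1`. Four rounds reach everything.
set_option maxRecDepth 100000 in
theorem mem_stepPerms_of_mem_stablePerms :
    ∀ A ∈ stablePerms, A ∈ stepPerms (stepPerms (stepPerms (stepPerms {{1}}))) := by
  decide

attribute [irreducible] stepPerms stablePerms

/-- All sets stable under a reflection arise from `{1}` by means of the operations `A ∪ t A` and
`A ∩ t A`, for reflections `t`. -/
theorem stableSets_induction {p : Set W → Prop} (one : p {1})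
    (union : ∀ A, p A → ∀ t, cs.IsReflection t → p (A ∪ (fun x => t * x) '' A))
    (inter : ∀ A, p A → ∀ t, cs.IsReflection t → p (A ∩ (fun x => t * x) '' A))
    {A : Set W} (hA : A ∈ stableSets cs) : p A := by
  have hstep : ∀ K : Finset (Finset (Perm (Fin 3))), (∀ A ∈ K, p (setOfPerms cs A)) →
      ∀ A ∈ stepPerms K, p (setOfPerms cs A) := by
    intro K hK A hA
    unfold stepPerms at hA
    simp only [Finset.mem_union, Finset.mem_biUnion, Finset.mem_filter,
      Finset.mem_univ, true_and, Finset.mem_insert, Finset.mem_singleton] at hA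
    obtain hA | ⟨B, hB, t, ht, rfl | rfl⟩ := hA
    · exact hK A hA
    · rw [setOfPerms_union, setOfPerms_image_symm]
      exact union _ (hK B hB) _ ((isReflection_symm_iff cs t).2 ht)
    · rw [setOfPerms_inter, setOfPerms_image_symm]
      exact inter _ (hK B hB) _ ((isReflection_symm_iff cs t).2 ht)
  obtain ⟨A, rfl⟩ := setOfPerms_surjective cs A
  have h0 : ∀ A ∈ ({{1}} : Finset (Finset (Perm (Fin 3)))), p (setOfPerms cs A) := by
    intro A hA
    rw [Finset.mem_singleton.1 hA, setOfPerms_singleton_one]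
    exact one
  exact hstep _ (hstep _ (hstep _ (hstep _ h0))) A
    (mem_stepPerms_of_mem_stablePerms A ((setOfPerms_mem_stableSets cs).1 hA))

/-- As `t² = 1`, left multiplication by `t` exchanges `A` and `t A`. With the analogous fact for
intersections, it keeps the splitting of `B_t ⊗ R(A)` within the same family of sets. -/
theorem union_image_mem_stableSets {A : Set W} (hA : A.Nonempty) {t : W}
    (ht : cs.IsReflection t) : A ∪ (fun x => t * x) '' A ∈ stableSets cs := by
  refine ⟨hA.inl, t, ht, ?_⟩
  rw [Set.image_union, Set.image_image]
  simp only [← mul_assoc, ht.mul_self, one_mul, Set.image_id']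
  rw [Set.union_comm]

theorem inter_image_mem_stableSets {A : Set W} {t : W} (ht : cs.IsReflection t)
    (h : (A ∩ (fun x => t * x) '' A).Nonempty) :
    A ∩ (fun x => t * x) '' A ∈ stableSets cs := by
  refine ⟨h, t, ht, ?_⟩
  rw [Set.image_inter (mul_right_injective t), Set.image_image]
  simp only [← mul_assoc, ht.mul_self, one_mul, Set.image_id']
  rw [Set.inter_comm]

end TypeATwo

/-! ### Finite direct sums and the Krull-Schmidt property -/

section KrullSchmidt

variable {𝒞 : Type*} [Category 𝒞] [Preadditive 𝒞] [HasBinaryBiproducts 𝒞]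

/-- The finite direct sums of objects with the property `P`. -/
inductive FinSum (P : ObjectProperty 𝒞) : ObjectProperty 𝒞
  | zero {N : 𝒞} (h : IsZero N) : FinSum P N
  | cons {X M N : 𝒞} (hX : P X) (hM : FinSum P M) (e : N ≅ X ⊞ M) : FinSum P N

namespace FinSum

variable {P : ObjectProperty 𝒞}

theorem of_iso {M N : 𝒞} (e : M ≅ N) (h : FinSum P N) : FinSum P M := by
  cases h with
  | zero h => exact .zero (h.of_iso e)
  | cons hX hM f => exact .cons hX hM (e ≪≫ f)

/-- `X ⊞ Z ≅ X` for a zero object `Z`. -/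
noncomputable def biprodZeroIso (X : 𝒞) {Z : 𝒞} (hZ : IsZero Z) : X ⊞ Z ≅ X where
  hom := biprod.fst
  inv := biprod.inl
  hom_inv_id := by
    rw [← biprod.total, show (biprod.snd : X ⊞ Z ⟶ Z) = 0 from hZ.eq_of_tgt _ _]
    simp
  inv_hom_id := biprod.inl_fst

/-- `Z ⊞ X ≅ X` for a zero object `Z`. -/
noncomputable def zeroBiprodIso (X : 𝒞) {Z : 𝒞} (hZ : IsZero Z) : Z ⊞ X ≅ X :=
  biprod.braiding Z X ≪≫ biprodZeroIso X hZ

theorem biprod {M N : 𝒞} (hM : FinSum P M) (hN : FinSum P N) : FinSum P (M ⊞ N) := by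
  induction hM with
  | zero h => exact of_iso (zeroBiprodIso N h) hN
  | @cons X M' M hX _ e ih =>
    exact .cons hX ih (biprod.mapIso e (Iso.refl N) ≪≫ biprod.associator X M' N)

theorem single {X : 𝒞} (hX : P X) {Z : 𝒞} (hZ : IsZero Z) : FinSum P X :=
  .cons hX (.zero hZ) (biprodZeroIso X hZ).symm

theorem map {𝒟 : Type*} [Category 𝒟] [Preadditive 𝒟] [HasBinaryBiproducts 𝒟]
    {Q : ObjectProperty 𝒟} (F : 𝒞 ⥤ 𝒟) [F.Additive] (h : ∀ X, P X → FinSum Q (F.obj X)) {M : 𝒞}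
    (hM : FinSum P M) : FinSum Q (F.obj M) := by
  induction hM with
  | zero h => exact .zero (F.map_isZero h)
  | cons hX _ e ih => exact of_iso (F.mapIso e ≪≫ mapBiprodIso F _ _) (biprod (h _ hX) ih)

/-- If the endomorphisms of the objects in `P` are zero or invertible, then a direct summand of a
finite direct sum of such objects is again one. -/
theorem of_retract (hP : ∀ X, P X → ∀ f : X ⟶ X, f = 0 ∨ IsIso f)
    (hsplit : ∀ {X N : 𝒞} (i : X ⟶ N) (r : N ⟶ X), i ≫ r = 𝟙 X →
      ∃ (N' : 𝒞) (j : N' ⟶ N) (q : N ⟶ N'), j ≫ q = 𝟙 N' ∧ r ≫ i + q ≫ j = 𝟙 N)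
    {M N : 𝒞} (h : FinSum P M) (ι : N ⟶ M) (ρ : M ⟶ N) (hιρ : ι ≫ ρ = 𝟙 N) : FinSum P N := by
  induction h generalizing N with
  | @zero M h =>
    refine .zero ((IsZero.iff_id_eq_zero N).2 ?_)
    rw [← hιρ, h.eq_of_tgt ι 0, zero_comp]
  | @cons X M' M hX _ e ih =>
    have htot : (e.hom ≫ biprod.fst) ≫ (biprod.inl ≫ e.inv) +
        (e.hom ≫ biprod.snd) ≫ (biprod.inr ≫ e.inv) = 𝟙 M := by
      have h : e.hom ≫ (biprod.fst ≫ biprod.inl + biprod.snd ≫ biprod.inr) ≫ e.inv = 𝟙 M := by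
        rw [biprod.total, Category.id_comp, e.hom_inv_id]
      simpa only [Preadditive.add_comp, Preadditive.comp_add, Category.assoc] using h
    obtain ⟨π, hπ⟩ : ∃ π, π = e.hom ≫ (biprod.fst : X ⊞ M' ⟶ X) := ⟨_, rfl⟩
    obtain ⟨π', hπ'⟩ : ∃ π', π' = e.hom ≫ (biprod.snd : X ⊞ M' ⟶ M') := ⟨_, rfl⟩
    obtain ⟨κ, hκ⟩ : ∃ κ, κ = (biprod.inl : X ⟶ X ⊞ M') ≫ e.inv := ⟨_, rfl⟩
    obtain ⟨κ', hκ'⟩ : ∃ κ', κ' = (biprod.inr : M' ⟶ X ⊞ M') ≫ e.inv := ⟨_, rfl⟩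
    rw [← hπ, ← hπ', ← hκ, ← hκ'] at htot
    have htot' : π' ≫ κ' = 𝟙 M - π ≫ κ := by rw [← htot]; abel
    -- If some endomorphism of `X` factoring through `N` by way of `ι ≫ π` is nonzero, it is
    -- invertible and `X` splits off `N`. Otherwise `N` is already a retract of `M'`.
    by_cases hf : ∃ g : X ⟶ N, g ≫ ι ≫ π ≠ 0
    · obtain ⟨g, hg⟩ := hf
      have := (hP X hX (g ≫ ι ≫ π)).resolve_left hg
      obtain ⟨i, hi⟩ : ∃ i : X ⟶ N, i ≫ ι ≫ π = 𝟙 X := ⟨inv (g ≫ ι ≫ π) ≫ g, by simp⟩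
      obtain ⟨N', j, q, hjq, hN⟩ := hsplit i (ι ≫ π) hi
      have hj : j ≫ ι ≫ π = 0 := by
        have h1 : j ≫ ((ι ≫ π) ≫ i + q ≫ j) = j := by
          rw [hN, Category.comp_id]
        rw [Preadditive.comp_add, reassoc_of% hjq, add_eq_right] at h1
        have h2 := h1 =≫ (ι ≫ π)
        simpa [hi] using h2
      -- Since `j ≫ ι ≫ π = 0`, the complement `N'` of `X` in `N` passes entirely through `M'`, so
      -- the induction hypothesis applies to it.
      refine .cons hX (ih (j ≫ ι ≫ π') (κ' ≫ ρ ≫ q) ?_)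
        { hom := biprod.lift (ι ≫ π) q
          inv := biprod.desc i j
          hom_inv_id := by simpa using hN
          inv_hom_id := ?_ }
      · have h1 : (j ≫ ι ≫ π') ≫ κ' ≫ ρ ≫ q = (j ≫ ι) ≫ (π' ≫ κ') ≫ ρ ≫ q := by simp
        rw [h1, htot', Preadditive.sub_comp, Preadditive.comp_sub]
        have h2 : (j ≫ ι) ≫ (π ≫ κ) ≫ ρ ≫ q = (j ≫ ι ≫ π) ≫ κ ≫ ρ ≫ q := by simp
        rw [h2, hj, zero_comp, sub_zero, Category.id_comp, Category.assoc, reassoc_of% hιρ, hjq]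
      · have hiq : i ≫ q = 0 := by
          have h1 : ((ι ≫ π) ≫ i + q ≫ j) ≫ q = q := by
            rw [hN, Category.id_comp]
          rw [Preadditive.add_comp, Category.assoc q, hjq, Category.comp_id, add_eq_right] at h1
          have h2 := i ≫= h1
          rw [comp_zero] at h2
          rw [← h2]
          simp only [Category.assoc, reassoc_of% hi]
        refine biprod.hom_ext' _ _ (biprod.hom_ext _ _ ?_ ?_) (biprod.hom_ext _ _ ?_ ?_)
        · simpa using hi
        · simpa using hiq
        · simpa using hj
        · simpa using hjq
    · push Not at hf
      have hz : κ ≫ ρ ≫ ι ≫ π = 0 := by simpa using hf (κ ≫ ρ)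
      -- Put `e = ι ≫ π ≫ κ ≫ ρ`. Going through `M'` gives `𝟙 - e`, and `hz` implies `e ≫ e = 0`, so
      -- `𝟙 + e` corrects the retraction.
      refine ih (ι ≫ π') (κ' ≫ ρ ≫ (𝟙 N + ι ≫ π ≫ κ ≫ ρ)) ?_
      have h1 : (ι ≫ π') ≫ κ' ≫ ρ ≫ (𝟙 N + ι ≫ π ≫ κ ≫ ρ) =
        ι ≫ (π' ≫ κ') ≫ ρ ≫ (𝟙 N + ι ≫ π ≫ κ ≫ ρ) := by simp
      rw [h1, htot']
      simp only [Preadditive.sub_comp, Preadditive.comp_sub, Preadditive.comp_add, Category.assoc,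
        Category.comp_id, Category.id_comp, reassoc_of% hιρ, hιρ, reassoc_of% hz, zero_comp,
        comp_zero]
      abel

end FinSum

end KrullSchmidt

/-! ### Multiplicities -/

section Multiplicity

variable (k : Type*) [Field k] {𝒞 : Type*} [Category 𝒞] [Preadditive 𝒞] [Linear k 𝒞]

/-- The homomorphisms from `X` to `N` modulo those whose composition with each homomorphism from
`N` to `X` is zero. -/
abbrev HomModRad (X N : 𝒞) : Type _ := (X ⟶ N) ⧸ LinearMap.ker (Linear.comp (S := k) X N X)

theorem mem_ker_linearComp {X N : 𝒞} {g : X ⟶ N} :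
    g ∈ LinearMap.ker (Linear.comp (S := k) X N X) ↔ ∀ f : N ⟶ X, g ≫ f = 0 := by
  rw [LinearMap.mem_ker, LinearMap.ext_iff]
  rfl

/-- The multiplicity of `X` in `N`, if `X` is an object whose endomorphisms are scalars. -/
noncomputable def homMultiplicity (X N : 𝒞) : ℕ := Module.finrank k (HomModRad k X N)

variable {k}

/-- Any `f : N' ⟶ X` can be precomposed with `h` to give a test map on `N`. This is the
functoriality in `N` that makes the multiplicity invariant and additive. -/
theorem comp_mem_ker_linearComp {X N N' : 𝒞} {g : X ⟶ N} (h : N ⟶ N')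
    (hg : g ∈ LinearMap.ker (Linear.comp (S := k) X N X)) :
    g ≫ h ∈ LinearMap.ker (Linear.comp (S := k) X N' X) := by
  rw [mem_ker_linearComp] at hg ⊢
  intro f
  rw [Category.assoc, hg]

variable (k)

/-- Isomorphic objects have isomorphic spaces `HomModRad`. -/
noncomputable def homModRadCongr (X : 𝒞) {N N' : 𝒞} (e : N ≅ N') :
    HomModRad k X N ≃ₗ[k] HomModRad k X N' :=
  Submodule.Quotient.equiv _ _ (Linear.homCongr k (Iso.refl X) e) (by
    ext g
    rw [Submodule.mem_map]
    constructor
    · rintro ⟨f, hf, rfl⟩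
      have h : (Linear.homCongr k (Iso.refl X) e) f = f ≫ e.hom := by
        simp [Linear.homCongr_apply]
      exact h ▸ comp_mem_ker_linearComp e.hom hf
    · intro hg
      exact ⟨g ≫ e.inv, comp_mem_ker_linearComp e.inv hg, by simp [Linear.homCongr_apply]⟩)

/-- The space `HomModRad` of a direct sum. -/
noncomputable def homModRadBiprod [HasBinaryBiproducts 𝒞] (X N N' : 𝒞) :
    HomModRad k X (N ⊞ N') ≃ₗ[k] HomModRad k X N × HomModRad k X N' :=
  let φ : (X ⟶ N ⊞ N') →ₗ[k] HomModRad k X N × HomModRad k X N' :=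
    LinearMap.prod (Submodule.mkQ _ ∘ₗ Linear.rightComp k X biprod.fst)
      (Submodule.mkQ _ ∘ₗ Linear.rightComp k X biprod.snd)
  have hker : LinearMap.ker (Linear.comp (S := k) X (N ⊞ N') X) = LinearMap.ker φ := by
    ext g
    rw [LinearMap.mem_ker (f := φ), LinearMap.prod_apply, Function.prod_apply, Prod.mk_eq_zero,
      LinearMap.comp_apply, LinearMap.comp_apply, Submodule.mkQ_apply, Submodule.mkQ_apply,
      Submodule.Quotient.mk_eq_zero, Submodule.Quotient.mk_eq_zero]
    constructor
    · intro hg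
      exact ⟨comp_mem_ker_linearComp _ hg, comp_mem_ker_linearComp _ hg⟩
    · rintro ⟨h1, h2⟩
      rw [mem_ker_linearComp] at h1 h2 ⊢
      intro f
      have h : g ≫ f = (g ≫ biprod.fst) ≫ biprod.inl ≫ f + (g ≫ biprod.snd) ≫ biprod.inr ≫ f := by
        have := g ≫= biprod.total (X := N) (Y := N') =≫ f
        simpa only [Preadditive.comp_add, Preadditive.add_comp, Category.assoc,
          Category.id_comp] using this.symm
      rw [h]
      have h1' := h1 (biprod.inl ≫ f)
      have h2' := h2 (biprod.inr ≫ f)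
      simp only [Linear.rightComp_apply] at h1' h2'
      rw [h1', h2', add_zero]
  have hsurj : Function.Surjective φ := by
    rintro ⟨x, y⟩
    obtain ⟨f, rfl⟩ := Submodule.mkQ_surjective _ x
    obtain ⟨g, rfl⟩ := Submodule.mkQ_surjective _ y
    refine ⟨biprod.lift f g, ?_⟩
    simp [φ]
  Submodule.quotEquivOfEq _ _ hker ≪≫ₗ φ.quotKerEquivOfSurjective hsurj

theorem homMultiplicity_eq_of_iso (X : 𝒞) {N N' : 𝒞} (e : N ≅ N') :
    homMultiplicity k X N = homMultiplicity k X N' :=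
  (homModRadCongr k X e).finrank_eq

theorem homMultiplicity_biprod [HasBinaryBiproducts 𝒞] (X N N' : 𝒞)
    [Module.Finite k (HomModRad k X N)] [Module.Finite k (HomModRad k X N')] :
    homMultiplicity k X (N ⊞ N') = homMultiplicity k X N + homMultiplicity k X N' := by
  rw [homMultiplicity, (homModRadBiprod k X N N').finrank_eq, Module.finrank_prod]
  rfl

/-- If all endomorphisms of `X ≠ 0` are scalars, then `X` has multiplicity `1` in `X`. -/
noncomputable def homModRadSelf (X : 𝒞) (h : ∀ f : X ⟶ X, ∃ c : k, f = c • 𝟙 X)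
    (h0 : 𝟙 X ≠ 0) : k ≃ₗ[k] HomModRad k X X :=
  LinearEquiv.ofBijective (LinearMap.toSpanSingleton k (HomModRad k X X) (Submodule.mkQ _ (𝟙 X)))
    (by
      constructor
      · rw [← LinearMap.ker_eq_bot, LinearMap.ker_eq_bot']
        intro c hc
        rw [LinearMap.toSpanSingleton_apply, ← map_smul, Submodule.mkQ_apply,
          Submodule.Quotient.mk_eq_zero, mem_ker_linearComp] at hc
        have := hc (𝟙 X)
        rw [Category.comp_id, smul_eq_zero] at this
        exact this.resolve_right h0
      · intro x
        obtain ⟨f, rfl⟩ := Submodule.mkQ_surjective _ x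
        obtain ⟨c, rfl⟩ := h f
        exact ⟨c, by rw [LinearMap.toSpanSingleton_apply, map_smul]⟩)

theorem homMultiplicity_self (X : 𝒞) (h : ∀ f : X ⟶ X, ∃ c : k, f = c • 𝟙 X) (h0 : 𝟙 X ≠ 0) :
    homMultiplicity k X X = 1 := by
  rw [homMultiplicity, ← (homModRadSelf k X h h0).finrank_eq, Module.finrank_self]

theorem subsingleton_homModRad {X N : 𝒞} (h : ∀ (g : X ⟶ N) (f : N ⟶ X), g ≫ f = 0) :
    Subsingleton (HomModRad k X N) := by
  rw [Submodule.Quotient.subsingleton_iff, eq_top_iff]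
  intro g _
  rw [mem_ker_linearComp]
  exact h g

theorem homMultiplicity_eq_zero {X N : 𝒞} (h : ∀ (g : X ⟶ N) (f : N ⟶ X), g ≫ f = 0) :
    homMultiplicity k X N = 0 := by
  have := subsingleton_homModRad k h
  exact Module.finrank_zero_of_subsingleton

/-- `Module.finrank` is zero on infinite-dimensional spaces, so additivity of multiplicities needs
this finiteness; it is inherited from the summands through `homModRadBiprod`. -/
theorem FinSum.finite_homModRad [HasBinaryBiproducts 𝒞] {P : ObjectProperty 𝒞} (X : 𝒞)
    (hP : ∀ Y, P Y → Module.Finite k (HomModRad k X Y)) {N : 𝒞} (hN : FinSum P N) :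
    Module.Finite k (HomModRad k X N) := by
  induction hN with
  | zero h =>
    have := subsingleton_homModRad k (X := X) (fun g f => by rw [h.eq_of_tgt g 0, zero_comp])
    infer_instance
  | cons hY _ e ih =>
    have := hP _ hY
    exact Module.Finite.equiv (homModRadCongr k X e ≪≫ₗ homModRadBiprod k X _ _).symm

end Multiplicity

/-! ### Additive functions on split Grothendieck rings -/

section Additive

variable {𝒞 : Type*} [Category 𝒞] [MonoidalCategory 𝒞] [Preadditive 𝒞] [HasBinaryBiproducts 𝒞]
  [MonoidalPreadditive 𝒞]

/-- The additive subgroup of relations is already a two-sided ideal, so passing to the ring adds no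
relations. Hence a function that is merely additive on objects descends to the split Grothendieck
ring. -/
theorem splitMk_eq_zero_iff {x : FreeAbelianGroup (IsoClass 𝒞)} :
    splitMk 𝒞 x = 0 ↔ x ∈ splitRelations 𝒞 := by
  have h : splitMk 𝒞 x = 0 ↔ (splitIdeal 𝒞).ringCon x 0 := by
    rw [← map_zero (splitMk 𝒞)]
    exact RingCon.eq _
  rw [h, ← TwoSidedIdeal.mem_iff, splitIdeal, TwoSidedIdeal.mem_mk']
  rfl

theorem splitMk_surjective : Function.Surjective (splitMk 𝒞) :=
  (splitIdeal 𝒞).ringCon.mk'_surjective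

theorem splitClass_biprod (X Y : 𝒞) : splitClass (X ⊞ Y) = splitClass X + splitClass Y := by
  rw [← sub_eq_zero, ← sub_sub, splitClass, splitClass, splitClass, ← map_sub, ← map_sub,
    splitMk_eq_zero_iff]
  exact AddSubgroup.subset_closure ⟨X, Y, rfl⟩

/-- For a zero object `X ⊞ X ≅ X`, so `[X] = [X] + [X]`. -/
theorem splitClass_eq_zero {X : 𝒞} (hX : IsZero X) : splitClass X = 0 := by
  have h := splitClass_biprod X X
  rw [splitClass_eq (FinSum.biprodZeroIso X hX)] at h
  exact left_eq_add.1 h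

/-- The function on isomorphism classes given by a function on objects. -/
def isoClassLift {G : Type*} (μ : 𝒞 → G) (hiso : ∀ X Y : 𝒞, (X ≅ Y) → μ X = μ Y) :
    IsoClass 𝒞 → G :=
  Quotient.lift (s := isIsomorphicSetoid 𝒞) μ (by rintro X Y ⟨e⟩; exact hiso X Y e)

/-- The homomorphism from the split Grothendieck ring given by an additive function on objects. -/
noncomputable def splitLift {G : Type*} [AddCommGroup G] (μ : 𝒞 → G)
    (hiso : ∀ X Y : 𝒞, (X ≅ Y) → μ X = μ Y) (hadd : ∀ X Y, μ (X ⊞ Y) = μ X + μ Y) :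
    SplitK0 𝒞 →+ G :=
  (splitMk 𝒞).toAddMonoidHom.liftOfSurjective splitMk_surjective
    ⟨FreeAbelianGroup.lift (isoClassLift μ hiso), fun x hx => by
      have hx' : x ∈ splitRelations 𝒞 := splitMk_eq_zero_iff.1 hx
      have hle : splitRelations 𝒞 ≤ (FreeAbelianGroup.lift
          (isoClassLift μ hiso)).ker := by
        refine (AddSubgroup.closure_le _).2 ?_
        rintro _ ⟨X, Y, rfl⟩
        change FreeAbelianGroup.lift _ _ = 0
        simp only [map_sub, FreeAbelianGroup.lift_apply_of]
        change μ (X ⊞ Y) - μ X - μ Y = 0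
        rw [hadd, add_sub_cancel_left, sub_self]
      exact hle hx'⟩

theorem splitLift_splitClass {G : Type*} [AddCommGroup G] (μ : 𝒞 → G)
    (hiso : ∀ X Y : 𝒞, (X ≅ Y) → μ X = μ Y) (hadd : ∀ X Y, μ (X ⊞ Y) = μ X + μ Y) (X : 𝒞) :
    splitLift μ hiso hadd (splitClass X) = μ X := by
  unfold splitLift splitClass
  refine (AddMonoidHom.liftOfRightInverse_comp_apply _ _ _ _ _).trans ?_
  exact FreeAbelianGroup.lift_apply_of _ _

end Additive

/-! ### Further properties of graded bimodules -/

section GradedVectorSpaces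

variable {M : Type*} [AddCommGroup M] [Module ℝ M]

/-- The degree `k` component of a sum of elements of the `H i` lies in `H k`. Used to recognise a
grading from a family of homogeneous elements that spans. -/
theorem eq_of_le_of_iSup_eq_top {G H : ℤ → Submodule ℝ M} (hG : DirectSum.IsInternal G)
    (hle : ∀ k, H k ≤ G k) (htop : ⨆ k, H k = ⊤) (k : ℤ) : H k = G k := by
  obtain ⟨δ, hδ⟩ := exists_components G hG
  refine le_antisymm (hle k) fun m hm => ?_
  have key : ∀ x : M, δ x k ∈ H k := by
    intro x
    have hx : x ∈ ⨆ k, H k := by rw [htop]; trivial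
    induction hx using Submodule.iSup_induction' with
    | mem i x hx =>
      rw [hδ i x (hle i hx), Finsupp.single_apply]
      split_ifs with h
      · exact h ▸ hx
      · exact zero_mem _
    | zero => simp
    | add x y _ _ hx hy =>
      rw [map_add]
      exact add_mem hx hy
  have h := key m
  rwa [hδ k m hm, Finsupp.single_eq_same] at h

end GradedVectorSpaces

namespace GrBimod

variable {R : Type u} [CommRing R] [Algebra ℝ R] {𝒜 : ℤ → Submodule ℝ R} {M N : GrBimod 𝒜}

/-! ### Linear structure on homomorphisms, isomorphisms and split idempotents -/

instance : SMul ℝ (M ⟶ N) := ⟨fun c f => ofLin (c • f.toLin)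
  (by simp [f.map_lact]) (by simp [f.map_ract])
  (fun i m hm => Submodule.smul_mem _ c (f.map_deg i m hm))⟩

@[simp] theorem smul_toLin (c : ℝ) (f : M ⟶ N) (m : M.carrier) :
    Hom.toLin (c • f) m = c • f.toLin m := rfl

instance : Module ℝ (M ⟶ N) where
  one_smul f := hom_ext fun m => by simp
  mul_smul a b f := hom_ext fun m => by simp [mul_smul]
  smul_zero a := hom_ext fun m => by simp
  smul_add a f g := hom_ext fun m => by simp
  add_smul a b f := hom_ext fun m => by simp [add_smul]
  zero_smul f := hom_ext fun m => by simp

instance : Linear ℝ (GrBimod 𝒜) where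
  smul_comp _ _ _ r f g := hom_ext fun m => by simp
  comp_smul _ _ _ f r g := hom_ext fun m => by simp

theorem isZero_of_subsingleton (h : Subsingleton M.carrier) : IsZero M :=
  (IsZero.iff_id_eq_zero M).2 (hom_ext fun _ => Subsingleton.elim _ _)

/-- The sum `M ⊞ N` is isomorphic to the concrete direct sum. -/
noncomputable def biprodIsoDirSum (M N : GrBimod 𝒜) : M ⊞ N ≅ dirSum M N :=
  (biprod.uniqueUpToIso M N (b := dirSumBicone M N)
    (isBinaryBilimitOfTotal _ (hom_ext fun m => Prod.ext (add_zero m.1) (zero_add m.2)))).symm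

/-- A bijective homomorphism is an isomorphism. -/
noncomputable def isoOfBijective (f : M ⟶ N) (hf : Function.Bijective f.toLin) : M ≅ N :=
  let e := LinearEquiv.ofBijective f.toLin hf
  have he : ∀ m, f.toLin (e.symm m) = m := e.apply_symm_apply
  { hom := f
    inv := ofLin e.symm.toLinearMap
      (fun a m => hf.1 (by
        change f.toLin (e.symm _) = f.toLin (M.lact a (e.symm m))
        rw [f.map_lact, he, he]))
      (fun a m => hf.1 (by
        change f.toLin (e.symm _) = f.toLin (M.ract a (e.symm m))
        rw [f.map_ract, he, he]))
      (fun i m hm => by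
        -- The images of the graded pieces of `M` lie in those of `N` and span `N`, so they are all
        -- of them; thus the inverse preserves degrees too.
        rw [← eq_of_le_of_iSup_eq_top (H := fun k => (M.deg k).map f.toLin) N.isInternal
          (fun k => Submodule.map_le_iff_le_comap.2 (f.map_deg k))
          (by rw [← Submodule.map_iSup, M.isInternal.submodule_iSup_eq_top, Submodule.map_top,
            LinearMap.range_eq_top.2 hf.2])] at hm
        obtain ⟨x, hx, rfl⟩ := hm
        change e.symm (e x) ∈ M.deg i
        rwa [e.symm_apply_apply])
    hom_inv_id := hom_ext e.symm_apply_apply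
    inv_hom_id := hom_ext he }

/-- The kernel of an idempotent endomorphism `𝟙 - τ`, i.e. the fixed elements of `τ`. -/
def fixedBimod (τ : M ⟶ M) : GrBimod 𝒜 where
  carrier := LinearMap.eqLocus τ.toLin LinearMap.id
  lact := AlgHom.ofLinearMap
    { toFun := fun a => (M.lact a).restrict (fun m (hm : τ.toLin m = m) =>
        show τ.toLin (M.lact a m) = M.lact a m by rw [τ.map_lact, hm])
      map_add' := fun a b => LinearMap.ext fun m =>
        Subtype.ext (LinearMap.congr_fun (map_add M.lact a b) m.1)
      map_smul' := fun a b => LinearMap.ext fun m =>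
        Subtype.ext (LinearMap.congr_fun (map_smul M.lact a b) m.1) }
    (LinearMap.ext fun m => Subtype.ext (LinearMap.congr_fun (map_one M.lact) m.1))
    (fun a b => LinearMap.ext fun m => Subtype.ext (LinearMap.congr_fun (map_mul M.lact a b) m.1))
  ract := AlgHom.ofLinearMap
    { toFun := fun a => (M.ract a).restrict (fun m (hm : τ.toLin m = m) =>
        show τ.toLin (M.ract a m) = M.ract a m by rw [τ.map_ract, hm])
      map_add' := fun a b => LinearMap.ext fun m =>
        Subtype.ext (LinearMap.congr_fun (map_add M.ract a b) m.1)
      map_smul' := fun a b => LinearMap.ext fun m =>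
        Subtype.ext (LinearMap.congr_fun (map_smul M.ract a b) m.1) }
    (LinearMap.ext fun m => Subtype.ext (LinearMap.congr_fun (map_one M.ract) m.1))
    (fun a b => LinearMap.ext fun m => Subtype.ext (LinearMap.congr_fun (map_mul M.ract a b) m.1))
  lact_ract a b m := Subtype.ext (M.lact_ract a b m)
  deg i := (M.deg i).comap (Submodule.subtype _)
  isInternal := by
    rw [DirectSum.isInternal_submodule_iff_iSupIndep_and_iSup_eq_top]
    constructor
    · rw [iSupIndep_def]
      intro i
      rw [Submodule.disjoint_def]
      intro x hx hx'
      have h := M.isInternal.submodule_iSupIndep i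
      rw [Submodule.disjoint_def] at h
      refine Subtype.ext (h x.1 hx ?_)
      have hle : (⨆ j, ⨆ (_ : j ≠ i), (M.deg j).comap (Submodule.subtype _)) ≤
          (⨆ j, ⨆ (_ : j ≠ i), M.deg j).comap
            (LinearMap.eqLocus τ.toLin LinearMap.id).subtype :=
        iSup₂_le fun j hj => Submodule.comap_mono (le_iSup₂_of_le j hj le_rfl)
      exact hle hx'
    · rw [eq_top_iff]
      rintro ⟨m, hm⟩ -
      have h := mem_iSup_inf_eqLocus M.deg M.isInternal τ.toLin τ.map_deg m hm
      have hle : (⨆ k, M.deg k ⊓ LinearMap.eqLocus τ.toLin LinearMap.id) ≤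
          (⨆ k, (M.deg k).comap (Submodule.subtype _)).map
            (LinearMap.eqLocus τ.toLin LinearMap.id).subtype := by
        refine iSup_le fun k x hx => ?_
        exact ⟨⟨x, hx.2⟩, Submodule.mem_iSup_of_mem k hx.1, rfl⟩
      obtain ⟨x, hx, hxm⟩ := hle h
      have : x = ⟨m, hm⟩ := Subtype.ext hxm
      rwa [← this]
  lact_mem ha hm := M.lact_mem ha hm
  ract_mem hm hb := M.ract_mem hm hb

/-- This supplies a zero object, which the finite direct sums of one term end with. -/
theorem isZero_fixedBimod_zero (M : GrBimod 𝒜) : IsZero (fixedBimod (0 : M ⟶ M)) :=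
  isZero_of_subsingleton ⟨fun x y => Subtype.ext
    ((show 0 = x.1 from x.2).symm.trans (show 0 = y.1 from y.2))⟩

/-- Idempotents of graded bimodules split. -/
theorem exists_complement {X N : GrBimod 𝒜} (i : X ⟶ N) (r : N ⟶ X) (h : i ≫ r = 𝟙 X) :
    ∃ (N' : GrBimod 𝒜) (j : N' ⟶ N) (q : N ⟶ N'), j ≫ q = 𝟙 N' ∧ r ≫ i + q ≫ j = 𝟙 N := by
  have h' : ∀ x, r.toLin (i.toLin x) = x := fun x => congrArg (fun f : X ⟶ X => f.toLin x) h
  -- The complement of `X` is the image of the idempotent `𝟙 - r ≫ i`, realised as its fixed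
  -- elements.
  refine ⟨fixedBimod (𝟙 N - r ≫ i), ofLin (Submodule.subtype _) (fun _ _ => rfl) (fun _ _ => rfl)
    (fun _ _ hm => hm), ofLin (LinearMap.codRestrict _ (Hom.toLin (𝟙 N - r ≫ i)) ?_) ?_ ?_ ?_,
    ?_, ?_⟩
  · intro m
    have e : ∀ m, Hom.toLin (𝟙 N - r ≫ i) m = m - i.toLin (r.toLin m) := fun m => by
      rw [sub_eq_add_neg, add_toLin, neg_toLin, sub_eq_add_neg]; rfl
    rw [LinearMap.mem_eqLocus, LinearMap.id_apply, e, e]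
    simp [h']
  · exact fun a m => Subtype.ext (Hom.map_lact (𝟙 N - r ≫ i) a m)
  · exact fun a m => Subtype.ext (Hom.map_ract (𝟙 N - r ≫ i) a m)
  · exact fun k m hm => Hom.map_deg (𝟙 N - r ≫ i) k m hm
  · exact hom_ext fun m => Subtype.ext m.2
  · refine hom_ext fun m => ?_
    change i.toLin (r.toLin m) + (𝟙 N - r ≫ i).toLin m = m
    rw [sub_eq_add_neg, add_toLin, neg_toLin, id_toLin, comp_toLin]
    abel

/-! ### The action of `R ⊗ R` -/

theorem commute_lact_ract (M : GrBimod 𝒜) (a b : R) : Commute (M.lact a) (M.ract b) :=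
  LinearMap.ext (M.lact_ract a b)

/-- The action of `R ⊗ R` on a bimodule, `(a ⊗ b) m = a m b`. -/
noncomputable def biact (M : GrBimod 𝒜) : R ⊗[ℝ] R →ₐ[ℝ] Module.End ℝ M.carrier :=
  Algebra.TensorProduct.lift M.lact M.ract M.commute_lact_ract

@[simp] theorem biact_tmul (a b : R) (m : M.carrier) :
    M.biact (a ⊗ₜ b) m = M.lact a (M.ract b m) := by
  rw [biact, Algebra.TensorProduct.lift_tmul]
  rfl

theorem map_biact (f : M ⟶ N) (z : R ⊗[ℝ] R) (m : M.carrier) :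
    f.toLin (M.biact z m) = N.biact z (f.toLin m) := by
  induction z using TensorProduct.induction_on with
  | zero => simp
  | tmul a b => simp [f.map_lact, f.map_ract]
  | add x y hx hy => simp only [map_add, LinearMap.add_apply, hx, hy]

theorem lact_biact (a : R) (z : R ⊗[ℝ] R) (m : M.carrier) :
    M.lact a (M.biact z m) = M.biact ((a ⊗ₜ 1) * z) m := by
  rw [map_mul]
  simp

theorem ract_biact (b : R) (z : R ⊗[ℝ] R) (m : M.carrier) :
    M.ract b (M.biact z m) = M.biact ((1 ⊗ₜ b) * z) m := by
  rw [map_mul]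
  simp

/-- A bimodule generated by one homogeneous element `x` of degree `0`: homomorphisms into `N` are
given by homogeneous elements annihilated by the annihilator of `x`. -/
theorem exists_hom_of_cyclic [GradedAlgebra 𝒜] (x : M.carrier) (hx : x ∈ M.deg 0)
    (hgen : ∀ m, ∃ z, M.biact z x = m) {d : ℤ} {y : N.carrier} (hy : y ∈ N.deg d)
    (hann : ∀ z, M.biact z x = 0 → N.biact z y = 0) :
    ∃ f : shift (-d) M ⟶ N, ∀ z, f.toLin (toShift (-d) M (M.biact z x)) = N.biact z y := by
  obtain ⟨φ, hφ⟩ : ∃ φ : R ⊗[ℝ] R →ₗ[ℝ] M.carrier, ∀ z, φ z = M.biact z x :=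
    ⟨(LinearMap.applyₗ x) ∘ₗ M.biact.toLinearMap, fun _ => rfl⟩
  obtain ⟨ψ, hψ⟩ : ∃ ψ : R ⊗[ℝ] R →ₗ[ℝ] N.carrier, ∀ z, ψ z = N.biact z y :=
    ⟨(LinearMap.applyₗ y) ∘ₗ N.biact.toLinearMap, fun _ => rfl⟩
  have hs : Function.Surjective φ := fun m => (hgen m).imp fun z hz => (hφ z).trans hz
  have hker : LinearMap.ker φ ≤ LinearMap.ker ψ := by
    intro z hz
    rw [LinearMap.mem_ker, hφ] at hz
    rw [LinearMap.mem_ker, hψ, hann z hz]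
  -- As a space, `M` is the quotient of `R ⊗ R` by the annihilator of `x`, and `hann` lets `z ↦ z y`
  -- factor through it.
  obtain ⟨g, hg⟩ : ∃ g : M.carrier →ₗ[ℝ] N.carrier, ∀ z, g (M.biact z x) = N.biact z y := by
    refine ⟨(LinearMap.ker φ).liftQ ψ hker ∘ₗ (φ.quotKerEquivOfSurjective hs).symm.toLinearMap,
      fun z => ?_⟩
    have h : (φ.quotKerEquivOfSurjective hs).symm (M.biact z x) = Submodule.Quotient.mk z := by
      rw [LinearEquiv.symm_apply_eq, LinearMap.quotKerEquivOfSurjective_apply_mk, hφ]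
    rw [LinearMap.comp_apply, LinearEquiv.coe_coe, h, Submodule.liftQ_apply, hψ]
  have htop := (DirectSum.Decomposition.isInternal 𝒜).submodule_iSup_eq_top
  -- Products `a x b` of homogeneous elements with `x` in degree 0 span, so `H` is the grading of
  -- `M`; on these products it is clear that `g` raises degrees by `d`.
  let H : ℤ → Submodule ℝ M.carrier := fun k =>
    Submodule.span ℝ {m | ∃ i j, i + j = k ∧ ∃ a ∈ 𝒜 i, ∃ b ∈ 𝒜 j, M.biact (a ⊗ₜ b) x = m}
  have hH : ∀ k, H k = M.deg k := by
    refine eq_of_le_of_iSup_eq_top M.isInternal (fun k => Submodule.span_le.2 ?_) ?_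
    · rintro _ ⟨i, j, rfl, a, ha, b, hb, rfl⟩
      rw [biact_tmul]
      have h := M.lact_mem ha (M.ract_mem hx hb)
      rwa [zero_add] at h
    · rw [eq_top_iff]
      rintro m -
      obtain ⟨z, rfl⟩ := hgen m
      induction z using TensorProduct.induction_on with
      | zero => simp
      | add x y hx hy => rw [map_add]; exact add_mem hx hy
      | tmul a b =>
        have ha : a ∈ ⨆ k, 𝒜 k := by rw [htop]; trivial
        have hb : b ∈ ⨆ k, 𝒜 k := by rw [htop]; trivial
        induction ha using Submodule.iSup_induction' with
        | zero => simp
        | add x y _ _ hx hy =>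
          rw [TensorProduct.add_tmul, map_add]
          exact add_mem hx hy
        | mem i a ha =>
          induction hb using Submodule.iSup_induction' with
          | zero => simp
          | add x y _ _ hx hy =>
            rw [TensorProduct.tmul_add, map_add]
            exact add_mem hx hy
          | mem j b hb =>
            exact Submodule.mem_iSup_of_mem (i + j)
              (Submodule.subset_span ⟨i, j, rfl, a, ha, b, hb, rfl⟩)
  refine ⟨ofLin (g ∘ₗ (toShift (-d) M).symm.toLinearMap) ?_ ?_ ?_, fun z => ?_⟩
  · intro a m
    obtain ⟨m, rfl⟩ := (toShift (-d) M).surjective m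
    obtain ⟨z, rfl⟩ := hgen m
    simp only [shift_lact, LinearMap.comp_apply, LinearEquiv.coe_coe,
      LinearEquiv.symm_apply_apply, lact_biact, hg]
  · intro a m
    obtain ⟨m, rfl⟩ := (toShift (-d) M).surjective m
    obtain ⟨z, rfl⟩ := hgen m
    simp only [shift_ract, LinearMap.comp_apply, LinearEquiv.coe_coe,
      LinearEquiv.symm_apply_apply, ract_biact, hg]
  · intro k m hm
    rw [mem_shift_deg, ← hH] at hm
    obtain ⟨m, rfl⟩ := (toShift (-d) M).surjective m
    rw [LinearMap.comp_apply, LinearEquiv.coe_coe, LinearEquiv.symm_apply_apply] at *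
    suffices h : H (k + -d) ≤ (N.deg k).comap g from h hm
    refine Submodule.span_le.2 ?_
    rintro _ ⟨i, j, hij, a, ha, b, hb, rfl⟩
    change g _ ∈ N.deg k
    rw [hg, biact_tmul]
    have h := N.lact_mem ha (N.ract_mem hy hb)
    rwa [show i + (d + j) = k by omega] at h
  · rw [ofLin_toLin, LinearMap.comp_apply, LinearEquiv.coe_coe, LinearEquiv.symm_apply_apply, hg]

end GrBimod

/-! ### Polynomial functions -/

section PolyFun

variable {V : Type u} [AddCommGroup V] [Module ℝ V]

theorem dual_mem_polyFun (φ : Module.Dual ℝ V) : (fun v => φ v) ∈ polyFun V :=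
  Algebra.subset_adjoin ⟨φ, rfl⟩

/-- A linear form as a polynomial function. -/
def linForm : Module.Dual ℝ V →ₗ[ℝ] polyFun V where
  toFun φ := ⟨fun v => φ v, dual_mem_polyFun φ⟩
  map_add' _ _ := rfl
  map_smul' _ _ := rfl

@[simp] theorem linForm_apply (φ : Module.Dual ℝ V) (v : V) : (linForm φ).1 v = φ v := rfl

@[simp] theorem polyPullback_apply {V' : Type u} [AddCommGroup V'] [Module ℝ V'] (L : V' →ₗ[ℝ] V)
    (f : polyFun V) (v : V') : (polyPullback L f).1 v = f.1 (L v) := rfl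

theorem linForm_mem (φ : Module.Dual ℝ V) : linForm φ ∈ polyGrading V 2 := by
  refine homogeneousPart_le (p := id) 1 ?_
  intro c i j h
  change j = c • i at h
  rw [h]
  change φ (c • i) = c ^ 1 * φ i
  rw [map_smul, smul_eq_mul, pow_one]

/-- Restriction to lines gives access to the integral domain `ℝ[X]` without identifying polynomial
functions on `V` with polynomials. -/
theorem exists_polynomial_line {f : V → ℝ} (hf : f ∈ polyFun V) (v w : V) :
    ∃ P : Polynomial ℝ, ∀ s, f (v + s • w) = P.eval s := by
  induction hf using Algebra.adjoin_induction with
  | mem f h =>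
    obtain ⟨φ, rfl⟩ := h
    exact ⟨.C (φ v) + .C (φ w) * .X, fun s => by
      change φ (v + s • w) = _
      rw [map_add, map_smul, smul_eq_mul, mul_comm s]
      simp⟩
  | algebraMap r => exact ⟨.C r, fun s => by simp⟩
  | add f g _ _ hf hg =>
    obtain ⟨P, hP⟩ := hf
    obtain ⟨Q, hQ⟩ := hg
    exact ⟨P + Q, fun s => by simp [hP, hQ]⟩
  | mul f g _ _ hf hg =>
    obtain ⟨P, hP⟩ := hf
    obtain ⟨Q, hQ⟩ := hg
    exact ⟨P * Q, fun s => by simp [hP, hQ]⟩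

/-- On each line in a direction `w` with `φ w ≠ 0`, the form `φ` becomes a polynomial of degree one,
which can be cancelled in `ℝ[X]`. Every point lies on such a line. -/
theorem eq_zero_of_linForm_mul_eq_zero {φ : Module.Dual ℝ V} (hφ : φ ≠ 0) {f : polyFun V}
    (h : linForm φ * f = 0) : f = 0 := by
  apply Subtype.ext
  funext v
  obtain ⟨w, hw⟩ : ∃ w, φ w ≠ 0 := by
    by_contra! h
    exact hφ (LinearMap.ext h)
  obtain ⟨P, hP⟩ := exists_polynomial_line f.2 v w
  have h1 : ∀ s, φ (v + s • w) * P.eval s = 0 := fun s => by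
    rw [← hP]
    exact congrFun (congrArg Subtype.val h) (v + s • w)
  have h2 : (Polynomial.C (φ v) + Polynomial.C (φ w) * Polynomial.X) * P = 0 := by
    apply Polynomial.funext
    intro s
    have := h1 s
    rw [map_add, map_smul, smul_eq_mul, mul_comm s] at this
    simpa using this
  rw [mul_eq_zero] at h2
  rcases h2 with h2 | h2
  · have := congrArg (Polynomial.coeff · 1) h2
    simp [Polynomial.coeff_C] at this
    exact absurd this hw
  · have := hP 0
    rw [h2, Polynomial.eval_zero, zero_smul, add_zero] at this
    exact this

end PolyFun

/-! ### The bimodules `R(A)` -/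

section GraphBimod

variable {W : Type*} [Group W] {V : Type u} [AddCommGroup V] [Module ℝ V]
  (ρ : Representation ℝ W V)

/-- The restriction of `a ⊗ b`, viewed as the function `a(u) b(v)` on `V × V`, to the graph
of `x`. -/
noncomputable def evalGraph (x : W) : polyFun V ⊗[ℝ] polyFun V →ₐ[ℝ] polyFun V :=
  Algebra.TensorProduct.productMap (polyPullback (ρ x)) (AlgHom.id ℝ (polyFun V))

@[simp] theorem evalGraph_tmul (x : W) (a b : polyFun V) :
    evalGraph ρ x (a ⊗ₜ b) = polyPullback (ρ x) a * b :=
  Algebra.TensorProduct.productMap_apply_tmul _ _ a b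

/-- The action of `t` on the first factor of `R ⊗ R`. -/
noncomputable def leftTwist (t : W) :
    polyFun V ⊗[ℝ] polyFun V →ₐ[ℝ] polyFun V ⊗[ℝ] polyFun V :=
  Algebra.TensorProduct.map (polyPullback (ρ t)) (AlgHom.id ℝ (polyFun V))

@[simp] theorem leftTwist_tmul (t : W) (a b : polyFun V) :
    leftTwist ρ t (a ⊗ₜ b) = polyPullback (ρ t) a ⊗ₜ b :=
  Algebra.TensorProduct.map_tmul _ _ a b

/-- Replacing `a(u)` by `a(t u)` turns the value at `(x v, v)` into the value at `(t x v, v)`. -/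
theorem evalGraph_leftTwist (x t : W) (z : polyFun V ⊗[ℝ] polyFun V) :
    evalGraph ρ x (leftTwist ρ t z) = evalGraph ρ (t * x) z := by
  induction z using TensorProduct.induction_on with
  | zero => simp
  | add x y hx hy => simp only [map_add, hx, hy]
  | tmul a b =>
    rw [leftTwist_tmul, evalGraph_tmul, evalGraph_tmul]
    congr 1
    apply Subtype.ext
    funext v
    simp

variable {ρ} {A : Set W}

theorem mem_graphUnion {x : W} (hx : x ∈ A) (v : V) : (ρ x v, v) ∈ graphUnion ρ A :=
  Set.mem_biUnion hx ⟨v, rfl⟩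

theorem exists_of_mem_graphUnion {p : V × V} (hp : p ∈ graphUnion ρ A) :
    ∃ x ∈ A, (ρ x p.2, p.2) = p := by
  obtain ⟨x, hx, v, rfl⟩ := Set.mem_iUnion₂.1 hp
  exact ⟨x, hx, rfl⟩

variable (ρ) in
/-- The value of a regular function at `(x v, v)`. -/
def evalAt {x : W} (hx : x ∈ A) (v : V) : (graphBimod ρ A).carrier →ₗ[ℝ] ℝ :=
  (LinearMap.proj (⟨_, mem_graphUnion hx v⟩ : graphUnion ρ A)) ∘ₗ
    (regFun (graphUnion ρ A)).val.toLinearMap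

variable (ρ A) in
/-- The function `1` in `R(A)`. -/
def graphOne : (graphBimod ρ A).carrier := (1 : regFun (graphUnion ρ A))

@[simp] theorem evalAt_graphOne {x : W} (hx : x ∈ A) (v : V) :
    evalAt ρ hx v (graphOne ρ A) = 1 := rfl

theorem graphBimod_ext {f g : (graphBimod ρ A).carrier}
    (h : ∀ x (hx : x ∈ A) v, evalAt ρ hx v f = evalAt ρ hx v g) : f = g := by
  apply Subtype.ext
  funext p
  obtain ⟨x, hx, h'⟩ := exists_of_mem_graphUnion p.2
  have e : (⟨_, mem_graphUnion hx p.1.2⟩ : graphUnion ρ A) = p := Subtype.ext h'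
  rw [← e]
  exact h x hx p.1.2

theorem evalAt_lact {x : W} (hx : x ∈ A) (v : V) (a : polyFun V) (f : (graphBimod ρ A).carrier) :
    evalAt ρ hx v ((graphBimod ρ A).lact a f) = a.1 (ρ x v) * evalAt ρ hx v f := rfl

theorem evalAt_ract {x : W} (hx : x ∈ A) (v : V) (a : polyFun V) (f : (graphBimod ρ A).carrier) :
    evalAt ρ hx v ((graphBimod ρ A).ract a f) = a.1 v * evalAt ρ hx v f := rfl

theorem evalAt_biact {x : W} (hx : x ∈ A) (v : V) (z : polyFun V ⊗[ℝ] polyFun V)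
    (f : (graphBimod ρ A).carrier) :
    evalAt ρ hx v ((graphBimod ρ A).biact z f) = (evalGraph ρ x z).1 v * evalAt ρ hx v f := by
  induction z using TensorProduct.induction_on with
  | zero => simp
  | add y z hy hz =>
    rw [map_add, LinearMap.add_apply, map_add, hy, hz, map_add]
    exact (add_mul _ _ _).symm
  | tmul a b =>
    rw [GrBimod.biact_tmul, evalAt_lact, evalAt_ract, evalGraph_tmul, ← mul_assoc]
    rfl

/-- Together with `exists_biact_graphOne` this presents `R(A)` as `R ⊗ R` modulo the functions
vanishing on the graphs of `A`, so maps out of `R(A)` amount to elements with a prescribed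
annihilator. -/
theorem biact_graphOne_eq_zero_iff {z : polyFun V ⊗[ℝ] polyFun V} :
    (graphBimod ρ A).biact z (graphOne ρ A) = 0 ↔ ∀ x ∈ A, evalGraph ρ x z = 0 := by
  constructor
  · intro h x hx
    apply Subtype.ext
    funext v
    have h' := evalAt_biact hx v z (graphOne ρ A)
    rw [h, map_zero, evalAt_graphOne, mul_one] at h'
    exact h'.symm
  · intro h
    refine graphBimod_ext fun x hx v => ?_
    rw [evalAt_biact, h x hx, map_zero]
    exact zero_mul _

/-- A linear form on `V × V` is the sum of a form in `u` and a form in `v`, so polynomial functions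
on `V × V` are sums of products `a(u) b(v)`. -/
theorem exists_biact_graphOne (f : (graphBimod ρ A).carrier) :
    ∃ z, (graphBimod ρ A).biact z (graphOne ρ A) = f := by
  obtain ⟨f, F, hF, rfl⟩ := f
  change F ∈ polyFun (V × V) at hF
  suffices h : ∃ z, ∀ x v, (evalGraph ρ x z).1 v = F (ρ x v, v) by
    obtain ⟨z, hz⟩ := h
    refine ⟨z, graphBimod_ext fun x hx v => ?_⟩
    rw [evalAt_biact, hz, evalAt_graphOne, mul_one]
    rfl
  induction hF using Algebra.adjoin_induction with
  | mem F h =>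
    obtain ⟨φ, rfl⟩ := h
    refine ⟨linForm (φ ∘ₗ LinearMap.inl ℝ V V) ⊗ₜ 1 + 1 ⊗ₜ linForm (φ ∘ₗ LinearMap.inr ℝ V V),
      fun x v => ?_⟩
    rw [map_add, evalGraph_tmul, evalGraph_tmul, map_one, one_mul, mul_one]
    change φ (ρ x v, 0) + φ (0, v) = φ (ρ x v, v)
    rw [← map_add, Prod.mk_add_mk, add_zero, zero_add]
  | algebraMap r =>
    refine ⟨algebraMap ℝ _ r, fun x v => ?_⟩
    rw [AlgHom.commutes]
    rfl
  | add F G _ _ hF hG =>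
    obtain ⟨y, hy⟩ := hF
    obtain ⟨z, hz⟩ := hG
    refine ⟨y + z, fun x v => ?_⟩
    rw [map_add, Pi.add_apply, ← hy, ← hz]
    rfl
  | mul F G _ _ hF hG =>
    obtain ⟨y, hy⟩ := hF
    obtain ⟨z, hz⟩ := hG
    refine ⟨y * z, fun x v => ?_⟩
    rw [map_mul, Pi.mul_apply, ← hy, ← hz]
    rfl

theorem graphOne_mem : graphOne ρ A ∈ (graphBimod ρ A).deg 0 := one_mem_evenGrading

theorem graphOne_ne_zero (hA : A.Nonempty) : graphOne ρ A ≠ 0 := by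
  obtain ⟨x, hx⟩ := hA
  intro h
  have h' := evalAt_graphOne (ρ := ρ) hx 0
  rw [h, map_zero] at h'
  exact zero_ne_one h'

theorem mem_span_graphOne {f : (graphBimod ρ A).carrier}
    (hf : ∀ x (hx : x ∈ A) y (hy : y ∈ A) v, evalAt ρ hx v f = evalAt ρ hy 0 f) :
    f ∈ Submodule.span ℝ {graphOne ρ A} := by
  rcases A.eq_empty_or_nonempty with rfl | ⟨y, hy⟩
  · rw [show f = 0 from graphBimod_ext (ρ := ρ) fun x hx => hx.elim]
    exact zero_mem _
  · refine Submodule.mem_span_singleton.2 ⟨evalAt ρ hy 0 f, graphBimod_ext fun x hx v => ?_⟩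
    rw [map_smul, evalAt_graphOne, smul_eq_mul, mul_one, hf x hx y hy v]

/-- Every graph passes through the origin, and scaling by 0 does not change a function of degree 0,
so its values all agree with the value at the origin. -/
theorem graphBimod_deg_zero {f : (graphBimod ρ A).carrier} (hf : f ∈ (graphBimod ρ A).deg 0) :
    ∃ c : ℝ, f = c • graphOne ρ A := by
  suffices h : (graphBimod ρ A).deg 0 ≤ Submodule.span ℝ {graphOne ρ A} by
    obtain ⟨c, hc⟩ := Submodule.mem_span_singleton.1 (h hf)
    exact ⟨c, hc.symm⟩
  refine evenGrading_le ?_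
  intro n hn f hf
  obtain rfl : n = 0 := by omega
  refine mem_span_graphOne (f := f) fun x hx y hy v => ?_
  -- Homogeneity with scalar 0 is informative in degree 0 because `0 ^ 0 = 1`.
  have h := hf 0 ⟨_, mem_graphUnion hx v⟩ ⟨_, mem_graphUnion hy 0⟩ (by simp)
  rw [pow_zero, one_mul] at h
  exact h.symm

theorem graphBimod_deg_neg {k : ℤ} (hk : k < 0) {f : (graphBimod ρ A).carrier}
    (hf : f ∈ (graphBimod ρ A).deg k) : f = 0 := by
  suffices h : (graphBimod ρ A).deg k ≤ ⊥ from (Submodule.mem_bot ℝ).1 (h hf)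
  refine evenGrading_le ?_
  intro n hn
  omega

/-- Homomorphisms out of `R(A)` are given by elements annihilated by the functions which vanish
on the graphs of the elements of `A`. -/
theorem exists_hom_graphBimod {N : GrBimod (polyGrading V)} {d e : ℤ} (he : e + d = 0)
    {y : N.carrier} (hy : y ∈ N.deg d)
    (hann : ∀ z, (∀ x ∈ A, evalGraph ρ x z = 0) → N.biact z y = 0) :
    ∃ f : GrBimod.shift e (graphBimod ρ A) ⟶ N,
      ∀ z, f.toLin (GrBimod.toShift e (graphBimod ρ A)
        ((graphBimod ρ A).biact z (graphOne ρ A))) = N.biact z y := by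
  obtain rfl : e = -d := by omega
  exact GrBimod.exists_hom_of_cyclic (M := graphBimod ρ A) (graphOne ρ A) (graphOne_mem (ρ := ρ))
    (exists_biact_graphOne (ρ := ρ) (A := A)) hy
    fun z hz => hann z ((biact_graphOne_eq_zero_iff (ρ := ρ)).1 hz)

/-- The isomorphism between `R` and `R({1})`. -/
noncomputable def regularIsoGraph (ρ : Representation ℝ W V) :
    GrBimod.regular (polyGrading V) ≅ graphBimod ρ {1} :=
  GrBimod.isoOfBijective
    (GrBimod.ofLin (M := GrBimod.regular (polyGrading V)) (N := graphBimod ρ {1})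
      ((restrictTo (graphUnion ρ {1})).comp (polyPullback (LinearMap.fst ℝ V V))).toLinearMap
      (fun a m => map_mul
        ((restrictTo (graphUnion ρ {1})).comp (polyPullback (LinearMap.fst ℝ V V))) a m)
      (fun a m => graphBimod_ext fun x hx v => by
        rw [evalAt_ract]
        obtain rfl : x = 1 := hx
        change a.1 (ρ 1 v) * m.1 (ρ 1 v) = a.1 v * m.1 (ρ 1 v)
        rw [map_one]
        rfl)
      (fun i m hm => pullback_mem_regGrading _ _ hm))
    (by
      constructor
      · rw [← LinearMap.ker_eq_bot, LinearMap.ker_eq_bot']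
        intro a ha
        apply Subtype.ext
        funext v
        have h := congrArg (evalAt ρ (Set.mem_singleton (1 : W)) v) ha
        rw [map_zero] at h
        have h' : a.1 (ρ 1 v) = 0 := h
        rw [map_one] at h'
        exact h'
      · intro f
        obtain ⟨z, rfl⟩ := exists_biact_graphOne f
        refine ⟨evalGraph ρ 1 z, graphBimod_ext fun x hx v => ?_⟩
        rw [evalAt_biact, evalAt_graphOne, mul_one]
        obtain rfl : x = 1 := hx
        change (evalGraph ρ 1 z).1 (ρ 1 v) = _
        rw [map_one]
        rfl)

end GraphBimod

/-! ### The bimodules `R ⊗_S N` -/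

namespace GrBimod

variable {R : Type u} [CommRing R] [Algebra ℝ R] {𝒜 : ℤ → Submodule ℝ R} [GradedAlgebra 𝒜]
  {S : Subalgebra ℝ R} (hS : IsGradedSubalgebra 𝒜 S)

/-- The bimodule `R ⊗_S R(1)`. -/
abbrev inducedBimod : GrBimod 𝒜 := shift 1 (balTensor S (regular 𝒜) (regular 𝒜) hS)

/-- The element `a ⊗ b` of `R ⊗_S R(1)`. -/
def inducedMk : R →ₗ[ℝ] R →ₗ[ℝ] (inducedBimod hS).carrier :=
  ((balMk S (regular 𝒜) (regular 𝒜)).compl₁₂ (toRegular 𝒜).toLinearMap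
    (toRegular 𝒜).toLinearMap).compr₂
    (toShift 1 (balTensor S (regular 𝒜) (regular 𝒜) hS)).toLinearMap

theorem inducedMk_lact (c a b : R) :
    (inducedBimod hS).lact c (inducedMk hS a b) = inducedMk hS (c * a) b :=
  balLact_balMk (S := S) (M := regular 𝒜) (N := regular 𝒜) c (toRegular 𝒜 a) (toRegular 𝒜 b)

theorem inducedMk_ract (c a b : R) :
    (inducedBimod hS).ract c (inducedMk hS a b) = inducedMk hS a (c * b) :=
  balRact_balMk (S := S) (M := regular 𝒜) (N := regular 𝒜) c (toRegular 𝒜 a) (toRegular 𝒜 b)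

theorem inducedMk_mul {s : R} (hs : s ∈ S) (a b : R) :
    inducedMk hS (s * a) b = inducedMk hS a (s * b) :=
  balMk_ract (S := S) (M := regular 𝒜) (N := regular 𝒜) hs (toRegular 𝒜 a) (toRegular 𝒜 b)

theorem inducedMk_one_mem : inducedMk hS 1 1 ∈ (inducedBimod hS).deg (-1) := by
  have h := balMk_mem (S := S) (M := regular 𝒜) (N := regular 𝒜) (m := toRegular 𝒜 1)
    (n := toRegular 𝒜 1) (SetLike.one_mem_graded 𝒜) (SetLike.one_mem_graded 𝒜)
  exact h

theorem induced_induction {p : (inducedBimod hS).carrier → Prop}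
    (h : ∀ a b, p (inducedMk hS a b)) (hadd : ∀ x y, p x → p y → p (x + y)) (z) : p z := by
  obtain ⟨z, rfl⟩ := (toShift 1 (balTensor S (regular 𝒜) (regular 𝒜) hS)).surjective z
  obtain ⟨z, rfl⟩ := Submodule.mkQ_surjective (balRel S (regular 𝒜) (regular 𝒜)) z
  induction z using TensorProduct.induction_on with
  | zero =>
    have h0 := h 0 0
    rw [map_zero] at h0
    rw [map_zero]
    exact h0
  | add x y hx hy => rw [map_add]; exact hadd _ _ hx hy
  | tmul a b => exact h a b

/-! ### Evaluations of `R ⊗_S N` twisted by an endomorphism fixing `S` -/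

section Twisted

variable (τ : R →ₐ[ℝ] R) (hτ : ∀ s ∈ S, τ s = s)

variable (𝒜) in
/-- The bilinear map `(a, b) ↦ τ(a) b`. -/
def twistMul : (regular 𝒜).carrier →ₗ[ℝ] (regular 𝒜).carrier →ₗ[ℝ] R :=
  (LinearMap.mul ℝ R).compl₁₂ (τ.toLinearMap ∘ₗ (toRegular 𝒜).symm.toLinearMap)
    (toRegular 𝒜).symm.toLinearMap

theorem twistMul_ract (hτ : ∀ s ∈ S, τ s = s) (s : R) (hs : s ∈ S) (a b : (regular 𝒜).carrier) :
    twistMul 𝒜 τ ((regular 𝒜).ract s a) b = twistMul 𝒜 τ a ((regular 𝒜).lact s b) := by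
  obtain ⟨a, rfl⟩ := (toRegular 𝒜).surjective a
  obtain ⟨b, rfl⟩ := (toRegular 𝒜).surjective b
  change τ (s * a) * b = τ a * (s * b)
  rw [map_mul, hτ s hs, mul_left_comm, mul_assoc]

/-- The map `a ⊗ b ↦ τ(a) b`. -/
def inducedEval : (inducedBimod hS).carrier →ₗ[ℝ] R :=
  balLift (S := S) (M := regular 𝒜) (N := regular 𝒜) (twistMul 𝒜 τ) (twistMul_ract τ hτ) ∘ₗ
    (toShift 1 (balTensor S (regular 𝒜) (regular 𝒜) hS)).symm.toLinearMap

@[simp] theorem inducedEval_mk (a b : R) :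
    inducedEval hS τ hτ (inducedMk hS a b) = τ a * b :=
  balLift_balMk (S := S) (M := regular 𝒜) (N := regular 𝒜) _ (twistMul_ract τ hτ)
    (toRegular 𝒜 a) (toRegular 𝒜 b)

theorem inducedEval_ract (c : R) (z : (inducedBimod hS).carrier) :
    inducedEval hS τ hτ ((inducedBimod hS).ract c z) = c * inducedEval hS τ hτ z := by
  induction z using induced_induction with
  | h a b => rw [inducedMk_ract, inducedEval_mk, inducedEval_mk, mul_left_comm]
  | hadd x y hx hy => rw [map_add, map_add, hx, hy, map_add, mul_add]

theorem inducedEval_lact (c : R) (z : (inducedBimod hS).carrier) :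
    inducedEval hS τ hτ ((inducedBimod hS).lact c z) = τ c * inducedEval hS τ hτ z := by
  induction z using induced_induction with
  | h a b => rw [inducedMk_lact, inducedEval_mk, inducedEval_mk, map_mul, mul_assoc]
  | hadd x y hx hy => rw [map_add, map_add, hx, hy, map_add, mul_add]

variable (N : GrBimod 𝒜)

/-- The map `(a ⊗ b) ⊗ n ↦ τ(a) b n`. -/
def twistEval : (tensor (inducedBimod hS) N).carrier →ₗ[ℝ] N.carrier :=
  tlift (N.lact.toLinearMap ∘ₗ inducedEval hS τ hτ) (fun r m n => by
    rw [LinearMap.comp_apply, LinearMap.comp_apply, inducedEval_ract, mul_comm, AlgHom.toLinearMap_apply,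
      map_mul]
    rfl)

@[simp] theorem twistEval_tmk (z : (inducedBimod hS).carrier) (n : N.carrier) :
    twistEval hS τ hτ N (tmk (inducedBimod hS) N z n) = N.lact (inducedEval hS τ hτ z) n := by
  unfold twistEval
  exact tlift_tmk _ _ _ _

/-- The map is right linear, and left linear up to `τ`. So evaluating at a multiple of `1 ⊗ n`
amounts to twisting the first factor of `R ⊗ R`. -/
theorem twistEval_biact (z : R ⊗[ℝ] R) (w : (tensor (inducedBimod hS) N).carrier) :
    twistEval hS τ hτ N ((tensor (inducedBimod hS) N).biact z w) =
      N.biact (Algebra.TensorProduct.map τ (AlgHom.id ℝ R) z) (twistEval hS τ hτ N w) := by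
  induction z using TensorProduct.induction_on with
  | zero => simp
  | add x y hx hy => simp only [map_add, LinearMap.add_apply, hx, hy]
  | tmul a b =>
    rw [Algebra.TensorProduct.map_tmul, biact_tmul, biact_tmul, AlgHom.id_apply]
    induction w using tensor_induction with
    | hadd x y hx hy => simp only [map_add, hx, hy]
    | h m n =>
      rw [tensor_ract, tensor_lact, twistEval_tmk, twistEval_tmk, inducedEval_lact, map_mul,
        Module.End.mul_apply, N.lact_ract]

end Twisted

variable (N : GrBimod 𝒜)

/-- The map `n ↦ 1 ⊗ n` from `N` to `R ⊗_S N(1)`. -/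
def oneTmk : N.carrier →ₗ[ℝ] (tensor (inducedBimod hS) N).carrier :=
  tmk (inducedBimod hS) N (inducedMk hS 1 1)

theorem oneTmk_mem {k : ℤ} {n : N.carrier} (hn : n ∈ N.deg k) :
    oneTmk hS N n ∈ (tensor (inducedBimod hS) N).deg (-1 + k) :=
  tmk_mem (inducedMk_one_mem hS) hn

theorem oneTmk_lact {s : R} (hs : s ∈ S) (n : N.carrier) :
    oneTmk hS N (N.lact s n) = (tensor (inducedBimod hS) N).lact s (oneTmk hS N n) := by
  rw [oneTmk, ← tmk_ract, tensor_lact, inducedMk_ract, inducedMk_lact, inducedMk_mul hS hs]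

theorem oneTmk_ract (b : R) (n : N.carrier) :
    oneTmk hS N (N.ract b n) = (tensor (inducedBimod hS) N).ract b (oneTmk hS N n) := by
  rw [oneTmk, tensor_ract]

theorem tmk_inducedMk_one (c : R) (n : N.carrier) :
    tmk (inducedBimod hS) N (inducedMk hS 1 c) n = oneTmk hS N (N.lact c n) := by
  rw [oneTmk, ← tmk_ract, inducedMk_ract, mul_one]

@[simp] theorem twistEval_oneTmk (τ : R →ₐ[ℝ] R) (hτ : ∀ s ∈ S, τ s = s) (n : N.carrier) :
    twistEval hS τ hτ N (oneTmk hS N n) = n := by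
  rw [oneTmk, twistEval_tmk, inducedEval_mk, map_one, mul_one, map_one, Module.End.one_apply]

/-- Since `R = S + αS`, elements of `S` move across the tensor sign and only the coefficients 1 and
`α` remain on the left. -/
theorem exists_oneTmk_add {α : R} (hα : ∀ a, ∃ s ∈ S, ∃ s' ∈ S, a = s + α * s')
    (w : (tensor (inducedBimod hS) N).carrier) :
    ∃ n n', w = oneTmk hS N n + (tensor (inducedBimod hS) N).lact α (oneTmk hS N n') := by
  induction w using tensor_induction with
  | hadd x y hx hy =>
    obtain ⟨n, n', rfl⟩ := hx
    obtain ⟨m, m', rfl⟩ := hy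
    refine ⟨n + m, n' + m', ?_⟩
    simp only [map_add]
    abel
  | h z n =>
    induction z using induced_induction with
    | hadd x y hx hy =>
      obtain ⟨n, n', h⟩ := hx
      obtain ⟨m, m', h'⟩ := hy
      refine ⟨n + m, n' + m', ?_⟩
      simp only [map_add, LinearMap.add_apply, h, h']
      abel
    | h a b =>
      obtain ⟨s, hs, s', hs', rfl⟩ := hα a
      refine ⟨N.lact (s * b) n, N.lact (s' * b) n, ?_⟩
      have h1 : inducedMk hS (s + α * s') b = inducedMk hS 1 (s * b) +
          (inducedBimod hS).lact α (inducedMk hS 1 (s' * b)) := by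
        rw [map_add, LinearMap.add_apply, ← inducedMk_mul hS hs, ← inducedMk_mul hS hs',
          inducedMk_lact, mul_one, mul_one]
      rw [h1, map_add, LinearMap.add_apply, ← tensor_lact, tmk_inducedMk_one, tmk_inducedMk_one]

/-- The two maps `(a ⊗ b) ⊗ n ↦ a b n` and `(a ⊗ b) ⊗ n ↦ τ(a) b n` are jointly injective. -/
theorem twistEval_injective {α : R} (hα : ∀ a, ∃ s ∈ S, ∃ s' ∈ S, a = s + α * s')
    (τ : R →ₐ[ℝ] R) (hτ : ∀ s ∈ S, τ s = s) (hτα : τ α = -α)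
    (hN : ∀ n, N.lact α n = 0 → n = 0) {w : (tensor (inducedBimod hS) N).carrier}
    (h1 : twistEval hS (AlgHom.id ℝ R) (fun s _ => AlgHom.id_apply s) N w = 0)
    (h2 : twistEval hS τ hτ N w = 0) : w = 0 := by
  obtain ⟨n, n', rfl⟩ := exists_oneTmk_add hS N hα w
  have e : ∀ (σ : R →ₐ[ℝ] R) (hσ : ∀ s ∈ S, σ s = s), twistEval hS σ hσ N
      ((tensor (inducedBimod hS) N).lact α (oneTmk hS N n')) = N.lact (σ α) n' := by
    intro σ hσ
    have h := twistEval_biact hS σ hσ N (α ⊗ₜ 1) (oneTmk hS N n')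
    simpa using h
  rw [map_add, twistEval_oneTmk, e] at h1 h2
  rw [AlgHom.id_apply] at h1
  rw [hτα, map_neg, LinearMap.neg_apply] at h2
  -- The two evaluations read `n + α n' = 0` and `n - α n' = 0`; adding them isolates `n`, and `hN`
  -- then removes `α` from `α n' = 0`.
  have h3 : (2 : ℝ) • n = 0 := by
    rw [two_smul]
    calc n + n = (n + N.lact α n') + (n + -N.lact α n') := by abel
      _ = 0 := by rw [h1, h2, add_zero]
  have h4 : n = 0 := (smul_eq_zero.1 h3).resolve_left two_ne_zero
  rw [h4, zero_add] at h1
  rw [h4, hN n' h1, map_zero, map_zero, add_zero]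

/-- If `x` generates `N`, then `1 ⊗ x` and `1 ⊗ α x` generate `R ⊗_S N`. -/
theorem eq_top_of_oneTmk_mem {α : R} (hα : ∀ a, ∃ s ∈ S, ∃ s' ∈ S, a = s + α * s')
    {x : N.carrier} (hx : ∀ n, ∃ z, N.biact z x = n)
    (U : Submodule ℝ (tensor (inducedBimod hS) N).carrier)
    (hl : ∀ a, ∀ w ∈ U, (tensor (inducedBimod hS) N).lact a w ∈ U)
    (hr : ∀ a, ∀ w ∈ U, (tensor (inducedBimod hS) N).ract a w ∈ U)
    (h1 : oneTmk hS N x ∈ U) (h2 : oneTmk hS N (N.lact α x) ∈ U) : U = ⊤ := by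
  have h : ∀ n, oneTmk hS N n ∈ U := by
    intro n
    obtain ⟨z, rfl⟩ := hx n
    induction z using TensorProduct.induction_on with
    | zero => simp
    | add y z hy hz =>
      rw [map_add, LinearMap.add_apply, map_add]
      exact add_mem hy hz
    | tmul a b =>
      obtain ⟨s, hs, s', hs', rfl⟩ := hα a
      -- With `a = s + αs'`, the element `1 ⊗ a x b` equals `(s (1 ⊗ x) + s' (1 ⊗ αx)) b`.
      rw [biact_tmul, N.lact_ract, oneTmk_ract, map_add, LinearMap.add_apply, mul_comm, map_mul,
        Module.End.mul_apply, map_add, oneTmk_lact hS N hs, oneTmk_lact hS N hs']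
      exact hr _ _ (add_mem (hl _ _ h1) (hl _ _ h2))
  rw [eq_top_iff]
  rintro w -
  obtain ⟨n, n', rfl⟩ := exists_oneTmk_add hS N hα w
  exact add_mem (h n) (hl _ _ (h n'))

end GrBimod

/-! ### Tensor products with the bimodules `B_t` -/

section Decomposition

variable {W : Type*} [Group W] {V : Type u} [AddCommGroup V] [Module ℝ V]
  {ρ : Representation ℝ W V}

theorem polyPullback_linForm (t : W) (φ : Module.Dual ℝ V) :
    polyPullback (ρ t) (linForm φ) = linForm (φ ∘ₗ ρ t) := rfl

theorem polyPullback_of_mem_invariants {t : W} {f : polyFun V} (hf : f ∈ invariants ρ t) :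
    polyPullback (ρ t) f = f := hf

/-- If `t` is a reflection with root `α`, then `R = R^t + α R^t`. -/
theorem exists_invariants_add {t : W} (ht : t * t = 1) {α : Module.Dual ℝ V}
    (hα : α ∘ₗ ρ t = -α) (hroot : ∀ φ : Module.Dual ℝ V, ∃ c : ℝ, φ - φ ∘ₗ ρ t = c • α)
    (a : polyFun V) :
    ∃ s ∈ invariants ρ t, ∃ s' ∈ invariants ρ t, a = s + linForm α * s' := by
  have hinv : ∀ f : polyFun V, f ∈ invariants ρ t ↔ polyPullback (ρ t) f = f := fun f => Iff.rfl
  obtain ⟨a, ha⟩ := a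
  induction ha using Algebra.adjoin_induction with
  | mem f h =>
    obtain ⟨φ, rfl⟩ := h
    obtain ⟨c, hc⟩ := hroot φ
    -- The decomposition is `φ = (φ + φ∘t)/2 + (φ - φ∘t)/2`, and the second term is `(c/2) α`.
    refine ⟨(2⁻¹ : ℝ) • linForm (φ + φ ∘ₗ ρ t), ?_, algebraMap ℝ _ (2⁻¹ * c),
      Subalgebra.algebraMap_mem _ _, ?_⟩
    · rw [hinv, map_smul, polyPullback_linForm, LinearMap.add_comp, LinearMap.comp_assoc,
        ← Module.End.mul_eq_comp, ← map_mul, ht, map_one, add_comm]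
      rfl
    · apply Subtype.ext
      funext v
      have h := LinearMap.congr_fun hc v
      simp only [LinearMap.sub_apply, LinearMap.comp_apply, LinearMap.smul_apply,
        smul_eq_mul] at h
      change φ v = 2⁻¹ * (φ v + φ (ρ t v)) + α v * (2⁻¹ * c)
      linear_combination (1 / 2 : ℝ) * h
  | algebraMap r =>
    exact ⟨algebraMap ℝ _ r, Subalgebra.algebraMap_mem _ _, 0, zero_mem _, by
      rw [mul_zero, add_zero]; rfl⟩
  | add f g hf hg h h' =>
    obtain ⟨s, hs, s', hs', h⟩ := h
    obtain ⟨r, hr, r', hr', h'⟩ := h'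
    refine ⟨s + r, add_mem hs hr, s' + r', add_mem hs' hr', ?_⟩
    have e : (⟨f + g, add_mem hf hg⟩ : polyFun V) = ⟨f, hf⟩ + ⟨g, hg⟩ := rfl
    rw [e, h, h']
    ring
  | mul f g hf hg h h' =>
    obtain ⟨s, hs, s', hs', h⟩ := h
    obtain ⟨r, hr, r', hr', h'⟩ := h'
    -- As `α` is anti-invariant, `α²` is invariant and the term `α² s' r'` of the product joins the
    -- invariant part.
    have hsq : linForm α * linForm α ∈ invariants ρ t := by
      rw [hinv, map_mul, polyPullback_linForm, hα, map_neg]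
      exact neg_mul_neg (linForm α) (linForm α)
    refine ⟨s * r + linForm α * linForm α * (s' * r'),
      add_mem (mul_mem hs hr) (mul_mem hsq (mul_mem hs' hr')), s * r' + s' * r,
      add_mem (mul_mem hs hr') (mul_mem hs' hr), ?_⟩
    have e : (⟨f * g, mul_mem hf hg⟩ : polyFun V) = ⟨f, hf⟩ * ⟨g, hg⟩ := rfl
    rw [e, h, h']
    ring

/-- On the graph of `x` the left action of `α` is multiplication by the nonzero linear form `α∘x`,
which can be cancelled. -/
theorem graphBimod_torsionFree {A : Set W} {α : Module.Dual ℝ V} (hα : α ≠ 0)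
    (f : (graphBimod ρ A).carrier) (hf : (graphBimod ρ A).lact (linForm α) f = 0) : f = 0 := by
  obtain ⟨z, rfl⟩ := exists_biact_graphOne f
  rw [GrBimod.lact_biact, biact_graphOne_eq_zero_iff] at hf
  rw [biact_graphOne_eq_zero_iff]
  intro x hx
  have h := hf x hx
  rw [map_mul, evalGraph_tmul, mul_one, polyPullback_linForm] at h
  refine eq_zero_of_linForm_mul_eq_zero (φ := α ∘ₗ ρ x) ?_ h
  intro h0
  apply hα
  ext v
  have := LinearMap.congr_fun h0 (ρ x⁻¹ v)
  simpa using this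

/-- The function `p(u) - q(v)`. -/
noncomputable def diffForm (p q : Module.Dual ℝ V) : polyFun V ⊗[ℝ] polyFun V :=
  linForm p ⊗ₜ 1 + 1 ⊗ₜ linForm (-q)

theorem evalGraph_diffForm (x : W) (p q : Module.Dual ℝ V) :
    evalGraph ρ x (diffForm p q) = linForm (p ∘ₗ ρ x - q) := by
  rw [diffForm, map_add, evalGraph_tmul, evalGraph_tmul, mul_one, map_one, one_mul,
    polyPullback_linForm, ← map_add, sub_eq_add_neg]

theorem biact_diffForm (N : GrBimod (polyGrading V)) (p q : Module.Dual ℝ V) (n : N.carrier) :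
    N.biact (diffForm p q) n = N.lact (linForm p) n + N.ract (linForm (-q)) n := by
  rw [diffForm, map_add, LinearMap.add_apply, GrBimod.biact_tmul, GrBimod.biact_tmul, map_one,
    map_one]
  rfl

theorem biact_diffForm_mem {N : GrBimod (polyGrading V)} (p q : Module.Dual ℝ V) {k : ℤ}
    {n : N.carrier} (hn : n ∈ N.deg k) : N.biact (diffForm p q) n ∈ N.deg (2 + k) := by
  rw [biact_diffForm]
  refine add_mem (N.lact_mem (linForm_mem p) hn) ?_
  rw [add_comm]
  exact N.ract_mem hn (linForm_mem (-q))

theorem mem_image_mul_iff {t : W} (ht : t * t = 1) {A : Set W} {x : W} :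
    x ∈ (fun y => t * y) '' A ↔ t * x ∈ A := by
  constructor
  · rintro ⟨y, hy, rfl⟩
    change t * (t * y) ∈ A
    rwa [← mul_assoc, ht, one_mul]
  · intro h
    exact ⟨t * x, h, by simp only [← mul_assoc, ht, one_mul]⟩

theorem comp_ne_zero {α : Module.Dual ℝ V} (hα : α ≠ 0) (x : W) : α ∘ₗ ρ x ≠ 0 := by
  intro h0
  apply hα
  ext v
  have := LinearMap.congr_fun h0 (ρ x⁻¹ v)
  simpa using this

/-- The independence of the two generators of `B_t ⊗ R(A)`, on the level of functions. -/
theorem evalGraph_eq_zero_of_add {t : W} (ht : t * t = 1) {A : Set W} {p q : Module.Dual ℝ V}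
    (hp : p - p ∘ₗ ρ t ≠ 0)
    (hpq : ∀ x ∈ A, t * x ∉ A → p ∘ₗ ρ x = q) {y z : polyFun V ⊗[ℝ] polyFun V}
    (h1 : ∀ x ∈ A, evalGraph ρ x y + evalGraph ρ x z * linForm (p ∘ₗ ρ x - q) = 0)
    (h2 : ∀ x ∈ A, evalGraph ρ (t * x) y + evalGraph ρ (t * x) z * linForm (p ∘ₗ ρ x - q) = 0) :
    (∀ x ∈ A ∪ (fun y => t * y) '' A, evalGraph ρ x y = 0) ∧
      ∀ x ∈ A ∩ (fun y => t * y) '' A, evalGraph ρ x z = 0 := by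
  -- The equation `h1` at `x` and the equation `h2` at `tx` involve the same `y` and `z` on `Gr(x)`,
  -- but different values of `λ`. Their difference is `z` times the nonzero form `(p - p∘t)∘x`.
  have hz : ∀ x ∈ A, t * x ∈ A → evalGraph ρ x z = 0 := by
    intro x hx htx
    have h3 := h1 x hx
    have h4 := h2 (t * x) htx
    rw [← mul_assoc, ht, one_mul] at h4
    have h5 : linForm ((p - p ∘ₗ ρ t) ∘ₗ ρ x) * evalGraph ρ x z = 0 := by
      have e : linForm ((p - p ∘ₗ ρ t) ∘ₗ ρ x) =
          linForm (p ∘ₗ ρ x - q) - linForm (p ∘ₗ ρ (t * x) - q) := by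
        rw [← map_sub, map_mul]
        congr 1
        ext v
        simp
      rw [e]
      linear_combination h3 - h4
    exact eq_zero_of_linForm_mul_eq_zero (comp_ne_zero hp x) h5
  -- The term with `z` drops out in both cases: `z` vanishes on the graphs of `x` and `tx` if `tx ∈
  -- A`, and `λ` vanishes on `Gr(x)` otherwise.
  have hy : ∀ x ∈ A, evalGraph ρ x y = 0 ∧ evalGraph ρ (t * x) y = 0 := by
    intro x hx
    have h3 := h1 x hx
    have h4 := h2 x hx
    by_cases htx : t * x ∈ A
    · rw [hz x hx htx, zero_mul, add_zero] at h3
      rw [hz (t * x) htx (by rwa [← mul_assoc, ht, one_mul]), zero_mul, add_zero] at h4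
      exact ⟨h3, h4⟩
    · rw [hpq x hx htx, sub_self, map_zero, mul_zero, add_zero] at h3 h4
      exact ⟨h3, h4⟩
  constructor
  · rintro x (hx | hx)
    · exact (hy x hx).1
    · rw [mem_image_mul_iff ht] at hx
      have := (hy _ hx).2
      rwa [← mul_assoc, ht, one_mul] at this
  · rintro x ⟨hx, hx'⟩
    exact hz x hx ((mem_image_mul_iff ht).1 hx')

/-- The bimodule `B_t ⊗ N`. -/
noncomputable def reflTensor (ρ : Representation ℝ W V) (t : W) (N : GrBimod (polyGrading V)) :
    GrBimod (polyGrading V) :=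
  GrBimod.tensor (reflBimod ρ t) N

/-- The map `n ↦ 1 ⊗ n` from `N` to `B_t ⊗ N`. -/
noncomputable def reflOne (ρ : Representation ℝ W V) (t : W) (N : GrBimod (polyGrading V)) :
    N.carrier →ₗ[ℝ] (reflTensor ρ t N).carrier :=
  GrBimod.oneTmk (invariants_isGraded ρ t) N

theorem reflOne_mem (t : W) {N : GrBimod (polyGrading V)} {k : ℤ} {n : N.carrier}
    (hn : n ∈ N.deg k) : reflOne ρ t N n ∈ (reflTensor ρ t N).deg (-1 + k) :=
  GrBimod.oneTmk_mem (invariants_isGraded ρ t) N hn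

theorem reflOne_lact {t : W} {N : GrBimod (polyGrading V)} {s : polyFun V}
    (hs : s ∈ invariants ρ t) (n : N.carrier) :
    reflOne ρ t N (N.lact s n) = (reflTensor ρ t N).lact s (reflOne ρ t N n) :=
  GrBimod.oneTmk_lact (invariants_isGraded ρ t) N hs n

theorem reflOne_ract {t : W} {N : GrBimod (polyGrading V)} (b : polyFun V) (n : N.carrier) :
    reflOne ρ t N (N.ract b n) = (reflTensor ρ t N).ract b (reflOne ρ t N n) :=
  GrBimod.oneTmk_ract (invariants_isGraded ρ t) N b n

/-- The untwisted evaluation and the one twisted by `t` turn questions about the tensor product into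
questions about functions; only their values on multiples of `1 ⊗ n` and their joint injectivity
matter later. -/
theorem exists_twistEval (ρ : Representation ℝ W V) (t : W) (N : GrBimod (polyGrading V)) :
    ∃ Φ Ψ : (reflTensor ρ t N).carrier →ₗ[ℝ] N.carrier,
      (∀ z n, Φ ((reflTensor ρ t N).biact z (reflOne ρ t N n)) = N.biact z n) ∧
      (∀ z n, Ψ ((reflTensor ρ t N).biact z (reflOne ρ t N n)) =
        N.biact (leftTwist ρ t z) n) ∧
      (t * t = 1 → ∀ α : Module.Dual ℝ V, α ∘ₗ ρ t = -α →
        (∀ φ : Module.Dual ℝ V, ∃ c : ℝ, φ - φ ∘ₗ ρ t = c • α) →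
        (∀ n, N.lact (linForm α) n = 0 → n = 0) → ∀ w, Φ w = 0 → Ψ w = 0 → w = 0) := by
  refine ⟨GrBimod.twistEval (invariants_isGraded ρ t) (AlgHom.id ℝ (polyFun V))
    (fun s _ => AlgHom.id_apply s) N, GrBimod.twistEval (invariants_isGraded ρ t)
    (polyPullback (ρ t)) (fun s hs => polyPullback_of_mem_invariants hs) N, ?_, ?_, ?_⟩
  · intro z n
    refine (GrBimod.twistEval_biact _ _ _ _ _ _).trans ?_
    rw [Algebra.TensorProduct.map_id]
    exact congrArg _ (GrBimod.twistEval_oneTmk _ _ _ _ _)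
  · intro z n
    refine (GrBimod.twistEval_biact _ _ _ _ _ _).trans ?_
    exact congrArg _ (GrBimod.twistEval_oneTmk _ _ _ _ _)
  · intro ht α hα hroot hN w h1 h2
    refine GrBimod.twistEval_injective _ N (α := linForm α) (exists_invariants_add ht hα hroot) _
      _ ?_ hN h1 h2
    rw [polyPullback_linForm, hα, map_neg]

theorem eq_top_of_reflOne_mem {t : W} (ht : t * t = 1) {α : Module.Dual ℝ V}
    (hα : α ∘ₗ ρ t = -α) (hroot : ∀ φ : Module.Dual ℝ V, ∃ c : ℝ, φ - φ ∘ₗ ρ t = c • α)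
    {N : GrBimod (polyGrading V)} {x : N.carrier} (hx : ∀ n, ∃ z, N.biact z x = n)
    (U : Submodule ℝ (reflTensor ρ t N).carrier)
    (hl : ∀ a, ∀ w ∈ U, (reflTensor ρ t N).lact a w ∈ U)
    (hr : ∀ a, ∀ w ∈ U, (reflTensor ρ t N).ract a w ∈ U)
    (h1 : reflOne ρ t N x ∈ U) (h2 : reflOne ρ t N (N.lact (linForm α) x) ∈ U) : U = ⊤ :=
  GrBimod.eq_top_of_oneTmk_mem (invariants_isGraded ρ t) N (exists_invariants_add ht hα hroot) hx
    U hl hr h1 h2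

end Decomposition

/-! ### Relations between the two generators of `B_t ⊗ R(A)` -/

section Decomposition

variable {W : Type*} [Group W] {V : Type u} [AddCommGroup V] [Module ℝ V]
  {ρ : Representation ℝ W V}

/-- The linear dependencies between the elements `1 ⊗ 1` and `1 ⊗ λ` of `B_t ⊗ R(A)`, where
`λ(u, v) = p(u) - q(v)`. -/
theorem biact_reflOne_add_eq_zero_iff {t : W} (ht : t * t = 1) {A : Set W}
    {p q α : Module.Dual ℝ V} (hα0 : α ≠ 0) (hα : α ∘ₗ ρ t = -α)
    (hroot : ∀ φ : Module.Dual ℝ V, ∃ c : ℝ, φ - φ ∘ₗ ρ t = c • α)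
    (y z : polyFun V ⊗[ℝ] polyFun V) :
    (reflTensor ρ t (graphBimod ρ A)).biact y (reflOne ρ t (graphBimod ρ A) (graphOne ρ A)) +
      (reflTensor ρ t (graphBimod ρ A)).biact z (reflOne ρ t (graphBimod ρ A)
        ((graphBimod ρ A).biact (diffForm p q) (graphOne ρ A))) = 0 ↔
    ∀ x ∈ A, evalGraph ρ x y + evalGraph ρ x z * linForm (p ∘ₗ ρ x - q) = 0 ∧
      evalGraph ρ (t * x) y + evalGraph ρ (t * x) z * linForm (p ∘ₗ ρ x - q) = 0 := by
  obtain ⟨Φ, Ψ, hΦ, hΨ, hinj⟩ := exists_twistEval ρ t (graphBimod ρ A)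
  replace hinj := hinj ht α hα hroot (graphBimod_torsionFree hα0)
  generalize hw : (reflTensor ρ t (graphBimod ρ A)).biact y
    (reflOne ρ t (graphBimod ρ A) (graphOne ρ A)) +
      (reflTensor ρ t (graphBimod ρ A)).biact z (reflOne ρ t (graphBimod ρ A)
        ((graphBimod ρ A).biact (diffForm p q) (graphOne ρ A))) = w
  have h1 : ∀ x (hx : x ∈ A) v, evalAt ρ hx v (Φ w) =
      (evalGraph ρ x y + evalGraph ρ x z * linForm (p ∘ₗ ρ x - q)).1 v := by
    intro x hx v
    rw [← hw, map_add, map_add, hΦ, hΦ, evalAt_biact, evalAt_biact, evalAt_biact,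
      evalAt_graphOne, mul_one, mul_one, evalGraph_diffForm]
    rfl
  have h2 : ∀ x (hx : x ∈ A) v, evalAt ρ hx v (Ψ w) =
      (evalGraph ρ (t * x) y + evalGraph ρ (t * x) z * linForm (p ∘ₗ ρ x - q)).1 v := by
    intro x hx v
    rw [← hw, map_add, map_add, hΨ, hΨ, evalAt_biact, evalAt_biact, evalAt_biact,
      evalAt_graphOne, mul_one, mul_one, evalGraph_diffForm, evalGraph_leftTwist,
      evalGraph_leftTwist]
    rfl
  constructor
  · intro hw0 x hx
    constructor
    · apply Subtype.ext
      funext v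
      rw [← h1 x hx v, hw0, map_zero, map_zero]
      rfl
    · apply Subtype.ext
      funext v
      rw [← h2 x hx v, hw0, map_zero, map_zero]
      rfl
  · intro h
    refine hinj w (graphBimod_ext fun x hx v => ?_) (graphBimod_ext fun x hx v => ?_)
    · rw [h1, (h x hx).1, map_zero]
      rfl
    · rw [h2, (h x hx).2, map_zero]
      rfl

/-- This allows `p - p∘t` to serve as the root of `t`. -/
theorem comp_sub_comp_eq_neg {t : W} (ht : t * t = 1) (p : Module.Dual ℝ V) :
    (p - p ∘ₗ ρ t) ∘ₗ ρ t = -(p - p ∘ₗ ρ t) := by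
  have htt : ρ t ∘ₗ ρ t = LinearMap.id := by
    rw [← Module.End.mul_eq_comp, ← map_mul, ht, map_one]
    rfl
  rw [LinearMap.sub_comp, LinearMap.comp_assoc, htt, LinearMap.comp_id, neg_sub]

/-- The homomorphism `R(A ∪ t A)(1) → B_t ⊗ R(A)` with `1 ↦ 1 ⊗ 1`. -/
theorem exists_hom_reflOne {t : W} (ht : t * t = 1) (A : Set W)
    {α : Module.Dual ℝ V} (hα0 : α ≠ 0) (hα : α ∘ₗ ρ t = -α)
    (hroot : ∀ φ : Module.Dual ℝ V, ∃ c : ℝ, φ - φ ∘ₗ ρ t = c • α) :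
    ∃ f : GrBimod.shift 1 (graphBimod ρ (A ∪ (fun y => t * y) '' A)) ⟶
        reflTensor ρ t (graphBimod ρ A),
      ∀ z, f.toLin (GrBimod.toShift 1 (graphBimod ρ (A ∪ (fun y => t * y) '' A))
        ((graphBimod ρ (A ∪ (fun y => t * y) '' A)).biact z (graphOne ρ _))) =
        (reflTensor ρ t (graphBimod ρ A)).biact z
          (reflOne ρ t (graphBimod ρ A) (graphOne ρ A)) := by
  -- The shift in `B_t` puts `1 ⊗ 1` in degree -1, so the source is shifted by 1.
  refine exists_hom_graphBimod (d := -1 + 0) (by norm_num)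
    (reflOne_mem t (graphOne_mem (ρ := ρ) (A := A))) fun z hz => ?_
  have h := (biact_reflOne_add_eq_zero_iff ht (A := A) (p := 0) (q := 0) hα0 hα hroot z 0).2
    (fun x hx => ⟨by rw [hz x (Or.inl hx), map_zero, zero_mul, add_zero],
      by rw [hz (t * x) (Or.inr ⟨x, hx, rfl⟩), map_zero, zero_mul, add_zero]⟩)
  rwa [map_zero, LinearMap.zero_apply, add_zero] at h

/-- The homomorphism `R(A ∩ t A)(-1) → B_t ⊗ R(A)` with `1 ↦ 1 ⊗ λ`, where
`λ(u, v) = p(u) - q(v)` vanishes on the graphs of the elements of `A \ t A`. -/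
theorem exists_hom_reflOne_diffForm {t : W} (ht : t * t = 1) (A : Set W)
    {p q α : Module.Dual ℝ V} (hα0 : α ≠ 0) (hα : α ∘ₗ ρ t = -α)
    (hroot : ∀ φ : Module.Dual ℝ V, ∃ c : ℝ, φ - φ ∘ₗ ρ t = c • α)
    (hpq : ∀ x ∈ A, t * x ∉ A → p ∘ₗ ρ x = q) :
    ∃ f : GrBimod.shift (-1) (graphBimod ρ (A ∩ (fun y => t * y) '' A)) ⟶
        reflTensor ρ t (graphBimod ρ A),
      ∀ z, f.toLin (GrBimod.toShift (-1) (graphBimod ρ (A ∩ (fun y => t * y) '' A))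
        ((graphBimod ρ (A ∩ (fun y => t * y) '' A)).biact z (graphOne ρ _))) =
        (reflTensor ρ t (graphBimod ρ A)).biact z (reflOne ρ t (graphBimod ρ A)
          ((graphBimod ρ A).biact (diffForm p q) (graphOne ρ A))) := by
  -- The linear form `λ` adds 2 to the degree -1 of `1 ⊗ 1`, so the source is shifted by -1.
  refine exists_hom_graphBimod (d := -1 + (2 + 0)) (by norm_num)
    (reflOne_mem t (biact_diffForm_mem p q (graphOne_mem (ρ := ρ) (A := A)))) fun z hz => ?_
  have h := (biact_reflOne_add_eq_zero_iff ht (A := A) (p := p) (q := q) hα0 hα hroot 0 z).2 ?_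
  · rwa [map_zero, LinearMap.zero_apply, zero_add] at h
  · intro x hx
    rw [map_zero, zero_add, map_zero, zero_add]
    -- If `tx ∈ A`, both `x` and `tx` lie in `A ∩ tA`, where `z` vanishes; otherwise `λ` vanishes on
    -- `Gr(x)`.
    by_cases htx : t * x ∈ A
    · rw [hz x ⟨hx, (mem_image_mul_iff ht).2 htx⟩, hz (t * x) ⟨htx, ⟨x, hx, rfl⟩⟩, zero_mul]
      exact ⟨rfl, rfl⟩
    · rw [hpq x hx htx, sub_self, map_zero, mul_zero, mul_zero]
      exact ⟨rfl, rfl⟩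

theorem linForm_add_comp_mem_invariants {t : W} (ht : t * t = 1) (φ : Module.Dual ℝ V) :
    linForm (φ + φ ∘ₗ ρ t) ∈ invariants ρ t := by
  have htt : ρ t ∘ₗ ρ t = LinearMap.id := by
    rw [← Module.End.mul_eq_comp, ← map_mul, ht, map_one]
    rfl
  change polyPullback (ρ t) (linForm (φ + φ ∘ₗ ρ t)) = linForm (φ + φ ∘ₗ ρ t)
  rw [polyPullback_linForm, LinearMap.add_comp, LinearMap.comp_assoc, htt, LinearMap.comp_id,
    add_comm]

/-! ### Generation by two elements, and the splitting -/

/-- The submodule generated by two elements of a bimodule. -/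
noncomputable def biactRange (N : GrBimod (polyGrading V)) (g₁ g₂ : N.carrier) :
    Submodule ℝ N.carrier :=
  LinearMap.range ((LinearMap.applyₗ g₁ ∘ₗ N.biact.toLinearMap).coprod
    (LinearMap.applyₗ g₂ ∘ₗ N.biact.toLinearMap))

theorem mem_biactRange {N : GrBimod (polyGrading V)} {g₁ g₂ w : N.carrier} :
    w ∈ biactRange N g₁ g₂ ↔ ∃ y z, N.biact y g₁ + N.biact z g₂ = w := by
  constructor
  · rintro ⟨⟨y, z⟩, h⟩
    exact ⟨y, z, h⟩
  · rintro ⟨y, z, h⟩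
    exact ⟨⟨y, z⟩, h⟩

theorem lact_mem_biactRange {N : GrBimod (polyGrading V)} {g₁ g₂ w : N.carrier} (a : polyFun V)
    (h : w ∈ biactRange N g₁ g₂) : N.lact a w ∈ biactRange N g₁ g₂ := by
  obtain ⟨y, z, rfl⟩ := mem_biactRange.1 h
  rw [map_add, GrBimod.lact_biact, GrBimod.lact_biact]
  exact mem_biactRange.2 ⟨_, _, rfl⟩

theorem ract_mem_biactRange {N : GrBimod (polyGrading V)} {g₁ g₂ w : N.carrier} (a : polyFun V)
    (h : w ∈ biactRange N g₁ g₂) : N.ract a w ∈ biactRange N g₁ g₂ := by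
  obtain ⟨y, z, rfl⟩ := mem_biactRange.1 h
  rw [map_add, GrBimod.ract_biact, GrBimod.ract_biact]
  exact mem_biactRange.2 ⟨_, _, rfl⟩

theorem left_mem_biactRange {N : GrBimod (polyGrading V)} (g₁ g₂ : N.carrier) :
    g₁ ∈ biactRange N g₁ g₂ :=
  mem_biactRange.2 ⟨1, 0, by
    rw [map_one, map_zero, LinearMap.zero_apply, add_zero]
    rfl⟩

theorem right_mem_biactRange {N : GrBimod (polyGrading V)} (g₁ g₂ : N.carrier) :
    g₂ ∈ biactRange N g₁ g₂ :=
  mem_biactRange.2 ⟨0, 1, by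
    rw [map_one, map_zero, LinearMap.zero_apply, zero_add]
    rfl⟩

theorem linForm_sub_comp (t : W) (p : Module.Dual ℝ V) :
    linForm (p - p ∘ₗ ρ t) = (2 : ℝ) • linForm p - linForm (p + p ∘ₗ ρ t) := by
  rw [← map_smul, ← map_sub]
  congr 1
  module

/-- The root is `2p` minus the invariant form `p + p∘t`, and an invariant form moves across the
tensor sign. So `1 ⊗ αx` may be replaced by `1 ⊗ px` as a generator. -/
theorem reflOne_lact_sub {t : W} (ht : t * t = 1) (N : GrBimod (polyGrading V))
    (p : Module.Dual ℝ V) (x : N.carrier) :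
    reflOne ρ t N (N.lact (linForm (p - p ∘ₗ ρ t)) x) =
      (2 : ℝ) • reflOne ρ t N (N.lact (linForm p) x) -
        (reflTensor ρ t N).lact (linForm (p + p ∘ₗ ρ t)) (reflOne ρ t N x) := by
  rw [← reflOne_lact (linForm_add_comp_mem_invariants ht p), ← map_smul, ← map_sub,
    linForm_sub_comp, map_sub, map_smul]
  rfl

/-- The form `λ` differs from `p` only by a right multiplication, which acts on `1 ⊗ x` from
outside; so `1 ⊗ px` may be replaced by `1 ⊗ λx`. -/
theorem reflOne_lact_linForm (t : W) (N : GrBimod (polyGrading V))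
    (p q : Module.Dual ℝ V) (x : N.carrier) :
    reflOne ρ t N (N.lact (linForm p) x) = reflOne ρ t N (N.biact (diffForm p q) x) -
      (reflTensor ρ t N).ract (linForm (-q)) (reflOne ρ t N x) := by
  rw [← reflOne_ract, ← map_sub, biact_diffForm, add_sub_cancel_right]

/-- The elements `1 ⊗ x` and `1 ⊗ λ x` generate `B_t ⊗ N`, if `x` generates `N`. -/
theorem biactRange_reflOne {t : W} (ht : t * t = 1) {p q : Module.Dual ℝ V}
    (hroot : ∀ φ : Module.Dual ℝ V, ∃ c : ℝ, φ - φ ∘ₗ ρ t = c • (p - p ∘ₗ ρ t))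
    {N : GrBimod (polyGrading V)} {x : N.carrier} (hx : ∀ n, ∃ z, N.biact z x = n) :
    biactRange (reflTensor ρ t N) (reflOne ρ t N x)
      (reflOne ρ t N (N.biact (diffForm p q) x)) = ⊤ := by
  have h1 := left_mem_biactRange (reflOne ρ t N x) (reflOne ρ t N (N.biact (diffForm p q) x))
  have h2 := right_mem_biactRange (reflOne ρ t N x) (reflOne ρ t N (N.biact (diffForm p q) x))
  refine eq_top_of_reflOne_mem ht (comp_sub_comp_eq_neg ht p) hroot hx _
    (fun a w => lact_mem_biactRange a) (fun a w => ract_mem_biactRange a) h1 ?_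
  rw [reflOne_lact_sub ht, reflOne_lact_linForm t N p q]
  exact sub_mem (Submodule.smul_mem _ _ (sub_mem h2 (ract_mem_biactRange _ h1)))
    (lact_mem_biactRange _ h1)

theorem GrBimod.nonempty_biprod_iso {M N P : GrBimod (polyGrading V)} (f₁ : M ⟶ P) (f₂ : N ⟶ P)
    (hinj : ∀ m n, f₁.toLin m + f₂.toLin n = 0 → m = 0 ∧ n = 0)
    (hsurj : ∀ w, ∃ m n, f₁.toLin m + f₂.toLin n = w) : Nonempty (M ⊞ N ≅ P) := by
  refine ⟨GrBimod.biprodIsoDirSum M N ≪≫ GrBimod.isoOfBijective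
    (GrBimod.ofLin (M := GrBimod.dirSum M N) (N := P) (f₁.toLin.coprod f₂.toLin) ?_ ?_ ?_) ?_⟩
  · rintro a ⟨m, n⟩
    change f₁.toLin (M.lact a m) + f₂.toLin (N.lact a n) = P.lact a (f₁.toLin m + f₂.toLin n)
    rw [map_add, f₁.map_lact, f₂.map_lact]
  · rintro a ⟨m, n⟩
    change f₁.toLin (M.ract a m) + f₂.toLin (N.ract a n) = P.ract a (f₁.toLin m + f₂.toLin n)
    rw [map_add, f₁.map_ract, f₂.map_ract]
  · rintro i ⟨m, n⟩ ⟨hm, hn⟩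
    exact add_mem (f₁.map_deg i m hm) (f₂.map_deg i n hn)
  · constructor
    · refine (injective_iff_map_eq_zero (f₁.toLin.coprod f₂.toLin)).2 ?_
      rintro ⟨m, n⟩ h
      obtain ⟨rfl, rfl⟩ := hinj m n h
      rfl
    · intro w
      obtain ⟨m, n, h⟩ := hsurj w
      exact ⟨(m, n), h⟩

theorem exists_toShift_biact_graphOne (k : ℤ) (A : Set W)
    (m : (GrBimod.shift k (graphBimod ρ A)).carrier) : ∃ z,
      GrBimod.toShift k (graphBimod ρ A) ((graphBimod ρ A).biact z (graphOne ρ A)) = m :=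
  exists_biact_graphOne (ρ := ρ) (A := A) m

/-- If `λ(u, v) = p(u) - q(v)` vanishes on the graphs of the elements of `A \ t A`, then
`B_t ⊗ R(A)` is the direct sum of `R(A ∪ t A)(1)` and `R(A ∩ t A)(-1)`. -/
theorem nonempty_reflTensor_iso {t : W} (ht : t * t = 1) {A : Set W} {p q : Module.Dual ℝ V}
    (hp : p - p ∘ₗ ρ t ≠ 0)
    (hroot : ∀ φ : Module.Dual ℝ V, ∃ c : ℝ, φ - φ ∘ₗ ρ t = c • (p - p ∘ₗ ρ t))
    (hpq : ∀ x ∈ A, t * x ∉ A → p ∘ₗ ρ x = q) :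
    Nonempty (GrBimod.shift 1 (graphBimod ρ (A ∪ (fun y => t * y) '' A)) ⊞
      GrBimod.shift (-1) (graphBimod ρ (A ∩ (fun y => t * y) '' A)) ≅
        reflTensor ρ t (graphBimod ρ A)) := by
  obtain ⟨f₁, h₁⟩ := exists_hom_reflOne ht A hp (comp_sub_comp_eq_neg ht p) hroot
  obtain ⟨f₂, h₂⟩ := exists_hom_reflOne_diffForm ht A hp (comp_sub_comp_eq_neg ht p) hroot hpq
  refine GrBimod.nonempty_biprod_iso f₁ f₂ ?_ ?_
  · intro m n h
    obtain ⟨y, rfl⟩ := exists_toShift_biact_graphOne _ _ m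
    obtain ⟨z, rfl⟩ := exists_toShift_biact_graphOne _ _ n
    rw [h₁, h₂, biact_reflOne_add_eq_zero_iff ht hp (comp_sub_comp_eq_neg ht p) hroot] at h
    obtain ⟨hy, hz⟩ := evalGraph_eq_zero_of_add ht hp hpq (fun x hx => (h x hx).1)
      (fun x hx => (h x hx).2)
    rw [(biact_graphOne_eq_zero_iff (ρ := ρ)).2 hy, (biact_graphOne_eq_zero_iff (ρ := ρ)).2 hz]
    exact ⟨map_zero _, map_zero _⟩
  · intro w
    have hw : w ∈ biactRange (reflTensor ρ t (graphBimod ρ A))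
        (reflOne ρ t (graphBimod ρ A) (graphOne ρ A)) (reflOne ρ t (graphBimod ρ A)
          ((graphBimod ρ A).biact (diffForm p q) (graphOne ρ A))) := by
      rw [biactRange_reflOne ht hroot (exists_biact_graphOne (ρ := ρ) (A := A))]
      trivial
    obtain ⟨y, z, h⟩ := mem_biactRange.1 hw
    exact ⟨_, _, by rw [h₁ y, h₂ z, h]⟩

end Decomposition

/-! ### Roots -/

section Roots

variable {V : Type u} [AddCommGroup V] [Module ℝ V]

/-- Both functionals factor through the line `V / K`, whose dual is again a line. -/
theorem exists_eq_smul_of_finrank_quotient_eq_one {K : Submodule ℝ V}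
    (hK : Module.finrank ℝ (V ⧸ K) = 1) {φ ψ : Module.Dual ℝ V} (hφ : ∀ v ∈ K, φ v = 0)
    (hψ : ∀ v ∈ K, ψ v = 0) (h0 : ψ ≠ 0) : ∃ c : ℝ, φ = c • ψ := by
  obtain ⟨x, -, hx⟩ := finrank_eq_one_iff'.1 hK
  obtain ⟨v, rfl⟩ := K.mkQ_surjective x
  have key : ∀ w, ∃ c : ℝ, ∀ χ : Module.Dual ℝ V, (∀ v ∈ K, χ v = 0) → χ w = c * χ v := by
    intro w
    obtain ⟨c, hc⟩ := hx (K.mkQ w)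
    refine ⟨c, fun χ hχ => ?_⟩
    rw [← map_smul] at hc
    have h := hχ _ ((Submodule.Quotient.eq K).1 hc)
    rw [map_sub, map_smul, smul_eq_mul, sub_eq_zero] at h
    exact h.symm
  have hv : ψ v ≠ 0 := fun h => h0 (LinearMap.ext fun w => by
    obtain ⟨c, hc⟩ := key w
    rw [hc ψ hψ, h, mul_zero]
    rfl)
  refine ⟨φ v / ψ v, LinearMap.ext fun w => ?_⟩
  obtain ⟨c, hc⟩ := key w
  rw [LinearMap.smul_apply, smul_eq_mul, hc φ hφ, hc ψ hψ]
  field_simp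

/-- The hypothesis says `(1 + r) t = 1 + r`. Combining it with its multiples by `r` on the right and
by `t` on the left gives `1 + x = 2x⁻¹` for `x = rt`. Multiplying by `x` and using `x³ = 1` gives `x
+ x⁻¹ = 2`. Together these yield `3x = 3`, and 3 is invertible over ℝ. -/
theorem mul_eq_one_of_one_add_mul_sub_one_eq_zero {E : Type*} [Ring E] [Module ℝ E] {r t : E}
    (hr : r * r = 1) (ht : t * t = 1) (h3 : (r * t) ^ 3 = 1) (h : (1 + r) * (t - 1) = 0) :
    r * t = 1 := by
  have e1 : t + r * t = 1 + r := by
    rw [← sub_eq_zero, ← h]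
    noncomm_ring
  have hxy : (r * t) * (t * r) = 1 := by
    rw [mul_assoc, ← mul_assoc t, ht, one_mul, hr]
  have hxx : (r * t) * (r * t) = t * r := by
    calc (r * t) * (r * t) = (r * t) ^ 3 * (t * r) := by
          rw [pow_succ, mul_assoc _ (r * t) (t * r), hxy, mul_one, pow_two]
      _ = t * r := by rw [h3, one_mul]
  have hrtr : r * t * r = t * r * t := by
    rw [← hxx, mul_assoc (r * t), mul_assoc r t t, ht, mul_one]
  have e2 : t * r + r * t * r = r + 1 := by
    have := congrArg (· * r) e1
    simp only [add_mul, hr, one_mul] at this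
    exact this
  have e3 : 1 + r * t * r = t + t * r := by
    have := congrArg (t * ·) e1
    simp only [mul_add, ht, mul_one, ← mul_assoc] at this
    rwa [hrtr]
  have e4 : 1 + r * t = (2 : ℝ) • (t * r) := by
    rw [two_smul]
    have h4 : 1 + r * t - (t * r + t * r) = (t + r * t - (1 + r)) +
        (1 + r * t * r - (t + t * r)) - (t * r + r * t * r - (r + 1)) := by abel
    rw [e1, e2, e3, sub_self, sub_self, sub_self, add_zero, sub_zero] at h4
    exact sub_eq_zero.1 h4
  have e5 : r * t + t * r = (2 : ℝ) • (1 : E) := by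
    have h5 : r * t + r * t * (r * t) = r * t * (t * r) + r * t * (t * r) := by
      rw [← mul_add, ← two_smul ℝ (t * r), ← e4, mul_add, mul_one]
    rw [hxx, hxy] at h5
    rw [h5, two_smul]
  have e6 : (3 : ℝ) • (r * t) = (3 : ℝ) • (1 : E) := by
    have h7 : t * r = (2 : ℝ) • (1 : E) - r * t := by rw [← e5]; abel
    rw [h7] at e4
    have h8 : (3 : ℝ) • (r * t) - (3 : ℝ) • (1 : E) =
      (1 + r * t) - (2 : ℝ) • ((2 : ℝ) • (1 : E) - r * t) := by module
    rw [← sub_eq_zero, h8, e4, sub_self]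
  have h9 := congrArg (fun x => (3⁻¹ : ℝ) • x) e6
  simpa only [smul_smul, inv_mul_cancel₀ (three_ne_zero (α := ℝ)), one_smul] using h9

variable {W : Type*} [Group W] {cs : CoxeterSystem (CoxeterMatrix.A 2) W}
  {ρ : Representation ℝ W V}

/-- All forms `φ - φ∘t` vanish on the fixed space of `t`, which has codimension 1, so they are
proportional to any nonzero one among them. -/
theorem IsReflectionFaithful.exists_sub_comp_eq_smul (hρ : IsReflectionFaithful cs ρ) {t : W}
    (ht : cs.IsReflection t) {p : Module.Dual ℝ V} (hp : p - p ∘ₗ ρ t ≠ 0)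
    (φ : Module.Dual ℝ V) : ∃ c : ℝ, φ - φ ∘ₗ ρ t = c • (p - p ∘ₗ ρ t) := by
  have h : ∀ χ : Module.Dual ℝ V, ∀ v ∈ LinearMap.eqLocus (ρ t) LinearMap.id,
      (χ - χ ∘ₗ ρ t) v = 0 := by
    intro χ v hv
    have hv' : ρ t v = v := hv
    rw [LinearMap.sub_apply, LinearMap.comp_apply, hv', sub_self]
  exact exists_eq_smul_of_finrank_quotient_eq_one ((hρ.codim_fixed t).2 ht) (h φ) (h p) hp

/-- If every `r`-invariant form were `t`-invariant, this would hold for all `φ + φ∘r`, which means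
`(1 + r)(t - 1) = 0` on `V`. Then `rt` acts trivially, contradicting faithfulness. -/
theorem IsReflectionFaithful.exists_comp_eq_and_sub_comp_ne_zero (hρ : IsReflectionFaithful cs ρ)
    {r t : W} (hr : cs.IsReflection r) (ht : cs.IsReflection t) (hrt : r ≠ t) :
    ∃ p : Module.Dual ℝ V, p ∘ₗ ρ r = p ∧ p - p ∘ₗ ρ t ≠ 0 := by
  by_contra! h
  have hr2 : ρ r * ρ r = 1 := by rw [← map_mul, hr.mul_self, map_one]
  have ht2 : ρ t * ρ t = 1 := by rw [← map_mul, ht.mul_self, map_one]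
  have h3 : (ρ r * ρ t) ^ 3 = 1 := by
    rw [← map_mul, ← map_pow, IsReflection.mul_pow_three cs hr ht, map_one]
  have key : (1 + ρ r) * (ρ t - 1) = 0 := by
    ext v
    refine (Module.forall_dual_apply_eq_zero_iff ℝ _).1 fun φ => ?_
    have h1 := LinearMap.congr_fun (h (φ + φ ∘ₗ ρ r) (by
      rw [LinearMap.add_comp, LinearMap.comp_assoc, ← Module.End.mul_eq_comp, hr2, add_comm]
      rfl)) v
    simp only [LinearMap.sub_apply, LinearMap.add_apply, LinearMap.comp_apply,
      LinearMap.zero_apply] at h1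
    simp only [Module.End.mul_apply, LinearMap.sub_apply, LinearMap.add_apply,
      Module.End.one_apply, map_add, map_sub]
    linear_combination -h1
  have h1 := mul_eq_one_of_one_add_mul_sub_one_eq_zero hr2 ht2 h3 key
  rw [← map_mul, ← map_one ρ] at h1
  exact hrt (eq_of_mul_inv_eq_one (by rw [ht.inv]; exact hρ.injective h1))

/-- `B_t ⊗ R(A) ≅ R(A ∪ t A)(1) ⊕ R(A ∩ t A)(-1)`. -/
theorem IsReflectionFaithful.nonempty_tensor_iso (hρ : IsReflectionFaithful cs ρ) {t : W}
    (ht : cs.IsReflection t) {A : Set W} (hA : A = {1} ∨ A ∈ stableSets cs) :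
    Nonempty (GrBimod.shift 1 (graphBimod ρ (A ∪ (fun y => t * y) '' A)) ⊞
      GrBimod.shift (-1) (graphBimod ρ (A ∩ (fun y => t * y) '' A)) ≅
        reflBimod ρ t ⊗ graphBimod ρ A) := by
  obtain ⟨a, b, hab, hr, hrt⟩ := exists_sdiff_image_subset_pair cs hA ht
  obtain ⟨p, hpr, hpt⟩ := hρ.exists_comp_eq_and_sub_comp_ne_zero hr ht hrt
  -- With `r = ab⁻¹` and `p` invariant under `r`, the forms `p∘a` and `p∘b` coincide, so `λ`
  -- vanishes on `Gr(a)` and `Gr(b)`, hence on all graphs over `A \ tA`.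
  refine nonempty_reflTensor_iso (q := p ∘ₗ ρ a) ht.mul_self hpt
    (hρ.exists_sub_comp_eq_smul ht hpt) fun x hx htx => ?_
  have hx' : x ∈ ({a, b} : Set W) :=
    hab ⟨hx, fun h => htx ((mem_image_mul_iff ht.mul_self).1 h)⟩
  rcases hx' with rfl | rfl
  · rfl
  · conv_rhs => rw [← inv_mul_cancel_right a x, map_mul]
    rw [Module.End.mul_eq_comp, ← LinearMap.comp_assoc, hpr]

end Roots

/-! ### Homomorphisms between the bimodules `R(A)(n)` -/

section Homs

variable {W : Type*} [Group W] {V : Type u} [AddCommGroup V] [Module ℝ V]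
  {ρ : Representation ℝ W V}

/-- The functions on the graph of `x` are separated from those on the graphs of the elements of
`A`, if `x` is not in `A`. -/
theorem exists_evalGraph_ne_zero (hρ : Function.Injective ρ) {A : Set W} (hA : A.Finite) {x : W}
    (hx : x ∉ A) : ∃ z, (∀ y ∈ A, evalGraph ρ y z = 0) ∧ evalGraph ρ x z ≠ 0 := by
  induction A, hA using Set.Finite.induction_on with
  | empty =>
    refine ⟨1, fun y hy => hy.elim, ?_⟩
    rw [map_one]
    intro h
    exact one_ne_zero (congrArg (fun f : polyFun V => f.1 0) h)
  | @insert y A _ _ ih =>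
    obtain ⟨z, hz, hz'⟩ := ih fun h => hx (Set.mem_insert_of_mem y h)
    have hxy : ρ x ≠ ρ y := fun h => hx (by rw [hρ h]; exact Set.mem_insert y A)
    obtain ⟨φ, v, hφ⟩ : ∃ φ : Module.Dual ℝ V, ∃ v, φ (ρ x v) - φ (ρ y v) ≠ 0 := by
      by_contra! h
      refine hxy (LinearMap.ext fun v => sub_eq_zero.1 ?_)
      refine (Module.forall_dual_apply_eq_zero_iff ℝ _).1 fun φ => ?_
      rw [map_sub]
      exact h φ v
    refine ⟨diffForm φ (φ ∘ₗ ρ y) * z, ?_, ?_⟩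
    · rintro w (rfl | hw)
      · rw [map_mul, evalGraph_diffForm, sub_self, map_zero, zero_mul]
      · rw [map_mul, hz w hw, mul_zero]
    · rw [map_mul, evalGraph_diffForm]
      intro h
      refine hz' (eq_zero_of_linForm_mul_eq_zero (fun h0 => hφ ?_) h)
      exact LinearMap.congr_fun h0 v

variable (ρ) in
/-- The function `1`, as an element of `R(A)(n)`. -/
def shiftOne (A : Set W) (n : ℤ) : (GrBimod.shift n (graphBimod ρ A)).carrier :=
  GrBimod.toShift n (graphBimod ρ A) (graphOne ρ A)

variable {A B : Set W} {n m : ℤ}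

theorem exists_biact_shiftOne (f : (GrBimod.shift n (graphBimod ρ A)).carrier) :
    ∃ z, (GrBimod.shift n (graphBimod ρ A)).biact z (shiftOne ρ A n) = f :=
  exists_biact_graphOne (ρ := ρ) (A := A) f

theorem biact_shiftOne_eq_zero_iff {z : polyFun V ⊗[ℝ] polyFun V} :
    (GrBimod.shift n (graphBimod ρ A)).biact z (shiftOne ρ A n) = 0 ↔
      ∀ x ∈ A, evalGraph ρ x z = 0 :=
  biact_graphOne_eq_zero_iff (ρ := ρ) (A := A)

theorem shiftOne_ne_zero (hA : A.Nonempty) : shiftOne ρ A n ≠ 0 := graphOne_ne_zero hA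

/-- `R(A)` is generated by 1 as a bimodule, so a homomorphism is determined by the image of 1. -/
theorem graphShift_hom_ext {N : GrBimod (polyGrading V)}
    {f g : GrBimod.shift n (graphBimod ρ A) ⟶ N}
    (h : f.toLin (shiftOne ρ A n) = g.toLin (shiftOne ρ A n)) : f = g := by
  refine GrBimod.hom_ext fun w => ?_
  obtain ⟨z, rfl⟩ := exists_biact_shiftOne w
  rw [GrBimod.map_biact, GrBimod.map_biact, h]

/-- The function 1 has degree `-n` in `R(A)(n)`, so its image, viewed in the unshifted `R(B)`, has
degree `m - n`. As `R(B)` is zero in negative degrees and consists of constants in degree 0, this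
controls all maps with `m ≤ n`. -/
theorem map_shiftOne_mem
    (f : GrBimod.shift n (graphBimod ρ A) ⟶ GrBimod.shift m (graphBimod ρ B)) :
    (GrBimod.toShift m (graphBimod ρ B)).symm (f.toLin (shiftOne ρ A n)) ∈
      (graphBimod ρ B).deg (-n + m) := by
  refine f.map_deg (-n) (shiftOne ρ A n) ?_
  rw [shiftOne, GrBimod.mem_shift_deg, LinearEquiv.symm_apply_apply, neg_add_cancel]
  exact graphOne_mem (ρ := ρ)

theorem exists_map_shiftOne_eq_smul
    (f : GrBimod.shift n (graphBimod ρ A) ⟶ GrBimod.shift n (graphBimod ρ B)) :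
    ∃ c : ℝ, f.toLin (shiftOne ρ A n) = c • shiftOne ρ B n := by
  have h := map_shiftOne_mem f
  rw [neg_add_cancel] at h
  exact graphBimod_deg_zero (ρ := ρ) h

theorem graphShift_hom_eq_zero_of_lt (h : m < n)
    (f : GrBimod.shift n (graphBimod ρ A) ⟶ GrBimod.shift m (graphBimod ρ B)) : f = 0 :=
  graphShift_hom_ext (graphBimod_deg_neg (ρ := ρ) (by omega) (map_shiftOne_mem f))

/-- The endomorphisms of `R(A)(n)` are scalars. -/
theorem graphShift_exists_eq_smul
    (f : GrBimod.shift n (graphBimod ρ A) ⟶ GrBimod.shift n (graphBimod ρ A)) :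
    ∃ c : ℝ, f = c • 𝟙 _ := by
  obtain ⟨c, hc⟩ := exists_map_shiftOne_eq_smul f
  exact ⟨c, graphShift_hom_ext hc⟩

theorem graphShift_id_ne_zero (hA : A.Nonempty) :
    𝟙 (GrBimod.shift n (graphBimod ρ A)) ≠ 0 := fun h =>
  shiftOne_ne_zero hA (congrArg (fun f => GrBimod.Hom.toLin f (shiftOne ρ A n)) h)

/-- The map sends 1 to a nonzero constant, so everything annihilating 1 in `R(A)` annihilates 1 in
`R(B)`. An `x ∈ B \ A` is excluded by a function vanishing on the graphs of `A` but not on `Gr(x)`.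
-/
theorem subset_of_graphShift_hom_ne_zero [Finite W] (hρ : Function.Injective ρ)
    {f : GrBimod.shift n (graphBimod ρ A) ⟶ GrBimod.shift n (graphBimod ρ B)} (hf : f ≠ 0) :
    B ⊆ A := by
  obtain ⟨c, hc⟩ := exists_map_shiftOne_eq_smul f
  intro x hx
  by_contra hxA
  obtain ⟨z, hz, hzx⟩ := exists_evalGraph_ne_zero hρ A.toFinite hxA
  have h := GrBimod.map_biact f z (shiftOne ρ A n)
  rw [biact_shiftOne_eq_zero_iff.2 hz, map_zero, hc, map_smul] at h
  rcases smul_eq_zero.1 h.symm with rfl | h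
  · refine hf (graphShift_hom_ext ?_)
    rw [hc, zero_smul]
    rfl
  · exact hzx (biact_shiftOne_eq_zero_iff.1 h x hx)

/-- If the shifts differ, one of the two maps goes in the direction where only zero exists. If they
agree and both maps are nonzero, then `A ⊆ B` and `B ⊆ A`. -/
theorem graphShift_comp_eq_zero [Finite W] (hρ : Function.Injective ρ)
    (h : ¬(A = B ∧ n = m))
    (f : GrBimod.shift n (graphBimod ρ A) ⟶ GrBimod.shift m (graphBimod ρ B))
    (g : GrBimod.shift m (graphBimod ρ B) ⟶ GrBimod.shift n (graphBimod ρ A)) : f ≫ g = 0 := by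
  rcases lt_trichotomy n m with hnm | rfl | hnm
  · rw [graphShift_hom_eq_zero_of_lt hnm g, comp_zero]
  · by_contra h0
    have hf : f ≠ 0 := by
      rintro rfl
      exact h0 zero_comp
    have hg : g ≠ 0 := by
      rintro rfl
      exact h0 comp_zero
    exact h ⟨(subset_of_graphShift_hom_ne_zero hρ hg).antisymm
      (subset_of_graphShift_hom_ne_zero hρ hf), rfl⟩
  · rw [graphShift_hom_eq_zero_of_lt hnm f, zero_comp]

/-- The bimodules `R(A)(n)` are pairwise non-isomorphic. -/
theorem graphShift_iso_unique [Finite W] (hρ : Function.Injective ρ) (hA : A.Nonempty)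
    (e : GrBimod.shift n (graphBimod ρ A) ≅ GrBimod.shift m (graphBimod ρ B)) :
    A = B ∧ n = m := by
  by_contra h
  have h1 := graphShift_comp_eq_zero hρ h e.hom e.inv
  rw [e.hom_inv_id] at h1
  exact graphShift_id_ne_zero hA h1

theorem isZero_graphBimod_empty : IsZero (graphBimod ρ (∅ : Set W)) :=
  GrBimod.isZero_of_subsingleton ⟨fun _ _ => graphBimod_ext (ρ := ρ) fun _ hx => hx.elim⟩

/-- Endomorphisms are scalars. This is the form of locality needed for `FinSum.of_retract` and for
indecomposability. -/
theorem eq_zero_or_isIso_of_iso_graphShift {X : GrBimod (polyGrading V)}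
    (e : X ≅ GrBimod.shift n (graphBimod ρ A)) (f : X ⟶ X) : f = 0 ∨ IsIso f := by
  obtain ⟨c, hc⟩ := graphShift_exists_eq_smul (ρ := ρ) (A := A) (n := n) (e.inv ≫ f ≫ e.hom)
  have hf : f = c • 𝟙 X := by
    have h : f = e.hom ≫ (e.inv ≫ f ≫ e.hom) ≫ e.inv := by simp
    rw [h, hc]
    simp
  by_cases h0 : c = 0
  · left
    rw [hf, h0, zero_smul]
  · right
    refine ⟨c⁻¹ • 𝟙 X, ?_, ?_⟩ <;> rw [hf] <;> simp [h0]

end Homs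

/-! ### The indecomposable objects -/

section Indecomposable

/-- Apply the hypothesis to the projector onto `Y`: if it is zero, so is `Y`; if it is invertible,
its complement `Z` is zero. -/
theorem indecomposable_of_end {𝒞 : Type*} [Category 𝒞] [Preadditive 𝒞] [HasBinaryBiproducts 𝒞]
    {X : 𝒞} (h0 : ¬IsZero X) (h : ∀ f : X ⟶ X, f = 0 ∨ IsIso f) : Indecomposable X := by
  refine ⟨h0, fun Y Z e => ?_⟩
  let f : X ⟶ X := e.hom ≫ biprod.fst ≫ biprod.inl ≫ e.inv
  rcases h f with hf | hf
  · left
    rw [IsZero.iff_id_eq_zero]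
    have h1 : 𝟙 Y = (biprod.inl : Y ⟶ Y ⊞ Z) ≫ e.inv ≫ f ≫ e.hom ≫ biprod.fst := by simp [f]
    rw [h1, hf]
    simp
  · right
    rw [IsZero.iff_id_eq_zero]
    have h1 : f ≫ e.hom ≫ (biprod.snd : Y ⊞ Z ⟶ Z) = 0 := by simp [f]
    have h2 : e.hom ≫ (biprod.snd : Y ⊞ Z ⟶ Z) = 0 := by
      rw [← cancel_epi f, h1, comp_zero]
    have h3 : 𝟙 Z = (biprod.inr : Z ⟶ Y ⊞ Z) ≫ e.inv ≫ e.hom ≫ biprod.snd := by simp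
    rw [h3, h2]
    simp

variable {W : Type*} [Group W] {V : Type u} [AddCommGroup V] [Module ℝ V]
  {cs : CoxeterSystem (CoxeterMatrix.A 2) W} {ρ : Representation ℝ W V}

/-- The sets `A` for which `R(A)` is an indecomposable object of the category. -/
def elementarySets (cs : CoxeterSystem (CoxeterMatrix.A 2) W) : Set (Set W) :=
  insert {1} (stableSets cs)

variable (ρ cs) in
/-- The bimodules isomorphic to some `R(A)(n)`, with `A = {1}` or `A` stable under a reflection. -/
def IsElementary : ObjectProperty (GrBimod (polyGrading V)) := fun X =>
  ∃ A ∈ elementarySets cs, ∃ n : ℤ, Nonempty (X ≅ GrBimod.shift n (graphBimod ρ A))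

theorem nonempty_of_mem_elementarySets {A : Set W} (hA : A ∈ elementarySets cs) :
    A.Nonempty := by
  rcases hA with rfl | hA
  · exact Set.singleton_nonempty 1
  · exact hA.1

theorem IsElementary.of_mem {A : Set W} (hA : A ∈ elementarySets cs) (n : ℤ) :
    IsElementary cs ρ (GrBimod.shift n (graphBimod ρ A)) :=
  ⟨A, hA, n, ⟨Iso.refl _⟩⟩

theorem IsElementary.eq_zero_or_isIso {X : GrBimod (polyGrading V)} (hX : IsElementary cs ρ X)
    (f : X ⟶ X) : f = 0 ∨ IsIso f := by
  obtain ⟨A, -, n, ⟨e⟩⟩ := hX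
  exact eq_zero_or_isIso_of_iso_graphShift e f

theorem IsElementary.not_isZero {X : GrBimod (polyGrading V)} (hX : IsElementary cs ρ X) :
    ¬IsZero X := by
  obtain ⟨A, hA, n, ⟨e⟩⟩ := hX
  intro h
  exact graphShift_id_ne_zero (ρ := ρ) (n := n) (nonempty_of_mem_elementarySets hA)
    ((IsZero.iff_id_eq_zero _).1 (h.of_iso e.symm))

theorem IsElementary.shift {X : GrBimod (polyGrading V)} (hX : IsElementary cs ρ X) (k : ℤ) :
    IsElementary cs ρ (GrBimod.shift k X) := by
  obtain ⟨A, hA, n, ⟨e⟩⟩ := hX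
  exact ⟨A, hA, n + k, ⟨GrBimod.shiftIso k e ≪≫ GrBimod.shiftShift n k (graphBimod ρ A)⟩⟩

theorem IsElementary.finSum {X : GrBimod (polyGrading V)} (hX : IsElementary cs ρ X) :
    FinSum (IsElementary cs ρ) X :=
  .single hX (GrBimod.isZero_fixedBimod_zero X)

theorem finSum_shift {X : GrBimod (polyGrading V)} (hX : FinSum (IsElementary cs ρ) X) (k : ℤ) :
    FinSum (IsElementary cs ρ) (GrBimod.shift k X) :=
  FinSum.map (GrBimod.shiftFunctor k) (fun _ hY => (hY.shift k).finSum) hX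

theorem inter_image_mem_elementarySets {A : Set W} {t : W} (ht : cs.IsReflection t) :
    A ∩ (fun y => t * y) '' A = ∅ ∨ A ∩ (fun y => t * y) '' A ∈ elementarySets cs := by
  rcases (A ∩ (fun y => t * y) '' A).eq_empty_or_nonempty with h | h
  · exact Or.inl h
  · exact Or.inr (Or.inr (inter_image_mem_stableSets cs ht h))

theorem finSum_shift_graphBimod {A : Set W} (hA : A = ∅ ∨ A ∈ elementarySets cs) (n : ℤ) :
    FinSum (IsElementary cs ρ) (GrBimod.shift n (graphBimod ρ A)) := by
  rcases hA with rfl | hA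
  · exact .zero ((GrBimod.shiftFunctor n).map_isZero isZero_graphBimod_empty)
  · exact (IsElementary.of_mem hA n).finSum

/-- The splitting of `B_t ⊗ R(A)` shows that the finite direct sums are stable under `B_t ⊗ -`; the
part indexed by `A ∩ tA` may be zero. -/
theorem IsElementary.finSum_tensor (hρ : IsReflectionFaithful cs ρ) {t : W}
    (ht : cs.IsReflection t) {X : GrBimod (polyGrading V)} (hX : IsElementary cs ρ X) :
    FinSum (IsElementary cs ρ) (reflBimod ρ t ⊗ X) := by
  obtain ⟨A, hA, n, ⟨e⟩⟩ := hX
  obtain ⟨d⟩ := hρ.nonempty_tensor_iso ht hA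
  have h : FinSum (IsElementary cs ρ) (reflBimod ρ t ⊗ graphBimod ρ A) :=
    .of_iso d.symm (.biprod (finSum_shift_graphBimod (Or.inr (Or.inr
      (union_image_mem_stableSets cs (nonempty_of_mem_elementarySets hA) ht))) 1)
      (finSum_shift_graphBimod (inter_image_mem_elementarySets ht) (-1)))
  exact .of_iso ((tensorLeft (reflBimod ρ t)).mapIso e ≪≫
    GrBimod.tensorShift n (reflBimod ρ t) (graphBimod ρ A)) (finSum_shift h n)

/-- The objects of the category are the finite direct sums of the `R(A)(n)`. -/
theorem finSum_of_karoubiGenerated (hρ : IsReflectionFaithful cs ρ) {X : GrBimod (polyGrading V)}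
    (hX : GrBimod.karoubiGenerated
      (fun t : {t : W // cs.IsReflection t} => reflBimod ρ t.1) X) :
    FinSum (IsElementary cs ρ) X := by
  induction hX with
  | word l n =>
    refine finSum_shift ?_ n
    induction l with
    | nil =>
      exact IsElementary.finSum ⟨{1}, Set.mem_insert _ _, 0,
        ⟨regularIsoGraph ρ ≪≫ (GrBimod.shiftZero (graphBimod ρ {1})).symm⟩⟩
    | cons t l ih =>
      exact FinSum.map (tensorLeft (reflBimod ρ t.1)) (fun Y hY => hY.finSum_tensor hρ t.2) ih
  | biprod _ _ hM hN => exact .biprod hM hN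
  -- Direct summands are the only case needing the exchange argument, with endomorphisms zero or
  -- invertible and idempotents split.
  | retract r _ hN =>
    exact FinSum.of_retract (fun _ hY => hY.eq_zero_or_isIso) GrBimod.exists_complement hN r.i r.r
      r.retract

/-! ### Membership of the bimodules `R(A)` in the category -/

theorem GrBimod.karoubiGenerated_self {R : Type u} [CommRing R] [Algebra ℝ R]
    {𝒜 : ℤ → Submodule ℝ R} [GradedAlgebra 𝒜] {ι : Type*} (B : ι → GrBimod 𝒜) (i : ι) :
    GrBimod.karoubiGenerated B (B i) :=
  .of_iso ((GrBimod.rightUnitIso (B i)).symm ≪≫ (GrBimod.shiftZero _).symm) (.word [i] 0)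

theorem GrBimod.karoubiGenerated_of_shift {R : Type u} [CommRing R] [Algebra ℝ R]
    {𝒜 : ℤ → Submodule ℝ R} [GradedAlgebra 𝒜] {ι : Type*} {B : ι → GrBimod 𝒜} {X : GrBimod 𝒜}
    {n : ℤ} (h : GrBimod.karoubiGenerated B (GrBimod.shift n X)) :
    GrBimod.karoubiGenerated B X :=
  .of_iso ((GrBimod.shiftZero X).symm ≪≫ eqToIso (by rw [add_neg_cancel]) ≪≫
    (GrBimod.shiftShift n (-n) X).symm) (h.shift (-n))

theorem GrBimod.karoubiGenerated_of_biprod {R : Type u} [CommRing R] [Algebra ℝ R]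
    {𝒜 : ℤ → Submodule ℝ R} [GradedAlgebra 𝒜] {ι : Type*} {B : ι → GrBimod 𝒜}
    {X Y N : GrBimod 𝒜} (e : X ⊞ Y ≅ N) (h : GrBimod.karoubiGenerated B N) :
    GrBimod.karoubiGenerated B X ∧ GrBimod.karoubiGenerated B Y :=
  have h' := GrBimod.karoubiGenerated.of_iso e h
  ⟨.retract ⟨biprod.inl, biprod.fst, biprod.inl_fst⟩ h',
    .retract ⟨biprod.inr, biprod.snd, biprod.inr_snd⟩ h'⟩

variable (ρ cs) in
/-- The generating bimodules `B_t`. -/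
noncomputable abbrev reflFamily : {t : W // cs.IsReflection t} → GrBimod (polyGrading V) :=
  fun t => reflBimod ρ t.1

/-- The bimodules `R(A)` lie in the category. -/
theorem karoubiGenerated_graphBimod (hρ : IsReflectionFaithful cs ρ) {A : Set W}
    (hA : A ∈ elementarySets cs) :
    GrBimod.karoubiGenerated (reflFamily cs ρ) (graphBimod ρ A) := by
  have one : GrBimod.karoubiGenerated (reflFamily cs ρ) (graphBimod ρ {1}) :=
    .of_iso (regularIsoGraph ρ).symm (GrBimod.karoubiGenerated_regular _)
  -- The empty set is carried along because `A ∩ tA` can be empty on the way. Both summands of `B_t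
  -- ⊗ R(A)` lie in the category, which is closed under summands and shifts.
  have step : ∀ A, (A = ∅ ∨ A ∈ elementarySets cs) ∧
      GrBimod.karoubiGenerated (reflFamily cs ρ) (graphBimod ρ A) → ∀ t, cs.IsReflection t →
      GrBimod.karoubiGenerated (reflFamily cs ρ) (graphBimod ρ (A ∪ (fun y => t * y) '' A)) ∧
      GrBimod.karoubiGenerated (reflFamily cs ρ)
        (graphBimod ρ (A ∩ (fun y => t * y) '' A)) := by
    rintro A ⟨rfl | hA, h⟩ t ht
    · rw [Set.image_empty, Set.union_empty, Set.inter_empty]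
      exact ⟨h, h⟩
    · obtain ⟨e⟩ := hρ.nonempty_tensor_iso ht hA
      have h' := GrBimod.karoubiGenerated_of_biprod e
        ((GrBimod.karoubiGenerated_self (reflFamily cs ρ) ⟨t, ht⟩).tensor h)
      exact ⟨GrBimod.karoubiGenerated_of_shift h'.1, GrBimod.karoubiGenerated_of_shift h'.2⟩
  rcases hA with rfl | hA
  · exact one
  · refine (stableSets_induction cs (p := fun A => (A = ∅ ∨ A ∈ elementarySets cs) ∧
      GrBimod.karoubiGenerated (reflFamily cs ρ) (graphBimod ρ A))
      ⟨Or.inr (Set.mem_insert _ _), one⟩ ?_ ?_ hA).2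
    · intro A hA t ht
      refine ⟨?_, (step A hA t ht).1⟩
      rcases hA.1 with rfl | hA
      · left
        rw [Set.image_empty, Set.union_empty]
      · exact Or.inr (Or.inr (union_image_mem_stableSets cs
          (nonempty_of_mem_elementarySets hA) ht))
    · intro A hA t ht
      exact ⟨inter_image_mem_elementarySets ht, (step A hA t ht).2⟩

end Indecomposable

/-! ### The split Grothendieck ring -/

section Grothendieck

variable {W : Type*} [Group W] {V : Type u} [AddCommGroup V] [Module ℝ V]
  {cs : CoxeterSystem (CoxeterMatrix.A 2) W} {ρ : Representation ℝ W V}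

/-- Each partial sum is a complement in an object of `Q`, so `hQ` keeps it in the subcategory. The
biproducts there are compared with the ambient ones through the additive inclusion functor. -/
theorem FinSum.fullSubcategory {𝒞 : Type*} [Category 𝒞] [Preadditive 𝒞]
    [HasBinaryBiproducts 𝒞] {Q P : ObjectProperty 𝒞} [HasBinaryBiproducts Q.FullSubcategory]
    (hPQ : ∀ X, P X → Q X) (hQ : ∀ X Y Z : 𝒞, (Z ≅ X ⊞ Y) → Q Z → Q Y) {X : 𝒞}
    (h : FinSum P X) (hX : Q X) : FinSum (fun Y : Q.FullSubcategory => P Y.obj) ⟨X, hX⟩ := by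
  induction h with
  | zero h =>
    refine .zero ((IsZero.iff_id_eq_zero _).2 (ObjectProperty.hom_ext _ ?_))
    exact h.eq_of_src _ _
  | @cons Y M N hY _ e ih =>
    have hM := hQ Y M N e hX
    obtain ⟨Y', rfl⟩ : ∃ Y' : Q.FullSubcategory, Y'.obj = Y := ⟨⟨Y, hPQ Y hY⟩, rfl⟩
    have e' : (⟨N, hX⟩ : Q.FullSubcategory) ≅ Y' ⊞ ⟨M, hM⟩ :=
      ObjectProperty.isoMk _ (e ≪≫ (mapBiprodIso Q.ι Y' ⟨M, hM⟩).symm)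
    exact .cons hY (ih hM) e'

variable (ρ) in
/-- The bimodule `R(A)(n)`, as an object of the category. -/
def graphObj (hρ : IsReflectionFaithful cs ρ) {A : Set W} (hA : A ∈ elementarySets cs) (n : ℤ) :
    ReflCat ρ cs :=
  ⟨GrBimod.shift n (graphBimod ρ A), (karoubiGenerated_graphBimod hρ hA).shift n⟩

theorem finSum_reflCat (hρ : IsReflectionFaithful cs ρ) (X : ReflCat ρ cs) :
    FinSum (fun Y : ReflCat ρ cs => IsElementary cs ρ Y.obj) X := by
  refine FinSum.fullSubcategory ?_ ?_ (finSum_of_karoubiGenerated hρ X.property) X.property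
  · rintro Y ⟨A, hA, n, ⟨e⟩⟩
    exact .of_iso e ((karoubiGenerated_graphBimod hρ hA).shift n)
  · intro X Y Z e h
    exact (GrBimod.karoubiGenerated_of_biprod e.symm h).2

theorem not_isZero_of_isElementary {X : ReflCat ρ cs} (hX : IsElementary cs ρ X.obj) :
    ¬IsZero X := fun h =>
  hX.not_isZero ((ObjectProperty.ι _).map_isZero h)

/-- An indecomposable object is a finite sum of elementary ones, so its first summand is already
everything. The converse holds because endomorphisms of an elementary object are zero or invertible.
-/
theorem indecomposable_iff_isElementary (hρ : IsReflectionFaithful cs ρ) (X : ReflCat ρ cs) :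
    Indecomposable X ↔ IsElementary cs ρ X.obj := by
  constructor
  · rintro ⟨h0, h⟩
    cases finSum_reflCat hρ X with
    | zero hX => exact (h0 hX).elim
    | @cons Y M _ hY _ e =>
      have hM := (h Y M e).resolve_left (not_isZero_of_isElementary hY)
      obtain ⟨A, hA, n, ⟨f⟩⟩ := hY
      exact ⟨A, hA, n, ⟨(ObjectProperty.ι _).mapIso (e ≪≫ FinSum.biprodZeroIso Y hM) ≪≫ f⟩⟩
  · intro h
    refine indecomposable_of_end (not_isZero_of_isElementary h) fun f => ?_
    rcases h.eq_zero_or_isIso f.hom with hf | hf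
    · exact Or.inl (ObjectProperty.hom_ext _ hf)
    · exact Or.inr ((ObjectProperty.isIso_hom_iff f).1 hf)

/-- Each summand of `X` contributes either a line or zero. -/
theorem finite_homModRad_graphShift [Finite W] (hρ : IsReflectionFaithful cs ρ) {A : Set W}
    (hA : A.Nonempty) (n : ℤ) (X : ReflCat ρ cs) :
    Module.Finite ℝ (HomModRad ℝ (GrBimod.shift n (graphBimod ρ A)) X.obj) := by
  refine FinSum.finite_homModRad ℝ _ ?_ (finSum_of_karoubiGenerated hρ X.property)
  rintro Y ⟨B, hB, m, ⟨e⟩⟩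
  by_cases h : A = B ∧ n = m
  · obtain ⟨rfl, rfl⟩ := h
    have := Module.Finite.equiv (homModRadSelf ℝ _
      (graphShift_exists_eq_smul (ρ := ρ) (A := A) (n := n)) (graphShift_id_ne_zero hA))
    exact Module.Finite.equiv (homModRadCongr ℝ _ e).symm
  · have := subsingleton_homModRad ℝ (graphShift_comp_eq_zero (ρ := ρ) hρ.injective h)
    exact Module.Finite.equiv (homModRadCongr ℝ _ e).symm

-- On the diagonal only scalars occur; off the diagonal every composition back is zero.
open Classical in
theorem homMultiplicity_graphShift [Finite W] (hρ : IsReflectionFaithful cs ρ) {A : Set W}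
    (hA : A.Nonempty) (B : Set W) (n m : ℤ) :
    homMultiplicity ℝ (GrBimod.shift n (graphBimod ρ A)) (GrBimod.shift m (graphBimod ρ B)) =
      if A = B ∧ n = m then 1 else 0 := by
  split_ifs with h
  · obtain ⟨rfl, rfl⟩ := h
    exact homMultiplicity_self ℝ _ (graphShift_exists_eq_smul (ρ := ρ) (A := A) (n := n))
      (graphShift_id_ne_zero hA)
  · exact homMultiplicity_eq_zero ℝ (graphShift_comp_eq_zero hρ.injective h)

open Classical in
/-- The multiplicity of `R(A)(n)`, as a function on the split Grothendieck ring. -/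
theorem exists_multiplicity [Finite W] (hρ : IsReflectionFaithful cs ρ) {A : Set W}
    (hA : A ∈ elementarySets cs) (n : ℤ) :
    ∃ χ : SplitK0 (ReflCat ρ cs) →+ ℤ, ∀ (B : Set W) (hB : B ∈ elementarySets cs) (m : ℤ),
      χ (splitClass (graphObj ρ hρ hB m)) = if A = B ∧ n = m then 1 else 0 := by
  have hA' := nonempty_of_mem_elementarySets hA
  refine ⟨splitLift (fun X : ReflCat ρ cs =>
    (homMultiplicity ℝ (GrBimod.shift n (graphBimod ρ A)) X.obj : ℤ)) ?_ ?_, ?_⟩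
  · intro X Y e
    exact congrArg _ (homMultiplicity_eq_of_iso ℝ _ ((ObjectProperty.ι _).mapIso e))
  · intro X Y
    have := finite_homModRad_graphShift hρ hA' n X
    have := finite_homModRad_graphShift hρ hA' n Y
    rw [← Nat.cast_add, ← homMultiplicity_biprod]
    exact congrArg _ (homMultiplicity_eq_of_iso ℝ _ (mapBiprodIso (ObjectProperty.ι _) X Y))
  · intro B hB m
    rw [splitLift_splitClass]
    change ((homMultiplicity ℝ (GrBimod.shift n (graphBimod ρ A))
      (GrBimod.shift m (graphBimod ρ B)) : ℕ) : ℤ) = _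
    rw [homMultiplicity_graphShift hρ hA']
    split_ifs <;> rfl

variable (ρ) in
/-- The class of `R(A)` in the split Grothendieck ring. -/
noncomputable def graphClass (hρ : IsReflectionFaithful cs ρ) (A : elementarySets cs) :
    SplitK0 (ReflCat ρ cs) :=
  splitClass (graphObj ρ hρ A.2 0)

theorem T_smul_graphClass (hρ : IsReflectionFaithful cs ρ) (A : elementarySets cs) (n : ℤ) :
    (LaurentPolynomial.T n : LaurentPolynomial ℤ) • graphClass ρ hρ A =
      splitClass (graphObj ρ hρ A.2 n) := by
  refine (GrBimod.T_smul_splitClass _ n (graphObj ρ hρ A.2 0)).trans (splitClass_eq ?_)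
  exact ObjectProperty.isoMk _ (GrBimod.shiftShift 0 n (graphBimod ρ A.1) ≪≫
    eqToIso (by rw [zero_add]; rfl))

/-- Every object is a finite sum of bimodules `R(A)(n)`, and `[R(A)(n)] = vⁿ [R(A)]`. -/
theorem span_graphClass (hρ : IsReflectionFaithful cs ρ) :
    ⊤ ≤ Submodule.span (LaurentPolynomial ℤ) (Set.range (graphClass ρ hρ)) := by
  have key : ∀ X : ReflCat ρ cs, splitClass X ∈
      Submodule.span (LaurentPolynomial ℤ) (Set.range (graphClass ρ hρ)) := by
    intro X
    induction finSum_reflCat hρ X with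
    | zero h =>
      rw [splitClass_eq_zero h]
      exact zero_mem _
    | @cons Y M N hY _ e ih =>
      rw [splitClass_eq e, splitClass_biprod]
      refine add_mem ?_ ih
      obtain ⟨A, hA, n, ⟨f⟩⟩ := hY
      rw [splitClass_eq (ObjectProperty.isoMk _ f : Y ≅ graphObj ρ hρ hA n),
        ← T_smul_graphClass hρ ⟨A, hA⟩ n]
      exact Submodule.smul_mem _ _ (Submodule.subset_span ⟨_, rfl⟩)
  rintro x -
  induction x using splitClass_induction with
  | h X => exact key X
  | h0 => exact zero_mem _
  | hadd x y hx hy => exact add_mem hx hy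
  | hneg x hx => exact neg_mem hx

/-- The multiplicity of `R(A)(n)`, applied to a linear combination, reads off the coefficient of
`vⁿ` in front of `[R(A)]`. -/
theorem linearIndependent_graphClass [Finite W] (hρ : IsReflectionFaithful cs ρ) :
    LinearIndependent (LaurentPolynomial ℤ) (graphClass ρ hρ) := by
  classical
  have := Fintype.ofFinite (elementarySets cs)
  rw [Fintype.linearIndependent_iff]
  intro c hc A
  ext n
  obtain ⟨χ, hχ⟩ := exists_multiplicity hρ A.2 n
  -- By additivity this reduces to monomials `k vᵐ`, where it is `k` times the multiplicity of
  -- `R(A)(n)` in `R(B)(m)`.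
  have key : ∀ (B : elementarySets cs) (p : LaurentPolynomial ℤ),
      χ (p • graphClass ρ hρ B) = if A = B then p.coeff n else 0 := by
    intro B p
    induction p using LaurentPolynomial.induction_on' with
    | add p q hp hq =>
      rw [add_smul, map_add, hp, hq]
      split_ifs
      · rfl
      · exact add_zero 0
    | C_mul_T m k =>
      have hk : (LaurentPolynomial.C k * LaurentPolynomial.T m : LaurentPolynomial ℤ) =
        k • LaurentPolynomial.T m := by rw [LaurentPolynomial.smul_eq_C_mul]
      rw [hk, smul_assoc, map_zsmul, T_smul_graphClass, hχ]
      by_cases hAB : A = B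
      · subst hAB
        rw [if_pos rfl, AddMonoidAlgebra.coeff_smul, Finsupp.smul_apply,
          LaurentPolynomial.T_apply]
        simp only [true_and, eq_comm]
      · rw [if_neg hAB, if_neg (fun h => hAB (Subtype.ext h.1)), smul_zero]
  have h := congrArg χ hc
  rw [map_sum, map_zero] at h
  simp only [key] at h
  rw [Finset.sum_ite_eq, if_pos (Finset.mem_univ _)] at h
  exact h

/-- The classes of the bimodules `R(A)` are a basis of the split Grothendieck ring. -/
noncomputable def graphClassBasis [Finite W] (hρ : IsReflectionFaithful cs ρ) :
    Module.Basis (elementarySets cs) (LaurentPolynomial ℤ) (SplitK0 (ReflCat ρ cs)) :=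
  .mk (linearIndependent_graphClass hρ) (span_graphClass hρ)

end Grothendieck

/-! ### The main theorem -/

theorem mainTheorem1 {W : Type*} [Group W] (cs : CoxeterSystem (CoxeterMatrix.A 2) W)
    {V : Type*} [AddCommGroup V] [Module ℝ V] (ρ : Representation ℝ W V)
    (hρ : IsReflectionFaithful cs ρ) :
    -- the indecomposable objects of the category generated by the bimodules `B_t` are the shifts
    -- of `R` and of the bimodules `R(A)`
    (∀ X : ReflCat ρ cs, Indecomposable X ↔
      (∃ n : ℤ, Nonempty (X.obj ≅ (GrBimod.regular (polyGrading V)).shift n)) ∨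
      ∃ A ∈ stableSets cs, ∃ n : ℤ, Nonempty (X.obj ≅ (graphBimod ρ A).shift n)) ∧
    -- all of these occur
    (∀ n : ℤ, ∃ X : ReflCat ρ cs, Nonempty (X.obj ≅ (GrBimod.regular (polyGrading V)).shift n)) ∧
    (∀ A ∈ stableSets cs, ∀ n : ℤ,
      ∃ X : ReflCat ρ cs, Nonempty (X.obj ≅ (graphBimod ρ A).shift n)) ∧
    -- and they are pairwise not isomorphic
    (∀ n m : ℤ, Nonempty ((GrBimod.regular (polyGrading V)).shift n ≅
      (GrBimod.regular (polyGrading V)).shift m) → n = m) ∧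
    (∀ A ∈ stableSets cs, ∀ n m : ℤ,
      IsEmpty ((GrBimod.regular (polyGrading V)).shift n ≅ (graphBimod ρ A).shift m)) ∧
    (∀ A ∈ stableSets cs, ∀ A' ∈ stableSets cs, ∀ n m : ℤ,
      Nonempty ((graphBimod ρ A).shift n ≅ (graphBimod ρ A').shift m) → A = A' ∧ n = m) ∧
    -- there are 19 subsets `A`
    (stableSets cs).ncard = 19 ∧
    -- the split Grothendieck ring
    Module.Free (LaurentPolynomial ℤ) (SplitK0 (ReflCat ρ cs)) ∧
    Module.finrank (LaurentPolynomial ℤ) (SplitK0 (ReflCat ρ cs)) = 20 := by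
  have hfin : Finite W := finite_typeATwo cs
  -- Replacing `R` by `R({1})` lets one treat it on the same footing as the other `R(A)`.
  have hreg : ∀ n : ℤ, GrBimod.shift n (GrBimod.regular (polyGrading V)) ≅
      GrBimod.shift n (graphBimod ρ {1}) := fun n => GrBimod.shiftIso n (regularIsoGraph ρ)
  have hone : ({1} : Set W) ∈ elementarySets cs := Set.mem_insert _ _
  refine ⟨fun X => ?_, fun n => ⟨graphObj ρ hρ hone n, ⟨(hreg n).symm⟩⟩,
    fun A hA n => ⟨graphObj ρ hρ (Set.mem_insert_of_mem _ hA) n, ⟨Iso.refl _⟩⟩, ?_, ?_, ?_,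
    ncard_stableSets cs, ?_, ?_⟩
  · rw [indecomposable_iff_isElementary hρ]
    constructor
    · rintro ⟨A, rfl | hA, n, ⟨e⟩⟩
      · exact Or.inl ⟨n, ⟨e ≪≫ (hreg n).symm⟩⟩
      · exact Or.inr ⟨A, hA, n, ⟨e⟩⟩
    · rintro (⟨n, ⟨e⟩⟩ | ⟨A, hA, n, ⟨e⟩⟩)
      · exact ⟨{1}, hone, n, ⟨e ≪≫ hreg n⟩⟩
      · exact ⟨A, Set.mem_insert_of_mem _ hA, n, ⟨e⟩⟩
  · rintro n m ⟨e⟩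
    exact (graphShift_iso_unique hρ.injective (Set.singleton_nonempty 1)
      ((hreg n).symm ≪≫ e ≪≫ hreg m)).2
  · intro A hA n m
    refine ⟨fun e => singleton_one_notMem_stableSets cs ?_⟩
    have h := (graphShift_iso_unique hρ.injective (Set.singleton_nonempty 1)
      ((hreg n).symm ≪≫ e)).1
    rwa [h]
  · rintro A hA A' _ n m ⟨e⟩
    exact graphShift_iso_unique hρ.injective hA.1 e
  · exact Module.Free.of_basis (graphClassBasis hρ)
  -- The basis is indexed by `{1}` and the 19 stable sets, and `{1}` is not stable.
  · rw [Module.finrank_eq_nat_card_basis (graphClassBasis hρ), Nat.card_coe_set_eq,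
      elementarySets, Set.ncard_insert_of_notMem (singleton_one_notMem_stableSets cs)
        (Set.toFinite _), ncard_stableSets cs]
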